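/- All graphs are finite and loopless, but may have multiple edges; all posets are finite. An edge of a graph is *multiple* if another edge has the same endpoints, and *simple* otherwise; a *bundle* is a maximal set of (at least two) multiple edges with the same endpoints. For a graph $H$ let $\mathcal C_H$ be the set consisting of the vertices and the multiple edges of $H$. A subgraph $I$ of $H$ is *induced* (respectively *semi-induced*) if it contains all edges (respectively at least one edge) of $H$ between any two vertices of $I$ that are adjacent in $H$. A *PI-graph* of $G$ is an induced subgraph of a graph obtained from $G$ by replacing some (possibly none) of its bundles with simple edges. For a connected graph $H$, a set $A\subseteq\mathcal C_H$ is *admissible* to $H$ if $|A\cap V(H)|$ is even, each vertex incident only to simple edges of $H$ lies in $A$, and for each bundle $B$ of $H$ the set $B\cap A$ is nonempty and $|B\cap A|$ is even. For a disconnected $H$, $A\subseteq\mathcal C_H$ is admissible to $H$ if $A\cap\mathcal C_{H'}$ is admissible to each component $H'$ of $H$. Let $\mathcal A^*(G)$ be the set of pairs $(H,A)$ with $H$ a PI-graph of $G$ and $A$ admissible to $H$. For $(H,A)\in\mathcal A^*(G)$ let $\mathcal P^{\mathrm{even}}_{H,A}$ be the poset, ordered by subgraph containment, of all semi-induced subgraphs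 $I$ of $H$ (including $\emptyset$ and $H$) such that every component of $I$ contains an even number of elements (vertices and edges) of $A$. A finite simplicial complex is *shellable* if its facets can be ordered $F_1,\dots,F_t$ so that for each $k=2,\dots,t$ the complex $\bigl(\bigcup_{i<k}\overline{F_i}\bigr)\cap\overline{F_k}$ is pure of dimension $\dim F_k-1$; a poset is *shellable* if the complex of its chains is. Let $\mathcal G^*$ be the family of all graphs $G$ such that $\mathcal P^{\mathrm{even}}_{H,A}$ is shellable for every $(H,A)\in\mathcal A^*(G)$. A bounded poset $\mathcal P$ (one with a least element $\hat 0$ and a greatest element $\hat 1$) is *CL-shellable* if the covers along its maximal chains can be labeled, for each maximal chain, by elements of some poset $L$ so that (i) if two maximal chains coincide along their bottom $d$ covers, then their labels coincide along these covers, and (ii) for all $x\le y$ and each maximal chain $r$ of $[\hat 0,x]$, among the maximal chains of $[x,y]$, labeled along $r$, there is a unique one with strictly increasing labels, and its label word lexicographically precedes the label words of all the others. **Theorem.** For every $G\in\mathcal G^*$ and every $(H,A)\in\mathcal A^*(G)$, the poset $\mathcal P^{\mathrm{even}}_{H,A}$ is CL-shellable. -/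

import Mathlib

open scoped Graph

namespace EvenSubgraph

section Shellability

variable {ι P : Type*}

/-- A facet of a simplicial complex is an inclusion-maximal face. -/
def IsFacet (K : PreAbstractSimplicialComplex ι) (F : Finset ι) : Prop :=
  Maximal (fun s => s ∈ K.faces) F

/-- The faces (the empty face included) of the intersection of the simplex spanned by `L[k]`
with the union of the simplices spanned by `L[0], …, L[k - 1]`. -/
def earlierFaces (L : List (Finset ι)) (k : ℕ) (hk : k < L.length) : Set (Finset ι) :=
  {s | s ⊆ L[k] ∧ ∃ (i : ℕ) (hi : i < k), s ⊆ L[i]}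

/-- A (possibly nonpure) shelling of a finite simplicial complex: a linear order of its facets
such that each facet after the first meets the subcomplex generated by the earlier ones in a
pure complex whose dimension is one less than the dimension of that facet. Since a face `s` has
dimension `s.card - 1`, this says that every maximal face of the intersection has one vertex less
than the facet. -/
structure IsShelling (K : PreAbstractSimplicialComplex ι) (L : List (Finset ι)) : Prop where
  nodup : L.Nodup
  mem_iff : ∀ F, F ∈ L ↔ IsFacet K F
  pure : ∀ (k : ℕ) (hk : k < L.length), 0 < k →
    ∀ s, Maximal (fun s => s ∈ earlierFaces L k hk) s → s.card + 1 = (L[k]).card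

/-- A simplicial complex is shellable if it has a shelling. -/
def ShellableComplex (K : PreAbstractSimplicialComplex ι) : Prop :=
  ∃ L : List (Finset ι), IsShelling K L

/-- The order complex of a poset: its faces are the nonempty finite chains. -/
def orderComplex (P : Type*) [PartialOrder P] : PreAbstractSimplicialComplex P where
  faces := {s | s.Nonempty ∧ IsChain (· ≤ ·) (s : Set P)}
  isRelLowerSet_faces := fun {_} hs =>
    ⟨hs.1, fun {_} hts ht => ⟨ht, hs.2.mono (Finset.coe_subset.mpr hts)⟩⟩

/-- A finite poset is shellable if its order complex is. -/
def Shellable (P : Type*) [PartialOrder P] : Prop :=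
  ShellableComplex (orderComplex P)

/-- `c` lists, from bottom to top, a saturated chain `x ⋖ ⋯ ⋖ y`. In a finite poset these are the
maximal chains of the closed interval `[x, y]`. -/
def IsSaturated [PartialOrder P] (x y : P) (c : List P) : Prop :=
  c.head? = some x ∧ c.getLast? = some y ∧ c.IsChain (· ⋖ ·)

/-- The concatenation of saturated chains `r` (ending at `x`), `m` (from `x` to `y`) and
`t` (starting at `y`). -/
def glue (r m t : List P) : List P := r ++ m.tail ++ t.tail

/-- The labels, from bottom to top, of the covers of the chain `m`, read along the maximal chain
`glue r m t`. Here `ρ σ i` is the label which the maximal chain `σ` gives to its `i`-th cover,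
counted from the bottom and from zero. -/
def labelWord {L : Type*} (ρ : List P → ℕ → L) (r m t : List P) : List L :=
  (List.range (m.length - 1)).map fun i => ρ (glue r m t) (r.length - 1 + i)

/-- `ρ` is a chain-lexicographic labeling of the poset `P` with bottom `b` and top `u`.
* `compat`: it is a chain-edge labeling, that is, if two maximal chains coincide along their bottom
  `d` covers, then so do their labels along these covers.
* `increasing`: for each `x ≤ y` and each maximal chain `r` of `[b, x]`, the rooted interval
  `[x, y]_r` has a unique maximal chain `m` whose labels strictly increase, and the label word of
  `m` lexicographically precedes that of every other maximal chain of `[x, y]_r`. The labels are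
  read along maximal chains of `P`, continued above `y` by `t`; by `compat` they do not depend on
  the choice of `t`. -/
structure IsCLLabeling [PartialOrder P] (b u : P) {L : Type*} [PartialOrder L]
    (ρ : List P → ℕ → L) : Prop where
  compat : ∀ σ τ : List P, IsSaturated b u σ → IsSaturated b u τ →
    ∀ d : ℕ, σ.take (d + 1) = τ.take (d + 1) → ∀ i < d, ρ σ i = ρ τ i
  increasing : ∀ x y : P, x ≤ y → ∀ r t : List P, IsSaturated b x r → IsSaturated y u t →
    ∃ m : List P, IsSaturated x y m ∧ (labelWord ρ r m t).IsChain (· < ·) ∧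
      ∀ m' : List P, IsSaturated x y m' → m' ≠ m →
        ¬ (labelWord ρ r m' t).IsChain (· < ·) ∧
          List.Lex (· < ·) (labelWord ρ r m t) (labelWord ρ r m' t)

/-- A finite poset is CL-shellable if it is bounded and admits a chain-lexicographic labeling by
some poset of labels. -/
def CLShellable (P : Type*) [PartialOrder P] : Prop :=
  ∃ b u : P, IsBot b ∧ IsTop u ∧
    ∃ (L : Type) (_ : PartialOrder L) (ρ : List P → ℕ → L), IsCLLabeling b u ρ

end Shellability

section Graphs

variable {α β : Type*}

/-- An edge is multiple if another edge has the same endpoints. -/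
def IsMultiple (G : Graph α β) (e : β) : Prop :=
  ∃ e' x y, e' ≠ e ∧ G.IsLink e x y ∧ G.IsLink e' x y

/-- A bundle is the set of all edges between two vertices, provided that there are at least two
such edges. -/
def IsBundle (G : Graph α β) (B : Set β) : Prop :=
  B.Nontrivial ∧ ∃ x y, B = {e | G.IsLink e x y}

/-- `I` is a semi-induced subgraph of `G`: it has at least one edge between any two of its vertices
which are adjacent in `G`. -/
def IsSemiInduced (I G : Graph α β) : Prop :=
  I ≤ G ∧ ∀ x ∈ V(I), ∀ y ∈ V(I), G.Adj x y → I.Adj x y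

/-- `H` is obtained from `G` by replacing some bundles with simple edges: between any two vertices,
`H` keeps either all edges of `G` or exactly one of them. -/
def IsPartialUnderlying (H G : Graph α β) : Prop :=
  H ≤s G ∧ ∀ x y, (∀ e, G.IsLink e x y → H.IsLink e x y) ∨ ∃! e, H.IsLink e x y

/-- `H` is a PI-graph of `G`: an induced subgraph of a partial underlying graph of `G`. -/
def IsPIGraph (H G : Graph α β) : Prop :=
  ∃ G' : Graph α β, IsPartialUnderlying G' G ∧ H.IsInducedSubgraph G'

/-- `K` is a connected component of `G`. -/
def IsComponent (K G : Graph α β) : Prop :=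
  ∃ x ∈ V(G), K = G.induce {y | Relation.ReflTransGen G.Adj x y}

/-- The set `𝒞_G` of all vertices and all multiple edges of `G`. -/
def labels (G : Graph α β) : Set (α ⊕ β) :=
  Sum.inl '' V(G) ∪ Sum.inr '' {e | IsMultiple G e}

/-- Admissibility of `A ⊆ 𝒞_H` for a connected graph `H`. -/
structure AdmissibleConn (H : Graph α β) (A : Set (α ⊕ β)) : Prop where
  even_vertices : Even (A ∩ Sum.inl '' V(H)).ncard
  mem_of_simple : ∀ v ∈ V(H), (∀ e, H.Inc e v → ¬ IsMultiple H e) → Sum.inl v ∈ A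
  bundle_nonempty : ∀ B, IsBundle H B → (A ∩ Sum.inr '' B).Nonempty
  bundle_even : ∀ B, IsBundle H B → Even (A ∩ Sum.inr '' B).ncard

/-- `A` is an admissible collection of `H`. -/
def Admissible (H : Graph α β) (A : Set (α ⊕ β)) : Prop :=
  A ⊆ labels H ∧ ∀ K, IsComponent K H → AdmissibleConn K (A ∩ labels K)

/-- Every component of `I` has an even number of vertices and edges in `A`. -/
def IsEven (A : Set (α ⊕ β)) (I : Graph α β) : Prop :=
  ∀ K, IsComponent K I → Even (A ∩ (Sum.inl '' V(K) ∪ Sum.inr '' E(K))).ncard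

/-- The poset of all `A`-even semi-induced subgraphs of `H`, ordered by subgraph containment
(for an admissible collection `A` of `H`). -/
abbrev EvenPoset (H : Graph α β) (A : Set (α ⊕ β)) : Type _ :=
  {I : Graph α β // IsSemiInduced I H ∧ IsEven A I}

/-- The set `𝒜*(G)` of pairs of a PI-graph `H` of `G` and an admissible collection of `H`. -/
def AStar (G : Graph α β) : Set (Graph α β × Set (α ⊕ β)) :=
  {p | IsPIGraph p.1 G ∧ Admissible p.1 p.2}

/-- The family `𝒢*` of finite loopless graphs all of whose posets of even subgraphs, for the pairs
in `𝒜*(G)`, are shellable. -/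
structure IsGStar (G : Graph α β) : Prop where
  finite_vertexSet : V(G).Finite
  finite_edgeSet : E(G).Finite
  loopless : G.Loopless
  shellable : ∀ p ∈ AStar G, Shellable (EvenPoset p.1 p.2)

end Graphs

end EvenSubgraph

/-! A finite bounded poset is CL-shellable once it has a recursive atom ordering. This is packaged
in `IsAtomOrder` as a precedence relation on the covers of each element, all of whose linear
extensions work; `IsAtomOrder.clShellable` turns such a relation into an integer chain labeling, and
`IsAtomOrder.pi` passes to products.

A semi-induced subgraph of `H` is determined by its vertices and those of its edges that are
multiple in `H`, called tokens. Let a multiple edge be adjacent to its ends and give each token the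
weight 1 or 0 in `ZMod 2` according to membership in `A`. Evenness then says that every component of
the token set has weight 0 (`isEven_iff`), and the poset becomes a product over the components of
`H` (`evenPosetIso`, `tokenOkIso`). In a component without bundles every token is odd. There any two
covers of a set that lie below `Y` have a common cover below `Y` (`exists_cov_superset`), so any
order of the atoms works.

Shellability enters only through two structural facts about `G`: a component contains at most one
bundle (`IsGStar.bundlesSeparated`), and a bundle together with an even set of vertices avoiding its
ends has at most one further neighbor (`IsGStar.uniqueNeighbor`). If either fails, a suitable
PI-graph and admissible set give an interval whose open part splits into two unrelated pieces
without isolated points (`not_shellable_of_bundle`), which no shellable poset has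
(`not_shellable_of_disconnected`). Both facts are inherited by subgraphs, hence by `H`.

It remains to order the covers in a component with exactly one bundle (`BundleModel`). Away from the
bundle everything is odd and semimodular; failures arise only where the ends of the bundle are
added. The order therefore favors covers that bring in a missing end, ties being broken by a rank on
vertices. The unique-neighbor condition makes the way of entering the bundle through an odd end
essentially unique, which gives exchange and coherence (`BundleModel.exchange`,
`BundleModel.coherent`). -/

namespace EvenSubgraph

/-! ### Recursive atom orders and the chain labelings they produce. -/

section AtomOrders

variable {P : Type*} [PartialOrder P]

/-- A precedence relation `R x a b` ("`a` has to come before `b`") on the covers of the elements `x`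
of a poset, all of whose linear extensions can be used in a recursive atom ordering. -/
structure IsAtomOrder (R : P → P → P → Prop) : Prop where
  irrefl : ∀ x a, ¬ R x a a
  trans : ∀ x a b c, x ⋖ a → x ⋖ b → x ⋖ c → R x a b → R x b c → R x a c
  -- The exchange axiom of recursive atom orderings. Since `c` is `a` or is forced before `b`, it
  -- precedes `b` in every linear extension that puts `a` before `b`.
  exchange : ∀ x a b y, x ⋖ a → x ⋖ b → a ≠ b → ¬ R x b a → a ≤ y → b ≤ y →
    ∃ c z, x ⋖ c ∧ c ≠ b ∧ (c = a ∨ R x c b) ∧ b ⋖ z ∧ c < z ∧ z ≤ y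
  -- Placing first the covers of `b` that lie above a predecessor of `b` must not violate the
  -- precedence at `b`: if `z'` has to come before such a `z`, then `z'` also lies above a
  -- predecessor of `b`.
  coherent : ∀ x a b z z', x ⋖ b → b ⋖ z → b ⋖ z' → R b z' z → x ⋖ a → a ≠ b → ¬ R x b a →
    a < z → ∃ a', x ⋖ a' ∧ a' ≠ b ∧ a' < z' ∧ (a' = a ∨ R x a' a ∨ R x a' b)

lemma exists_nat_rank {T : Type*} [Finite T] (S : T → T → Prop) (hirr : ∀ a, ¬ S a a)
    (htr : ∀ a b c, S a b → S b c → S a c) :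
    ∃ f : T → ℕ, Function.Injective f ∧ ∀ a b, S a b → f a < f b := by
  have : IsStrictOrder T S := { irrefl := hirr, trans := htr }
  let _ := partialOrderOfSO S
  have : Fintype T := Fintype.ofFinite T
  have : Fintype (LinearExtension T) := Fintype.ofEquiv T (Equiv.refl T)
  let e := Fintype.orderIsoFinOfCardEq (LinearExtension T) rfl
  have hlt : ∀ a b : T, S a b → toLinearExtension a < toLinearExtension b := by
    intro a b h
    have h' : a < b := h
    refine lt_of_le_of_ne (toLinearExtension.monotone h'.le) ?_
    intro h2
    exact h'.ne h2
  refine ⟨fun a => (e.symm (toLinearExtension a) : ℕ), ?_, ?_⟩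
  · intro a b h
    exact e.symm.injective (Fin.ext h)
  · intro a b h
    exact e.symm.strictMono (hlt a b h)

/-- `g` labels the covers of `x` injectively and respects the precedence relation `R`. -/
structure IsAdmissibleLabel (R : P → P → P → Prop) (x : P) (g : P → ℤ) : Prop where
  inj : ∀ a b, x ⋖ a → x ⋖ b → g a = g b → a = b
  mono : ∀ a b, x ⋖ a → x ⋖ b → R x a b → g a < g b

/-- `z` lies above a cover of `x` with a smaller label than `b`. -/
def IsOld (x b : P) (g : P → ℤ) (z : P) : Prop := ∃ a, x ⋖ a ∧ g a < g b ∧ a < z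

lemma IsAtomOrder.exists_label [Finite P] {R : P → P → P → Prop} (hR : IsAtomOrder R) (x : P) :
    ∃ g, IsAdmissibleLabel R x g := by
  classical
  obtain ⟨f, hf, hS⟩ := exists_nat_rank (T := {z // x ⋖ z}) (fun a b => R x a b)
    (fun a => hR.irrefl x a) (fun a b c => hR.trans x a b c a.2 b.2 c.2)
  refine ⟨fun z => if h : x ⋖ z then f ⟨z, h⟩ else 0, ?_, ?_⟩
  · intro a b ha hb h
    simp only [ha, hb, dif_pos, Nat.cast_inj] at h
    simpa using hf h
  · intro a b ha hb h
    simp only [ha, hb, dif_pos, Nat.cast_lt]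
    exact hS _ _ h

/-- The recursive step of the labeling. Covers of `b` lying above an earlier cover of `x` get labels
below that of `b`, all others get larger labels, so that descents are exactly the passages to old
covers. Coherence makes this compatible with the precedence at `b`. -/
lemma IsAtomOrder.exists_next [Finite P] {R : P → P → P → Prop} (hR : IsAtomOrder R) {x b : P}
    {g : P → ℤ} (hg : IsAdmissibleLabel R x g) (hb : x ⋖ b) :
    ∃ g', IsAdmissibleLabel R b g' ∧
      ∀ z, b ⋖ z → (IsOld x b g z → g' z < g b) ∧ (¬ IsOld x b g z → g b < g' z) := by
  classical
  obtain ⟨f, hf, hS⟩ := exists_nat_rank (T := {z // b ⋖ z}) (fun a c => R b a c)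
    (fun a => hR.irrefl b a) (fun a c d => hR.trans b a c d a.2 c.2 d.2)
  obtain ⟨N, hN⟩ : ∃ N : ℕ, ∀ z, f z < N := by
    obtain ⟨N, hN⟩ := (Set.finite_range f).bddAbove
    exact ⟨N + 1, fun z => Nat.lt_succ_of_le (hN ⟨z, rfl⟩)⟩
  -- As `f` takes values in `[0, N)`, the old covers get labels in `[g b - N, g b)` and the new ones
  -- get labels above `g b`.
  refine ⟨fun z => if h : b ⋖ z then
    (if IsOld x b g z then g b - N + f ⟨z, h⟩ else g b + 1 + f ⟨z, h⟩) else 0, ⟨?_, ?_⟩, ?_⟩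
  · intro z z' hz hz' h
    have h1 := hN ⟨z, hz⟩
    have h2 := hN ⟨z', hz'⟩
    simp only [hz, hz', dif_pos] at h
    have : f ⟨z, hz⟩ = f ⟨z', hz'⟩ := by
      split_ifs at h <;> omega
    simpa using hf this
  · intro z z' hz hz' h
    have h1 := hN ⟨z, hz⟩
    have h2 := hN ⟨z', hz'⟩
    have h3 := hS ⟨z, hz⟩ ⟨z', hz'⟩ h
    simp only [hz, hz', dif_pos]
    -- The only conflict between the two blocks of labels would be a new `z` that has to precede an
    -- old `z'`; coherence shows that such a `z` is old.
    by_cases hO' : IsOld x b g z'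
    · have hO : IsOld x b g z := by
        obtain ⟨a, ha, hab, haz⟩ := hO'
        obtain ⟨a', h1, h2, h3, h4⟩ := hR.coherent x a b z' z hb hz' hz h ha
          (by rintro rfl; exact lt_irrefl _ hab)
          (fun hba => (hg.mono b a hb ha hba).not_gt hab) haz
        refine ⟨a', h1, ?_, h3⟩
        rcases h4 with rfl | h4 | h4
        · exact hab
        · exact (hg.mono _ _ h1 ha h4).trans hab
        · exact hg.mono _ _ h1 hb h4
      rw [if_pos hO, if_pos hO']
      omega
    · rw [if_neg hO']
      split_ifs <;> omega
  · intro z hz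
    have h1 := hN ⟨z, hz⟩
    simp only [hz, dif_pos]
    refine ⟨fun h => ?_, fun h => ?_⟩
    · rw [if_pos h]; omega
    · rw [if_neg h]; omega

/-- The label of the covers of the last element of the chain `x :: l`. -/
def runLabels (next : P → P → (P → ℤ) → P → ℤ) : (P → ℤ) → P → List P → P → ℤ
  | g, _, [] => g
  | g, x, a :: l => runLabels next (next x a g) a l

/-- The label word of the chain `x :: l`. -/
def chainWord (next : P → P → (P → ℤ) → P → ℤ) : (P → ℤ) → P → List P → List ℤ
  | _, _, [] => []
  | g, x, a :: l => g a :: chainWord next (next x a g) a l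

lemma isSaturated_cons_cons {x y a : P} {l : List P} :
    IsSaturated x y (x :: a :: l) ↔ x ⋖ a ∧ IsSaturated a y (a :: l) := by
  simp [IsSaturated]; tauto

lemma IsSaturated.exists_eq_cons {x y : P} {c : List P} (h : IsSaturated x y c) :
    ∃ l, c = x :: l := by
  cases c with
  | nil => simp [IsSaturated] at h
  | cons a l => exact ⟨l, by have := h.1; simp at this; rw [this]⟩

lemma isSaturated_singleton_iff {x y : P} : IsSaturated x y [x] ↔ x = y := by
  simp [IsSaturated]

lemma IsSaturated.le {x y : P} {l : List P} (h : IsSaturated x y (x :: l)) : x ≤ y := by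
  induction l generalizing x with
  | nil => exact (isSaturated_singleton_iff.1 h).le
  | cons a l ih =>
    rw [isSaturated_cons_cons] at h
    exact h.1.le.trans (ih h.2)

lemma length_chainWord (next : P → P → (P → ℤ) → P → ℤ) (g : P → ℤ) (x : P) (l : List P) :
    (chainWord next g x l).length = l.length := by
  induction l generalizing g x with
  | nil => rfl
  | cons a l ih => simp [chainWord, ih]

lemma getElem_chainWord (next : P → P → (P → ℤ) → P → ℤ) (g : P → ℤ) (x : P) (l : List P) (i : ℕ)
    (hi : i < l.length) :
    (chainWord next g x l)[i]'(by rwa [length_chainWord]) =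
      runLabels next g x (l.take i) (l[i]) := by
  induction l generalizing g x i with
  | nil => simp at hi
  | cons a l ih =>
    cases i with
    | zero => simp [chainWord, runLabels]
    | succ i => simpa [chainWord, runLabels] using ih (next x a g) a i (by simpa using hi)

lemma runLabels_append (next : P → P → (P → ℤ) → P → ℤ) (g : P → ℤ) (b x : P) (r l : List P)
    (h : (b :: r).getLast? = some x) :
    runLabels next g b (r ++ l) = runLabels next (runLabels next g b r) x l := by
  induction r generalizing g b with
  | nil => simp at h; subst h; rfl
  | cons a r ih => simpa [runLabels] using ih (next b a g) a (by simpa using h)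

/-- The chain labeling given by a step function. -/
def stepLabeling (next : P → P → (P → ℤ) → P → ℤ) (g : P → ℤ) (b : P) (σ : List P) (i : ℕ) : ℤ :=
  -- The label uses only the first `i + 2` elements of `σ`, which gives compatibility. The default
  -- `b` is reached only past the top of the chain.
  runLabels next g b (σ.tail.take i) (σ.getD (i + 1) b)

/-- The root `r` influences the labels in the interval only through the label function it produces
at `x`, and the continuation `t` does not influence them at all. Induction on intervals can
therefore use `chainWord`. -/
lemma labelWord_stepLabeling (next : P → P → (P → ℤ) → P → ℤ) (g : P → ℤ) {b x : P} {r : List P}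
    (hr : IsSaturated b x r) (l t : List P) :
    labelWord (stepLabeling next g b) r (x :: l) t =
      chainWord next (runLabels next g b r.tail) x l := by
  obtain ⟨r, rfl⟩ := hr.exists_eq_cons
  apply List.ext_getElem
  · simp [labelWord, length_chainWord]
  · intro i h1 h2
    rw [length_chainWord] at h2
    rw [getElem_chainWord _ _ _ _ _ h2]
    simp only [labelWord, stepLabeling, glue, List.getElem_map, List.getElem_range, List.tail_cons,
      List.length_cons, Nat.add_sub_cancel, List.cons_append]
    rw [List.append_assoc, List.take_length_add_append, List.take_append_of_le_length h2.le,
      runLabels_append _ _ _ _ _ _ hr.2.1]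
    congr 1
    rw [List.getD_eq_getElem?_getD, List.getElem?_cons_succ,
      List.getElem?_append_right (Nat.le_add_right _ _), Nat.add_sub_cancel_left,
      List.getElem?_append_left h2, List.getElem?_eq_getElem h2, Option.getD_some]

/-- The increasing chain always takes the cover with the least label below `y`: the next element is
then never old, so the labels go up. A chain that starts with another cover `b` has, by exchange, an
old cover of `b` below `y`; its tail, if increasing, would begin with a label at most that old one,
hence with a descent. The clause on `m.head?` records the minimality of the first label that this
argument needs. -/
lemma IsAtomOrder.exists_increasing [Finite P] {R : P → P → P → Prop} (hR : IsAtomOrder R)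
    (next : P → P → (P → ℤ) → P → ℤ)
    (hnext : ∀ x b g, IsAdmissibleLabel R x g → x ⋖ b → IsAdmissibleLabel R b (next x b g) ∧
      ∀ z, b ⋖ z → (IsOld x b g z → next x b g z < g b) ∧ (¬ IsOld x b g z → g b < next x b g z))
    (y x : P) : ∀ (g : P → ℤ), IsAdmissibleLabel R x g → x ≤ y →
    ∃ m, IsSaturated x y (x :: m) ∧ (chainWord next g x m).IsChain (· < ·) ∧
      (∀ a ∈ m.head?, ∀ c, x ⋖ c → c ≤ y → g a ≤ g c) ∧
      ∀ m', IsSaturated x y (x :: m') → m' ≠ m → ¬ (chainWord next g x m').IsChain (· < ·) ∧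
        List.Lex (· < ·) (chainWord next g x m) (chainWord next g x m') := by
  induction x using WellFoundedGT.induction with
  | _ x ih =>
  intro g hg hxy
  rcases hxy.eq_or_lt with rfl | hlt
  · refine ⟨[], isSaturated_singleton_iff.2 rfl, by simp [chainWord], by simp, ?_⟩
    intro m' hm' hne
    exfalso
    cases m' with
    | nil => exact hne rfl
    | cons a l =>
      rw [isSaturated_cons_cons] at hm'
      exact hm'.1.lt.not_ge hm'.2.le
  · obtain ⟨a, ⟨hxa, hay⟩, hmin⟩ := Set.exists_min_image {a | x ⋖ a ∧ a ≤ y} g (Set.toFinite _)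
      (by
        obtain ⟨a, ha⟩ := exists_covBy_le_of_lt hlt
        exact ⟨a, ha⟩)
    obtain ⟨hadm, hold⟩ := hnext x a g hg hxa
    obtain ⟨m, hm, hinc, hhead, huniq⟩ := ih a hxa.lt _ hadm hay
    refine ⟨a :: m, isSaturated_cons_cons.2 ⟨hxa, hm⟩, ?_, ?_, ?_⟩
    · cases m with
      | nil => simp [chainWord]
      | cons z m =>
        rw [chainWord, chainWord, List.isChain_cons_cons]
        refine ⟨?_, hinc⟩
        have haz := (isSaturated_cons_cons.1 hm).1
        refine (hold z haz).2 ?_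
        rintro ⟨a', ha', hlt', haz'⟩
        exact (hmin a' ⟨ha', haz'.le.trans (isSaturated_cons_cons.1 hm).2.le⟩).not_gt hlt'
    · intro a' ha' c hc hcy
      obtain rfl : a = a' := by simpa using ha'
      exact hmin c ⟨hc, hcy⟩
    · intro m' hm' hne
      cases m' with
      | nil =>
        exact absurd (isSaturated_singleton_iff.1 hm') hlt.ne
      | cons b m' =>
        rw [isSaturated_cons_cons] at hm'
        by_cases hab : b = a
        · subst hab
          obtain ⟨h1, h2⟩ := huniq m' hm'.2 (fun h => hne (by rw [h]))
          refine ⟨fun h => h1 ?_, ?_⟩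
          · rw [chainWord] at h
            exact h.tail
          · rw [chainWord, chainWord]
            exact List.Lex.cons h2
        · have hby := hm'.2.le
          have hlab : g a < g b :=
            lt_of_le_of_ne (hmin b ⟨hm'.1, hby⟩) (fun h => hab (hg.inj _ _ hxa hm'.1 h).symm)
          refine ⟨?_, by rw [chainWord, chainWord]; exact List.Lex.rel hlab⟩
          intro hchain
          -- Exchange produces a cover `z` of `b` below `y` lying above a cover of `x` with a label
          -- smaller than that of `b`; its label is less than `g b`.
          obtain ⟨c, z, hxc, hcb, hc, hbz, hcz, hzy⟩ := hR.exchange x a b y hxa hm'.1 (Ne.symm hab)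
            (fun h => (hg.mono _ _ hm'.1 hxa h).not_gt hlab) hay hby
          have hgc : g c < g b := by
            rcases hc with rfl | hc
            · exact hlab
            · exact hg.mono _ _ hxc hm'.1 hc
          obtain ⟨hadm', hold'⟩ := hnext x b g hg hm'.1
          obtain ⟨m₂, -, -, hhead₂, huniq₂⟩ := ih b hm'.1.lt _ hadm' hby
          have hgz := (hold' z hbz).1 ⟨c, hxc, hgc, hcz⟩
          rw [chainWord] at hchain
          have hm₂ : m' = m₂ := by
            by_contra hne'
            exact (huniq₂ m' hm'.2 hne').1 hchain.tail
          subst hm₂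
          cases m' with
          | nil =>
            have := isSaturated_singleton_iff.1 hm'.2
            subst this
            exact hbz.lt.not_ge hzy
          | cons d m' =>
            rw [chainWord, List.isChain_cons_cons] at hchain
            have := hhead₂ d rfl z hbz hzy
            omega

theorem IsAtomOrder.clShellable [Finite P] {R : P → P → P → Prop} (hR : IsAtomOrder R)
    {b u : P} (hb : IsBot b) (hu : IsTop u) : CLShellable P := by
  classical
  -- The hypotheses are moved inside the existential so that `next` can be chosen as a total
  -- function; the value `g` is a dummy where they fail.
  have hex : ∀ x c g, ∃ g', IsAdmissibleLabel R x g → x ⋖ c → IsAdmissibleLabel R c g' ∧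
      ∀ z, c ⋖ z → (IsOld x c g z → g' z < g c) ∧ (¬ IsOld x c g z → g c < g' z) := by
    intro x c g
    by_cases h : IsAdmissibleLabel R x g ∧ x ⋖ c
    · obtain ⟨g', h'⟩ := hR.exists_next h.1 h.2
      exact ⟨g', fun _ _ => h'⟩
    · exact ⟨g, fun h1 h2 => absurd ⟨h1, h2⟩ h⟩
  choose next hnext using hex
  obtain ⟨g, hg⟩ := hR.exists_label b
  refine ⟨b, u, hb, hu, ℤ, inferInstance, stepLabeling next g b, ?_, ?_⟩
  · intro σ τ _ _ d hd i hi
    have h1 : σ.tail.take i = τ.tail.take i := by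
      have := congrArg (fun l => (l.take (i + 1)).tail) hd
      simp only [List.take_take, Nat.min_eq_left (show i + 1 ≤ d + 1 by omega)] at this
      cases σ <;> cases τ <;> simp_all
    have h2 : σ[i + 1]? = τ[i + 1]? := by
      have := congrArg (fun l => l[i + 1]?) hd
      simpa [List.getElem?_take, hi] using this
    simp only [stepLabeling, h1, List.getD_eq_getElem?_getD, h2]
  · intro x y hxy r t hr _
    have hrun : ∀ (l : List P) (c : P) (g : P → ℤ), IsAdmissibleLabel R c g →
        IsSaturated c x (c :: l) → IsAdmissibleLabel R x (runLabels next g c l) := by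
      intro l
      induction l with
      | nil =>
        intro c g hg h
        obtain rfl := isSaturated_singleton_iff.1 h
        exact hg
      | cons a l ih =>
        intro c g hg h
        rw [isSaturated_cons_cons] at h
        exact ih a _ (hnext c a g hg h.1).1 h.2
    have hadm : IsAdmissibleLabel R x (runLabels next g b r.tail) := by
      obtain ⟨l, rfl⟩ := hr.exists_eq_cons
      exact hrun l b g hg hr
    obtain ⟨m, hm, hinc, -, huniq⟩ := hR.exists_increasing next hnext y x _ hadm hxy
    refine ⟨x :: m, hm, by rwa [labelWord_stepLabeling _ _ hr], ?_⟩
    intro m' hm' hne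
    obtain ⟨l, rfl⟩ := hm'.exists_eq_cons
    rw [labelWord_stepLabeling _ _ hr, labelWord_stepLabeling _ _ hr]
    exact huniq l hm' (fun h => hne (by rw [h]))

end AtomOrders
end EvenSubgraph

namespace EvenSubgraph

/-! ### Transport and products of atom orders. -/

section AtomOrderConstructions

lemma IsAtomOrder.of_orderIso {P Q : Type*} [PartialOrder P] [PartialOrder Q] (e : P ≃o Q)
    {R : Q → Q → Q → Prop} (hR : IsAtomOrder R) :
    IsAtomOrder (fun x a b => R (e x) (e a) (e b)) := by
  refine ⟨fun x a => hR.irrefl _ _, ?_, ?_, ?_⟩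
  · intro x a b c ha hb hc
    exact hR.trans _ _ _ _ ((apply_covBy_apply_iff e).2 ha) ((apply_covBy_apply_iff e).2 hb)
      ((apply_covBy_apply_iff e).2 hc)
  · intro x a b y ha hb hab hba hay hby
    obtain ⟨c, z, h1, h2, h3, h4, h5, h6⟩ := hR.exchange (e x) (e a) (e b) (e y)
      ((apply_covBy_apply_iff e).2 ha) ((apply_covBy_apply_iff e).2 hb) (by simpa using hab) hba
      (by simpa using hay) (by simpa using hby)
    refine ⟨e.symm c, e.symm z, ?_, ?_, ?_, ?_, ?_, ?_⟩
    · rw [← apply_covBy_apply_iff e]; simpa using h1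
    · rintro rfl; simp at h2
    · rcases h3 with rfl | h3
      · simp
      · right; simpa using h3
    · rw [← apply_covBy_apply_iff e]; simpa using h4
    · simpa using h5
    · rw [← e.le_iff_le]; simpa using h6
  · intro x a b z z' hb hz hz' hR' ha hab hba haz
    obtain ⟨c, h1, h2, h3, h4⟩ := hR.coherent (e x) (e a) (e b) (e z) (e z')
      ((apply_covBy_apply_iff e).2 hb) ((apply_covBy_apply_iff e).2 hz)
      ((apply_covBy_apply_iff e).2 hz') hR' ((apply_covBy_apply_iff e).2 ha) (by simpa using hab)
      hba (by simpa using haz)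
    refine ⟨e.symm c, ?_, ?_, ?_, ?_⟩
    · rw [← apply_covBy_apply_iff e]; simpa using h1
    · rintro rfl; simp at h2
    · rw [← e.lt_iff_lt]; simpa using h3
    · rcases h4 with rfl | h4
      · simp
      · right; simpa using h4

variable {ι : Type*} {P : ι → Type*} [∀ i, PartialOrder (P i)]

lemma covBy_update [DecidableEq ι] (x : ∀ i, P i) {i : ι} {p : P i} (h : x i ⋖ p) :
    x ⋖ Function.update x i p :=
  Pi.covBy_iff_exists_right_eq.2 ⟨i, p, h, rfl⟩

lemma update_lt_update_update [DecidableEq ι] {x : ∀ i, P i} {i j : ι} (hij : i ≠ j) {p : P i}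
    {q : P j} (h : x j < q) :
    Function.update x i p < Function.update (Function.update x j q) i p := by
  refine Pi.lt_def.2 ⟨fun k => ?_, j, ?_⟩
  · by_cases hk : k = i
    · subst hk; simp
    · by_cases hk' : k = j
      · subst hk'; simp [hk, h.le]
      · simp [hk, hk']
  · simp [Ne.symm hij, h]

/-- The product of precedence relations. -/
def piAtomOrder (R : ∀ i, P i → P i → P i → Prop) (x a b : ∀ i, P i) : Prop :=
  ∃ i, (∀ j, j ≠ i → a j = x j ∧ b j = x j) ∧ R i (x i) (a i) (b i)

/-- A cover in a product changes one coordinate. Two covers changing the same coordinate are handled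
in that factor. Covers changing different coordinates span a commuting square, so they satisfy
exchange without any precedence between them. -/
lemma IsAtomOrder.pi {R : ∀ i, P i → P i → P i → Prop} (hR : ∀ i, IsAtomOrder (R i)) :
    IsAtomOrder (piAtomOrder R) := by
  classical
  have key : ∀ (x : ∀ i, P i) (i j : ι) (p : P i) (q : P j), x i ⋖ p → x j ⋖ q →
      ∀ b : ∀ i, P i, piAtomOrder R x (Function.update x i p) (Function.update x j q) ↔
        ∃ h : i = j, R j (x j) (h ▸ p) q := by
    intro x i j p q hp hq b
    constructor
    · rintro ⟨k, h1, h2⟩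
      obtain rfl : i = k := by
        by_contra h
        have := (h1 i h).1
        simp only [Function.update_self] at this
        exact hp.lt.ne this.symm
      obtain rfl : j = i := by
        by_contra h
        have := (h1 j h).2
        simp only [Function.update_self] at this
        exact hq.lt.ne this.symm
      exact ⟨rfl, by simpa using h2⟩
    · rintro ⟨rfl, h⟩
      exact ⟨i, fun j hj => by simp [hj], by simpa using h⟩
  refine ⟨?_, ?_, ?_, ?_⟩
  · rintro x a ⟨i, -, h⟩
    exact (hR i).irrefl _ _ h
  · intro x a b c ha hb hc hab hbc
    obtain ⟨i, p, hp, rfl⟩ := Pi.covBy_iff_exists_right_eq.1 ha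
    obtain ⟨j, q, hq, rfl⟩ := Pi.covBy_iff_exists_right_eq.1 hb
    obtain ⟨k, r, hr, rfl⟩ := Pi.covBy_iff_exists_right_eq.1 hc
    obtain ⟨rfl, h1⟩ := (key x i j p q hp hq x).1 hab
    obtain ⟨rfl, h2⟩ := (key x i k q r hq hr x).1 hbc
    exact (key x i i p r hp hr x).2 ⟨rfl, (hR i).trans _ _ _ _ hp hq hr h1 h2⟩
  · intro x a b y ha hb hab hba hay hby
    obtain ⟨i, p, hp, rfl⟩ := Pi.covBy_iff_exists_right_eq.1 ha
    obtain ⟨j, q, hq, rfl⟩ := Pi.covBy_iff_exists_right_eq.1 hb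
    have hxy : x ≤ y := ha.le.trans hay
    by_cases hij : i = j
    · subst hij
      have hpq : p ≠ q := by rintro rfl; exact hab rfl
      obtain ⟨c, z, h1, h2, h3, h4, h5, h6⟩ := (hR i).exchange (x i) p q (y i) hp hq hpq
        (fun h => hba ((key x i i q p hq hp x).2 ⟨rfl, h⟩)) (by simpa using hay i)
        (by simpa using hby i)
      refine ⟨Function.update x i c, Function.update x i z, covBy_update x h1, ?_, ?_, ?_, ?_, ?_⟩
      · intro h; exact h2 (by simpa using congrFun h i)
      · rcases h3 with rfl | h3
        · exact Or.inl rfl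
        · exact Or.inr ((key x i i c q h1 hq x).2 ⟨rfl, h3⟩)
      · have := covBy_update (Function.update x i q) (i := i) (p := z) (by simpa using h4)
        simpa using this
      · exact update_lt_update_iff.2 h5
      · exact update_le_iff.2 ⟨h6, fun j _ => hxy j⟩
    · refine ⟨Function.update x i p, Function.update (Function.update x j q) i p, ha, hab,
        Or.inl rfl, covBy_update _ (by simpa [hij] using hp), ?_, ?_⟩
      · exact update_lt_update_update hij hq.lt
      · refine update_le_iff.2 ⟨by simpa using hay i, fun k _ => hby k⟩
  · intro x a b z z' hb hz hz' hRz ha hab hba haz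
    obtain ⟨j, q, hq, rfl⟩ := Pi.covBy_iff_exists_right_eq.1 hb
    obtain ⟨i, p, hp, rfl⟩ := Pi.covBy_iff_exists_right_eq.1 ha
    obtain ⟨k, r, hr, rfl⟩ := Pi.covBy_iff_exists_right_eq.1 hz
    obtain ⟨l, s, hs, rfl⟩ := Pi.covBy_iff_exists_right_eq.1 hz'
    obtain ⟨rfl, h⟩ := (key _ _ _ _ _ hs hr x).1 hRz
    simp only at h
    by_cases hjl : j = l
    · subst hjl
      simp only [Function.update_self, Function.update_idem] at *
      obtain rfl : i = j := by
        by_contra hij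
        have := haz.le i
        simp [hij] at this
        exact hp.lt.not_ge this
      have hpq : p ≠ q := by rintro rfl; exact hab rfl
      obtain ⟨c, h1, h2, h3, h4⟩ := (hR i).coherent (x i) p q r s hq hr hs h hp hpq
        (fun h => hba ((key x i i q p hq hp x).2 ⟨rfl, h⟩))
        (update_lt_update_iff.1 haz)
      refine ⟨Function.update x i c, covBy_update x h1, ?_, update_lt_update_iff.2 h3, ?_⟩
      · intro h; exact h2 (by simpa using congrFun h i)
      · rcases h4 with rfl | h4 | h4
        · exact Or.inl rfl
        · exact Or.inr (Or.inl ((key x i i c p h1 hp x).2 ⟨rfl, h4⟩))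
        · exact Or.inr (Or.inr ((key x i i c q h1 hq x).2 ⟨rfl, h4⟩))
    -- Here `z` and `z'` change a coordinate `l` other than the coordinate `j` changed by `b`. Then
    -- `a` is the cover of `x` making the same change as `z`, and the cover of `x` making the same
    -- change as `z'` precedes it.
    · have hlj : l ≠ j := Ne.symm hjl
      simp only [ne_eq, hlj, not_false_eq_true, Function.update_of_ne] at hs hr h
      have hne : Function.update x l s ≠ Function.update x j q := by
        intro he
        have := congrFun he l
        simp [hlj] at this
        exact hs.lt.ne this.symm
      have hlt := update_lt_update_update (x := x) (i := l) (j := j) hlj (p := s) hq.lt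
      by_cases hij : i = l
      · subst hij
        have hpr : p = r := by
          have h1 : p ≤ r := by simpa using haz.le i
          exact (hr.eq_or_eq hp.le h1).resolve_left hp.lt.ne'
        subst hpr
        exact ⟨Function.update x i s, covBy_update x hs, hne, hlt,
          Or.inr (Or.inl ((key x i i s p hs hp x).2 ⟨rfl, h⟩))⟩
      -- If `a` does not change the coordinate `l`, then `a < z` forces it to change `j`, and to the
      -- same value as `b`.
      · exfalso
        have hij' : i = j := by
          by_contra hij'
          have := haz.le i
          simp [hij, hij'] at this
          exact hp.lt.not_ge this
        subst hij'
        have := haz.le i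
        simp [hij] at this
        exact hab (by rw [(hq.eq_or_eq hp.le this).resolve_left hp.lt.ne'])

end AtomOrderConstructions

/-! ### Disconnected open intervals obstruct shellability. -/

section Obstruction

variable {P : Type*} [PartialOrder P]

lemma exists_isFacet_superset [Finite P] {s : Finset P} (hs : s.Nonempty)
    (hc : IsChain (· ≤ ·) (s : Set P)) : ∃ F, s ⊆ F ∧ IsFacet (orderComplex P) F := by
  have : Fintype P := Fintype.ofFinite P
  obtain ⟨F, hF, hmax⟩ := Set.Finite.exists_le_maximal
    (Set.toFinite {t : Finset P | t ∈ (orderComplex P).faces}) (a := s) ⟨hs, hc⟩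
  exact ⟨F, hF, hmax⟩

lemma isChain_insert_finset [DecidableEq P] {s : Finset P} (hc : IsChain (· ≤ ·) (s : Set P)) {a : P}
    (h : ∀ b ∈ s, a ≤ b ∨ b ≤ a) : IsChain (· ≤ ·) ((insert a s : Finset P) : Set P) := by
  rw [Finset.coe_insert]
  exact hc.insert (fun b hb _ => h b hb)

/-- An open interval of a shellable poset does not have two connected components of positive
dimension. -/
theorem not_shellable_of_disconnected [Finite P] {x y : P} (hxy : x < y) {C : Bool → Set P}
    (hC : ∀ i, C i ⊆ Set.Ioo x y) (hdisj : ∀ c ∈ C true, c ∉ C false)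
    (hne : ∀ i, (C i).Nonempty)
    (hclosed : ∀ i, ∀ c ∈ C i, ∀ d ∈ Set.Ioo x y, c ≤ d ∨ d ≤ c → d ∈ C i)
    (hcomp : ∀ i, ∀ c ∈ C i, ∃ d ∈ Set.Ioo x y, d ≠ c ∧ (c ≤ d ∨ d ≤ c)) : ¬ Shellable P := by
  classical
  have : Fintype P := Fintype.ofFinite P
  rintro ⟨L, hL⟩
  -- A maximal chain `F₀` outside the open interval through `x` and `y`. The facets containing it
  -- correspond to maximal chains of the open interval, so the argument takes place in the link of
  -- `F₀`.
  obtain ⟨F₀, hF₀, hmax⟩ := Set.Finite.exists_le_maximal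
    (Set.toFinite {t : Finset P | IsChain (· ≤ ·) (t : Set P) ∧ ∀ z ∈ t, z ≤ x ∨ y ≤ z})
    (a := {x, y}) ⟨by
      rw [Finset.coe_pair]
      exact IsChain.pair hxy.le, by simp⟩
  have hx : x ∈ F₀ := hF₀ (by simp)
  have hy : y ∈ F₀ := hF₀ (by simp)
  -- the elements of a chain extending `F₀` are in `F₀` or in the open interval
  have hext : ∀ F : Finset P, IsChain (· ≤ ·) (F : Set P) → F₀ ⊆ F → ∀ z ∈ F, z ∉ F₀ →
      z ∈ Set.Ioo x y := by
    intro F hF hsub z hz hz0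
    have hcmp : ∀ w ∈ F₀, z ≤ w ∨ w ≤ z := fun w hw => hF.total hz (hsub hw)
    have hnot : ¬ (z ≤ x ∨ y ≤ z) := by
      intro h
      apply hz0
      have := hmax.le_of_ge (y := insert z F₀) ⟨isChain_insert_finset hmax.prop.1 hcmp, by
        intro w hw
        rcases Finset.mem_insert.1 hw with rfl | hw
        · exact h
        · exact hmax.prop.2 w hw⟩ (Finset.subset_insert _ _)
      exact this (Finset.mem_insert_self _ _)
    push Not at hnot
    refine ⟨lt_of_le_not_ge ((hcmp x hx).resolve_left hnot.1) hnot.1,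
      lt_of_le_not_ge ((hcmp y hy).resolve_right hnot.2) hnot.2⟩
  have hins : ∀ s : Finset P, IsChain (· ≤ ·) (s : Set P) → (∀ z ∈ s, z ∈ Set.Ioo x y) →
      IsChain (· ≤ ·) ((F₀ ∪ s : Finset P) : Set P) := by
    intro s hs hsI a ha b hb hab
    rw [Finset.mem_coe, Finset.mem_union] at ha hb
    have aux : ∀ a ∈ F₀, ∀ b ∈ s, a ≤ b ∨ b ≤ a := by
      intro a ha b hb
      rcases hmax.prop.2 a ha with h | h
      · exact Or.inl (h.trans (hsI b hb).1.le)
      · exact Or.inr ((hsI b hb).2.le.trans h)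
    rcases ha with ha | ha <;> rcases hb with hb | hb
    · exact hmax.prop.1 ha hb hab
    · exact aux a ha b hb
    · exact (aux b hb a ha).symm
    · exact hs ha hb hab
  -- The `k`-th facet contains `F₀` and passes through the piece `C i`. Since the pieces are closed
  -- under comparability, such a facet has all its other elements in `C i`.
  let T (i : Bool) (k : ℕ) : Prop := ∃ hk : k < L.length, F₀ ⊆ L[k] ∧ ∃ c ∈ L[k], c ∈ C i
  have hfacet : ∀ k (hk : k < L.length), IsFacet (orderComplex P) L[k] :=
    fun k hk => (hL.mem_iff _).1 (List.getElem_mem hk)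
  have hTex : ∀ i, ∃ k, T i k := by
    intro i
    obtain ⟨c, hc⟩ := hne i
    obtain ⟨F, hF, hFf⟩ := exists_isFacet_superset (s := F₀ ∪ {c}) ⟨x, by simp [hx]⟩
      (hins {c} (by simp) (by simpa using hC i hc))
    obtain ⟨k, hk, rfl⟩ := List.getElem_of_mem ((hL.mem_iff F).2 hFf)
    exact ⟨k, hk, (Finset.subset_union_left).trans hF, c, hF (by simp), hc⟩
  have hTall : ∀ i k (hT : T i k), ∀ z ∈ L[k]'hT.1, z ∉ F₀ → z ∈ C i := by
    rintro i k ⟨hk, hsub, c, hc, hci⟩ z hz hz0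
    have hch := (hfacet k hk).prop.2
    exact hclosed i c hci z (hext _ hch hsub z hz hz0) (hch.total hc hz)
  have hTdisj : ∀ k, T true k → ¬ T false k := by
    rintro k h1 h2
    obtain ⟨hk, hsub, c, hc, hci⟩ := h1
    have hc0 : c ∉ F₀ := by
      intro h
      have := hC _ hci
      rcases hmax.prop.2 c h with h | h
      · exact this.1.not_ge h
      · exact this.2.not_ge h
    exact hdisj c hci (hTall _ k h2 c hc hc0)
  -- If a facet of one type comes after a facet of the other type, `F₀` is a face of the
  -- intersection with the earlier facets. Purity enlarges it to a face missing only one vertex of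
  -- the current facet, and this face leaves `F₀`, so some earlier facet has the current type.
  -- Applied to the first facets of both types, this is a contradiction.
  have main : ∀ i, ∀ k, T i k → (∃ j < k, T (!i) j) → ∃ j < k, T i j := by
    rintro i k hTk ⟨j, hjk, hTj⟩
    have hTk' := hTk
    obtain ⟨hk, hsub, c, hc, hci⟩ := hTk'
    have hearly : F₀ ∈ earlierFaces L k hk := ⟨hsub, j, hjk, hTj.2.1⟩
    obtain ⟨s, hs, hsmax⟩ := Set.Finite.exists_le_maximal
      (Set.toFinite {s | s ∈ earlierFaces L k hk}) (a := F₀) hearly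
    have hcard := hL.pure k hk (by omega) s hsmax
    have hc0 : c ∉ F₀ := by
      intro h
      have := hC _ hci
      rcases hmax.prop.2 c h with h | h
      · exact this.1.not_ge h
      · exact this.2.not_ge h
    -- Since no point of the piece is isolated, a facet cannot leave `F₀` in the single element `c`.
    -- With two elements outside `F₀`, a face of codimension one retains at least one of them.
    obtain ⟨e, he, he0, hec⟩ : ∃ e ∈ L[k], e ∉ F₀ ∧ e ≠ c := by
      by_contra! hno
      obtain ⟨d, hd, hdc, hcmp⟩ := hcomp i c hci
      have hLk : L[k] ⊆ F₀ ∪ {c, d} := by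
        intro z hz
        by_cases h : z ∈ F₀
        · simp [h]
        · simp [hno z hz h]
      have hface : F₀ ∪ {c, d} ∈ (orderComplex P).faces := by
        refine ⟨⟨x, by simp [hx]⟩, hins _ ?_ ?_⟩
        · rw [Finset.coe_pair]
          rcases hcmp with h | h
          · exact IsChain.pair h
          · rw [Set.pair_comm]; exact IsChain.pair h
        · intro z hz
          rcases Finset.mem_insert.1 hz with rfl | hz
          · exact hC _ hci
          · rw [Finset.mem_singleton.1 hz]; exact hd
      have hdmem : d ∈ L[k] := (hfacet k hk).le_of_ge hface hLk (by simp)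
      have hd0 : d ∈ F₀ := by
        by_contra h
        exact hdc (hno d hdmem h)
      rcases hmax.prop.2 d hd0 with h | h
      · exact hd.1.not_ge h
      · exact hd.2.not_ge h
    obtain ⟨hsk, l, hl, hsl⟩ := hsmax.prop
    obtain ⟨f, hfs, hf0⟩ : ∃ f ∈ s, f ∉ F₀ := by
      by_contra! hno
      have h1 : F₀ ∪ {c, e} ⊆ L[k] := by
        intro z hz
        simp only [Finset.mem_union, Finset.mem_insert, Finset.mem_singleton] at hz
        rcases hz with hz | rfl | rfl
        · exact hsub hz
        · exact hc
        · exact he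
      have h2 := Finset.card_le_card h1
      have h3 : (F₀ ∪ {c, e}).card = F₀.card + 2 := by
        rw [Finset.card_union_of_disjoint, Finset.card_pair (Ne.symm hec)]
        simp [hc0, he0]
      have h4 := Finset.card_le_card (show s ⊆ F₀ from hno)
      omega
    exact ⟨l, hl, by omega, hs.trans hsl, f, hsl hfs, hTall i k hTk f (hsk hfs) hf0⟩
  obtain ⟨k₁, hk₁, hmin₁⟩ : ∃ k, T true k ∧ ∀ j < k, ¬ T true j :=
    ⟨Nat.find (hTex true), Nat.find_spec (hTex true), fun j hj => Nat.find_min _ hj⟩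
  obtain ⟨k₂, hk₂, hmin₂⟩ : ∃ k, T false k ∧ ∀ j < k, ¬ T false j :=
    ⟨Nat.find (hTex false), Nat.find_spec (hTex false), fun j hj => Nat.find_min _ hj⟩
  rcases lt_trichotomy k₁ k₂ with h | rfl | h
  · obtain ⟨j, hj, hT⟩ := main false k₂ hk₂ ⟨k₁, h, hk₁⟩
    exact hmin₂ j hj hT
  · exact hTdisj _ hk₁ hk₂
  · obtain ⟨j, hj, hT⟩ := main true k₁ hk₁ ⟨k₂, h, hk₂⟩
    exact hmin₁ j hj hT

end Obstruction
end EvenSubgraph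

namespace EvenSubgraph

/-! ### Parity of components in a weighted graph. -/

section EvenSets

variable {τ : Type*} [DecidableEq τ] {Γ : τ → τ → Prop} {w : τ → ZMod 2}
  {C I X Y : Finset τ} {r s t p : τ}

/-- `C` is a union of connected components of the subgraph of `Γ` induced on `X`. -/
def IsClosedIn (Γ : τ → τ → Prop) (C X : Finset τ) : Prop :=
  C ⊆ X ∧ ∀ x ∈ C, ∀ y ∈ X, Γ x y → y ∈ C

/-- Every connected component of the subgraph of `Γ` induced on `X` has even weight. -/
def IsEvenSet (Γ : τ → τ → Prop) (w : τ → ZMod 2) (X : Finset τ) : Prop :=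
  ∀ C, IsClosedIn Γ C X → ∑ x ∈ C, w x = 0

/-- `s` and `t` are in the same connected component of the subgraph of `Γ` induced on `X`. -/
def Linked (Γ : τ → τ → Prop) (X : Finset τ) (s t : τ) : Prop :=
  ∀ C, IsClosedIn Γ C X → s ∈ C → t ∈ C

lemma isClosedIn_self : IsClosedIn Γ X X := ⟨subset_rfl, fun _ _ _ hy _ => hy⟩

lemma IsClosedIn.inter (h : IsClosedIn Γ C Y) (hX : X ⊆ Y) : IsClosedIn Γ (C ∩ X) X :=
  ⟨Finset.inter_subset_right, fun x hx y hy hxy => Finset.mem_inter.2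
    ⟨h.2 x (Finset.mem_inter.1 hx).1 y (hX hy) hxy, hy⟩⟩

lemma IsClosedIn.sdiff (hΓ : ∀ ⦃x y⦄, Γ x y → Γ y x) (h : IsClosedIn Γ C X) : IsClosedIn Γ (X \ C) X := by
  refine ⟨Finset.sdiff_subset, fun x hx y hy hxy => ?_⟩
  rw [Finset.mem_sdiff] at hx ⊢
  exact ⟨hy, fun hyC => hx.2 (h.2 y hyC x hx.1 (hΓ hxy))⟩

lemma IsEvenSet.sum (h : IsEvenSet Γ w X) : ∑ x ∈ X, w x = 0 := h X isClosedIn_self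

lemma isEvenSet_empty : IsEvenSet Γ w ∅ := by
  intro C hC
  rw [Finset.subset_empty.1 hC.1, Finset.sum_empty]

lemma Linked.refl : Linked Γ X s s := fun _ _ h => h

lemma Linked.symm (hΓ : ∀ ⦃x y⦄, Γ x y → Γ y x) (h : Linked Γ X s t) (hs : s ∈ X) : Linked Γ X t s := by
  intro C hC ht
  by_contra hsC
  have := h _ (hC.sdiff hΓ) (Finset.mem_sdiff.2 ⟨hs, hsC⟩)
  exact (Finset.mem_sdiff.1 this).2 ht

lemma Linked.trans (h : Linked Γ X s t) (h' : Linked Γ X t r) : Linked Γ X s r :=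
  fun C hC hs => h' C hC (h C hC hs)

lemma Linked.mem (h : Linked Γ X s t) (hs : s ∈ X) : t ∈ X := h X isClosedIn_self hs

lemma Linked.mono (h : Linked Γ X s t) (hX : X ⊆ Y) (hs : s ∈ X) : Linked Γ Y s t :=
  fun _ hC hsC => (Finset.mem_inter.1 (h _ (hC.inter hX) (Finset.mem_inter.2 ⟨hsC, hs⟩))).1

lemma Linked.of_adj (h : Γ s t) (ht : t ∈ X) : Linked Γ X s t := fun _ hC hs => hC.2 s hs t ht h

open Classical in
/-- The connected component of `s` in the subgraph of `Γ` induced on `X`. -/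
noncomputable def block (Γ : τ → τ → Prop) (X : Finset τ) (s : τ) : Finset τ :=
  X.filter (Linked Γ X s)

lemma mem_block : t ∈ block Γ X s ↔ t ∈ X ∧ Linked Γ X s t := by
  simp [block]

lemma isClosedIn_block : IsClosedIn Γ (block Γ X s) X := by
  refine ⟨fun t ht => (mem_block.1 ht).1, fun x hx y hy hxy => mem_block.2 ⟨hy, ?_⟩⟩
  exact (mem_block.1 hx).2.trans (Linked.of_adj hxy hy)

/-- A union of components of `X` meets `I` in a union of components of `I`, and this part has weight
zero. -/
lemma IsClosedIn.sum_eq (hI : IsEvenSet Γ w I) (hIX : I ⊆ X) (hC : IsClosedIn Γ C X) :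
    ∑ x ∈ C, w x = ∑ x ∈ C \ I, w x := by
  rw [← Finset.sum_inter_add_sum_sdiff C I, hI _ (hC.inter hIX), zero_add]

lemma IsEvenSet.sum_sdiff_eq (hI : IsEvenSet Γ w I) (hIX : I ⊆ X) :
    ∑ x ∈ X \ I, w x = ∑ x ∈ X, w x := (isClosedIn_self.sum_eq hI hIX).symm

/-- Modulo the even set `I`, only the new elements of nonzero weight count, and they all lie in the
component of `r`. A union of components thus carries either the whole new weight, which is zero, or
none of it. -/
lemma IsEvenSet.of_linked (hΓ : ∀ ⦃x y⦄, Γ x y → Γ y x) (hI : IsEvenSet Γ w I) (hIX : I ⊆ X) (hr : r ∈ X)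
    (hlink : ∀ t ∈ X, t ∉ I → w t ≠ 0 → Linked Γ X r t) (hsum : ∑ x ∈ X, w x = 0) :
    IsEvenSet Γ w X := by
  intro C hC
  rw [hC.sum_eq hI hIX]
  by_cases hrC : r ∈ C
  · rw [← hsum, ← hI.sum_sdiff_eq hIX]
    refine Finset.sum_subset (Finset.sdiff_subset_sdiff hC.1 subset_rfl) ?_
    intro t ht htC
    rw [Finset.mem_sdiff] at ht htC
    by_contra hw
    exact htC ⟨hlink t ht.1 ht.2 hw C hC hrC, ht.2⟩
  · refine Finset.sum_eq_zero fun t ht => ?_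
    rw [Finset.mem_sdiff] at ht
    by_contra hw
    exact hrC ((hlink t (hC.1 ht.1) ht.2 hw).symm hΓ hr C hC ht.1)

/-- An odd component of `X` can be extended inside any even set `Y ⊇ X`, and this without using
the weightless elements `D` all of whose neighbours are in the component. -/
lemma exists_next_of_dead (hY : IsEvenSet Γ w Y) (hXY : X ⊆ Y) (hI : IsEvenSet Γ w I)
    (hIX : I ⊆ X) (hr : r ∈ X) (hlink : ∀ t ∈ X, t ∉ I → w t ≠ 0 → Linked Γ X r t)
    (hsum : ∑ x ∈ X, w x ≠ 0) (D : τ → Prop)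
    (hD : ∀ d, D d → w d = 0 ∧ ∀ t, Γ d t → Linked Γ X r t) :
    ∃ p ∈ Y, p ∉ X ∧ ¬ D p ∧ ∃ q ∈ X, Linked Γ X r q ∧ Γ q p := by
  classical
  by_contra! hno
  apply hsum
  -- If no element outside `X` and `D` extended the component of `r`, this component with the dead
  -- elements would be a union of components of `Y`; its weight is the odd total weight of `X`,
  -- contradicting evenness of `Y`.
  have hcl : IsClosedIn Γ (block Γ X r ∪ Y.filter D) Y := by
    refine ⟨Finset.union_subset (isClosedIn_block.1.trans hXY) (Finset.filter_subset _ _), ?_⟩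
    intro x hx y hy hxy
    rw [Finset.mem_union, Finset.mem_filter, mem_block]
    rcases Finset.mem_union.1 hx with hx | hx
    · rw [mem_block] at hx
      by_cases hyX : y ∈ X
      · exact Or.inl ⟨hyX, hx.2.trans (Linked.of_adj hxy hyX)⟩
      · by_cases hyD : D y
        · exact Or.inr ⟨hy, hyD⟩
        · exact absurd hxy (hno y hy hyX hyD x hx.1 hx.2)
    · have := (hD x (Finset.mem_filter.1 hx).2).2 y hxy
      exact Or.inl ⟨this.mem hr, this⟩
  have h0 := hY _ hcl
  have h1 : ∑ x ∈ block Γ X r ∪ Y.filter D, w x = ∑ x ∈ block Γ X r, w x := by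
    refine (Finset.sum_subset Finset.subset_union_left ?_).symm
    intro x hx hxb
    rcases Finset.mem_union.1 hx with hx | hx
    · exact absurd hx hxb
    · exact (hD x (Finset.mem_filter.1 hx).2).1
  rw [h1, isClosedIn_block.sum_eq hI hIX] at h0
  rw [← hI.sum_sdiff_eq hIX, ← h0]
  refine (Finset.sum_subset (Finset.sdiff_subset_sdiff isClosedIn_block.1 subset_rfl) ?_).symm
  intro t ht htb
  rw [Finset.mem_sdiff] at ht htb
  by_contra hw
  exact htb ⟨mem_block.2 ⟨ht.1, hlink t ht.1 ht.2 hw⟩, ht.2⟩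

lemma exists_next (hY : IsEvenSet Γ w Y) (hXY : X ⊆ Y) (hI : IsEvenSet Γ w I)
    (hIX : I ⊆ X) (hr : r ∈ X) (hlink : ∀ t ∈ X, t ∉ I → w t ≠ 0 → Linked Γ X r t)
    (hsum : ∑ x ∈ X, w x ≠ 0) : ∃ p ∈ Y, p ∉ X ∧ ∃ q ∈ X, Linked Γ X r q ∧ Γ q p := by
  obtain ⟨p, hp, hpX, -, h⟩ := exists_next_of_dead hY hXY hI hIX hr hlink hsum (fun _ => False)
    (fun _ h => h.elim)
  exact ⟨p, hp, hpX, h⟩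

lemma Linked.insert_of_adj (h : Linked Γ X r s) (hr : r ∈ X) (hsp : Γ s p) :
    Linked Γ (insert p X) r p :=
  (h.mono (Finset.subset_insert p X) hr).trans (Linked.of_adj hsp (Finset.mem_insert_self p X))

lemma sum_union_of_even {D : Finset τ} (hI : IsEvenSet Γ w I) (hD : ∀ d ∈ D, d ∉ I) :
    ∑ x ∈ D ∪ I, w x = ∑ x ∈ D, w x := by
  rw [Finset.sum_union (Finset.disjoint_left.2 hD), hI.sum, add_zero]

/-- An intermediate set is `I` together with some elements of `D`, so its total weight is a sum over
`D`. Minimality of covers is checked below by inspecting this sum. -/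
lemma sum_between {D K : Finset τ} (hI : IsEvenSet Γ w I) (hD : ∀ d ∈ D, d ∉ I) (hIK : I ⊆ K)
    (hK : K ⊆ D ∪ I) : ∑ x ∈ K, w x = ∑ d ∈ D, if d ∈ K then w d else 0 := by
  have h1 : K = D.filter (· ∈ K) ∪ I := by
    ext z
    simp only [Finset.mem_union, Finset.mem_filter]
    constructor
    · intro hz
      rcases Finset.mem_union.1 (hK hz) with h | h
      · exact Or.inl ⟨h, hz⟩
      · exact Or.inr h
    · rintro (h | h)
      · exact h.2
      · exact hIK h
  rw [← Finset.sum_filter]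
  conv_lhs => rw [h1]
  exact sum_union_of_even hI (fun d hd => hD d (Finset.mem_filter.1 hd).1)

lemma ZMod.eq_one_of_ne_zero {a : ZMod 2} (h : a ≠ 0) : a = 1 := by
  revert h; revert a; decide

/-- `J` covers `I` in the poset of the sets satisfying `Q`. -/
def Cov (Q : Finset τ → Prop) (I J : Finset τ) : Prop :=
  Q I ∧ Q J ∧ I ⊂ J ∧ ∀ K, Q K → I ⊂ K → K ⊆ J → K = J

lemma covBy_iff_cov {Q : Finset τ → Prop} {I J : {X // Q X}} : I ⋖ J ↔ Cov Q I.1 J.1 := by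
  constructor
  · intro h
    refine ⟨I.2, J.2, h.lt, fun K hK hIK hKJ => ?_⟩
    have := h.eq_or_eq (c := ⟨K, hK⟩) hIK.subset hKJ
    rcases this with h | h
    · rw [← h] at hIK; exact absurd rfl hIK.ne
    · rw [← h]
  · rintro ⟨-, -, h, hmin⟩
    refine ⟨h, fun K hIK hKJ => ?_⟩
    exact (show K.1 ⊂ J.1 from hKJ).ne (hmin K.1 K.2 hIK hKJ.le)

lemma Cov.not_ssubset {Q : Finset τ → Prop} {a b z : Finset τ} (ha : Cov Q I a) (hb : Cov Q I b)
    (hz : Cov Q b z) : a ≠ z := by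
  rintro rfl
  exact hz.2.2.1.ne (ha.2.2.2 b hb.2.1 hb.2.2.1 hz.2.2.1.subset)

lemma Cov.eq_of_subset {Q : Finset τ → Prop} {a b : Finset τ} (ha : Cov Q I a) (hb : Cov Q I b)
    (h : a ⊆ b) : a = b := hb.2.2.2 a ha.2.1 ha.2.2.1 h

/-- An atom order on a poset of finite sets given by a key of the covers. -/
theorem isAtomOrder_of_key {Q : Finset τ → Prop} (key : Finset τ → Finset τ → ℕ∞)
    (exch : ∀ I a b y, Cov Q I a → Cov Q I b → a ≠ b → key I a ≤ key I b → Q y → a ⊆ y → b ⊆ y →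
      ∃ c z, Cov Q I c ∧ (c = a ∨ key I c < key I b) ∧ Cov Q b z ∧ c ⊆ z ∧ z ⊆ y)
    (coh : ∀ I a b z z', Cov Q I a → Cov Q I b → Cov Q b z → Cov Q b z' → key b z' < key b z →
      a ≠ b → key I a ≤ key I b → a ⊆ z →
      ∃ a', Cov Q I a' ∧ a' ⊆ z' ∧ a' ≠ b ∧ (a' = a ∨ key I a' < key I b)) :
    IsAtomOrder (fun x a b : {X // Q X} => key x.1 a.1 < key x.1 b.1) := by
  refine ⟨fun _ _ => lt_irrefl _, fun _ _ _ _ _ _ _ => lt_trans, ?_, ?_⟩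
  · intro x a b y ha hb hab hba hay hby
    rw [covBy_iff_cov] at ha hb
    obtain ⟨c, z, hc, hca, hz, hcz, hzy⟩ := exch x.1 a.1 b.1 y.1 ha hb
      (fun h => hab (Subtype.ext h)) (not_lt.1 hba) y.2 hay hby
    refine ⟨⟨c, hc.2.1⟩, ⟨z, hz.2.1⟩, covBy_iff_cov.2 hc, ?_, ?_, covBy_iff_cov.2 hz, ?_, hzy⟩
    · rintro rfl
      rcases hca with h | h
      · exact hab (Subtype.ext h.symm)
      · exact lt_irrefl _ h
    · exact hca.imp (fun h => Subtype.ext h) id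
    · exact lt_of_le_of_ne hcz (fun h => hc.not_ssubset hb hz (congrArg Subtype.val h))
  · intro x a b z z' hb hz hz' hR ha hab hba haz
    rw [covBy_iff_cov] at ha hb hz hz'
    obtain ⟨c, hc, hcz, hcb, h⟩ := coh x.1 a.1 b.1 z.1 z'.1 ha hb hz hz' hR
      (fun h => hab (Subtype.ext h)) (not_lt.1 hba) haz.le
    refine ⟨⟨c, hc.2.1⟩, covBy_iff_cov.2 hc, fun h => hcb (congrArg Subtype.val h), ?_, ?_⟩
    · exact lt_of_le_of_ne hcz (fun h => hc.not_ssubset hb hz' (congrArg Subtype.val h))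
    · exact h.imp (fun h => Subtype.ext h) Or.inr

lemma even_pair (hΓ : ∀ ⦃x y⦄, Γ x y → Γ y x) (hI : IsEvenSet Γ w I) (hs : s ∉ I) (ht : t ∉ I) (hst : s ≠ t)
    (hsum : w s + w t = 0) (hlink : w t ≠ 0 → Linked Γ ({s, t} ∪ I) s t) :
    IsEvenSet Γ w ({s, t} ∪ I) := by
  refine hI.of_linked hΓ Finset.subset_union_right (r := s) (by simp) ?_ ?_
  · intro x hx hxI hw
    simp only [Finset.mem_union, Finset.mem_insert, Finset.mem_singleton, hxI, or_false] at hx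
    rcases hx with rfl | rfl
    · exact Linked.refl
    · exact hlink hw
  · rw [sum_union_of_even hI (by simp [hs, ht]), Finset.sum_pair hst, hsum]

/-- An even set strictly in between would contain exactly one of the odd elements `s`, `t`, so its
total weight would be odd. -/
lemma cov_pair {Q : Finset τ → Prop} (hQ : ∀ K, Q K → IsEvenSet Γ w K) (hI : Q I)
    (hJ : Q ({s, t} ∪ I)) (hs : s ∉ I) (ht : t ∉ I) (hst : s ≠ t) (hws : w s ≠ 0) (hwt : w t ≠ 0) :
    Cov Q I ({s, t} ∪ I) := by
  refine ⟨hI, hJ, ⟨Finset.subset_union_right, fun h => hs (h (by simp))⟩, ?_⟩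
  intro K hK hIK hKJ
  have h0 := (hQ K hK).sum
  rw [sum_between (hQ I hI) (by simp [hs, ht]) hIK.subset hKJ, Finset.sum_pair hst] at h0
  refine hKJ.antisymm (Finset.union_subset ?_ hIK.subset)
  obtain ⟨x, hxK, hxI⟩ := Finset.exists_of_ssubset hIK
  have hx := hKJ hxK
  simp only [Finset.mem_union, Finset.mem_insert, Finset.mem_singleton, hxI, or_false] at hx
  intro z hz
  simp only [Finset.mem_insert, Finset.mem_singleton] at hz
  by_cases h1 : s ∈ K <;> by_cases h2 : t ∈ K
  · rcases hz with rfl | rfl <;> assumption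
  · exact absurd (by simpa [h1, h2] using h0) hws
  · exact absurd (by simpa [h1, h2] using h0) hwt
  · rcases hx with rfl | rfl
    exacts [absurd hxK h1, absurd hxK h2]

lemma cov_single {Q : Finset τ → Prop} (hI : Q I) (hJ : Q (insert s I)) (hs : s ∉ I) :
    Cov Q I (insert s I) := by
  refine ⟨hI, hJ, Finset.ssubset_insert hs, ?_⟩
  intro K hK hIK hKJ
  obtain ⟨x, hxK, hxI⟩ := Finset.exists_of_ssubset hIK
  have hx := hKJ hxK
  simp only [Finset.mem_insert, hxI, or_false] at hx
  subst hx
  exact hKJ.antisymm (Finset.insert_subset hxK hIK.subset)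

/-! ### Semimodularity when all new elements are odd. -/

section Semimodular

variable {Q : Finset τ → Prop} {Y : Finset τ}

/-- Any element of odd weight can be completed to a linked pair. -/
lemma exists_pair (hΓ : ∀ ⦃x y⦄, Γ x y → Γ y x) (hQ : ∀ K, Q K → IsEvenSet Γ w K)
    (hQ' : ∀ K ⊆ Y, IsEvenSet Γ w K → Q K) (hY : Q Y) (hI : Q I) (hIY : I ⊆ Y)
    (hw : ∀ t ∈ Y, t ∉ I → w t ≠ 0) (hs : s ∈ Y) (hsI : s ∉ I) :
    ∃ t ∈ Y, t ∉ I ∧ s ≠ t ∧ Linked Γ ({s, t} ∪ I) s t ∧ Cov Q I ({s, t} ∪ I) := by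
  have hws := hw s hs hsI
  obtain ⟨t, htY, htX, q, hq, hlq, hqt⟩ := exists_next (hQ Y hY) (X := insert s I)
    (Finset.insert_subset hs hIY) (hQ I hI) (Finset.subset_insert s I) (r := s) (by simp)
    (by
      intro x hx hxI _
      obtain rfl : x = s := by simpa [hxI] using hx
      exact Linked.refl)
    (by rw [Finset.sum_insert hsI, (hQ I hI).sum, add_zero]; exact hws)
  rw [Finset.mem_insert, not_or] at htX
  have hlink : Linked Γ ({s, t} ∪ I) s t := by
    have := hlq.insert_of_adj (by simp) hqt
    have he : insert t (insert s I) = {s, t} ∪ I := by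
      rw [Finset.insert_comm, Finset.insert_union, Finset.singleton_union]
    rwa [he] at this
  have hst : s ≠ t := Ne.symm htX.1
  have hwt := hw t htY htX.2
  refine ⟨t, htY, htX.2, hst, hlink, cov_pair hQ hI (hQ' _ ?_ ?_) hsI htX.2 hst hws hwt⟩
  · intro z hz
    simp only [Finset.mem_union, Finset.mem_insert, Finset.mem_singleton] at hz
    rcases hz with (rfl | rfl) | hz
    exacts [hs, htY, hIY hz]
  · refine even_pair hΓ (hQ I hI) hsI htX.2 hst ?_ (fun _ => hlink)
    rw [ZMod.eq_one_of_ne_zero hws, ZMod.eq_one_of_ne_zero hwt]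
    decide

/-- Any new element of the cover can be completed to an even pair inside the cover, and minimality
makes this pair everything. -/
lemma Cov.exists_eq_pair (hΓ : ∀ ⦃x y⦄, Γ x y → Γ y x) (hQ : ∀ K, Q K → IsEvenSet Γ w K) {a : Finset τ}
    (ha : Cov Q I a) (hQ' : ∀ K ⊆ a, IsEvenSet Γ w K → Q K) (hw : ∀ t ∈ a, t ∉ I → w t ≠ 0) :
    ∃ s t, s ∉ I ∧ t ∉ I ∧ s ≠ t ∧ Linked Γ ({s, t} ∪ I) s t ∧ a = {s, t} ∪ I := by
  obtain ⟨s, hs, hsI⟩ := Finset.exists_of_ssubset ha.2.2.1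
  obtain ⟨t, ht, htI, hst, hlink, hcov⟩ := exists_pair hΓ hQ hQ' ha.2.1 ha.1 ha.2.2.1.subset hw hs
    hsI
  refine ⟨s, t, hsI, htI, hst, hlink, (ha.2.2.2 _ hcov.2.1 hcov.2.2.1 ?_).symm⟩
  intro z hz
  simp only [Finset.mem_union, Finset.mem_insert, Finset.mem_singleton] at hz
  rcases hz with (rfl | rfl) | hz
  exacts [hs, ht, ha.2.2.1.subset hz]

/-- If all weights are odd, any two covers of `I` below `Y` have a common cover below `Y`. -/
lemma exists_cov_superset (hΓ : ∀ ⦃x y⦄, Γ x y → Γ y x) (hQ : ∀ K, Q K → IsEvenSet Γ w K)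
    (hQ' : ∀ K ⊆ Y, IsEvenSet Γ w K → Q K) (hY : Q Y) (hw : ∀ t ∈ Y, t ∉ I → w t ≠ 0)
    {a b : Finset τ} (ha : Cov Q I a) (hb : Cov Q I b) (hab : a ≠ b) (haY : a ⊆ Y) (hbY : b ⊆ Y) :
    ∃ z, Cov Q b z ∧ a ⊆ z ∧ z ⊆ Y := by
  obtain ⟨s, t, hs, ht, hst, hlink, rfl⟩ := ha.exists_eq_pair hΓ hQ
    (fun K hK => hQ' K (hK.trans haY)) (fun t ht => hw t (haY ht))
  have hIb := hb.2.2.1.subset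
  have hwb : ∀ t ∈ Y, t ∉ b → w t ≠ 0 := fun t ht htb => hw t ht (fun h => htb (hIb h))
  have hsY : s ∈ Y := haY (by simp)
  have htY : t ∈ Y := haY (by simp)
  -- If `b` already contains one element of the pair, the other one only needs some partner in `Y`.
  have one : ∀ s t, s ∈ Y → s ∉ b → t ∈ b → ∃ z, Cov Q b z ∧ {s, t} ∪ I ⊆ z ∧ z ⊆ Y := by
    intro s t hs hsb htb
    obtain ⟨p, hp, hpb, hsp, -, hcov⟩ := exists_pair hΓ hQ hQ' hY hb.2.1 hbY hwb hs hsb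
    refine ⟨_, hcov, ?_, ?_⟩
    · intro z hz
      simp only [Finset.mem_union, Finset.mem_insert, Finset.mem_singleton] at hz ⊢
      rcases hz with (rfl | rfl) | hz
      exacts [Or.inl (Or.inl rfl), Or.inr htb, Or.inr (hIb hz)]
    · intro z hz
      simp only [Finset.mem_union, Finset.mem_insert, Finset.mem_singleton] at hz
      rcases hz with (rfl | rfl) | hz
      exacts [hs, hp, hbY hz]
  by_cases hsb : s ∈ b
  · by_cases htb : t ∈ b
    · exact absurd (ha.eq_of_subset hb (by
        intro z hz
        simp only [Finset.mem_union, Finset.mem_insert, Finset.mem_singleton] at hz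
        rcases hz with (rfl | rfl) | hz
        exacts [hsb, htb, hIb hz])) hab
    · rw [Finset.pair_comm]
      exact one t s htY htb hsb
  · by_cases htb : t ∈ b
    · exact one s t hsY hsb htb
    · have hsub : {s, t} ∪ b ⊆ Y := by
        intro z hz
        simp only [Finset.mem_union, Finset.mem_insert, Finset.mem_singleton] at hz
        rcases hz with (rfl | rfl) | hz
        exacts [hsY, htY, hbY hz]
      have hws := hwb s hsY hsb
      have hwt := hwb t htY htb
      refine ⟨{s, t} ∪ b, cov_pair hQ hb.2.1 (hQ' _ hsub ?_) hsb htb hst hws hwt,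
        Finset.union_subset_union_right hIb, hsub⟩
      refine even_pair hΓ (hQ b hb.2.1) hsb htb hst ?_ (fun _ => ?_)
      · rw [ZMod.eq_one_of_ne_zero hws, ZMod.eq_one_of_ne_zero hwt]
        decide
      · exact hlink.mono (Finset.union_subset_union_right hIb) (by simp)

/-- A graph without multiple edges. -/
theorem exists_isAtomOrder_of_odd (hΓ : ∀ ⦃x y⦄, Γ x y → Γ y x) {g : Finset τ} (hw : ∀ t ∈ g, w t ≠ 0) :
    ∃ R, IsAtomOrder (P := {X : Finset τ // X ⊆ g ∧ IsEvenSet Γ w X}) R := by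
  -- A constant key gives the empty relation: every order of the covers is allowed.
  refine ⟨_, isAtomOrder_of_key (fun _ _ => 0) ?_ ?_⟩
  · intro I a b y ha hb hab _ hy hay hby
    obtain ⟨z, h1, h2, h3⟩ := exists_cov_superset hΓ (fun K hK => hK.2)
      (fun K hK h => ⟨hK.trans hy.1, h⟩) hy (fun t ht _ => hw t (hy.1 ht)) ha hb hab hay hby
    exact ⟨a, z, ha, Or.inl rfl, h1, h2, h3⟩
  · intro I a b z z' _ _ _ _ h
    exact absurd h (lt_irrefl _)

end Semimodular

end EvenSets
end EvenSubgraph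

/-! ### Graphs with a single bundle: the model and the covers in its poset. -/

namespace EvenSubgraph

/-- The combinatorial data of a graph with a single bundle with ends `u`, `v`. The tokens in `τ` are
the vertices and the edges of the bundle, the latter being adjacent to their ends. -/
structure BundleModel (τ : Type*) [DecidableEq τ] where
  adj : τ → τ → Prop
  symm : ∀ ⦃x y⦄, adj x y → adj y x
  w : τ → ZMod 2
  IsEdge : τ → Prop
  u : τ
  v : τ
  ne : u ≠ v
  adj_ends : adj u v
  not_isEdge_u : ¬ IsEdge u
  not_isEdge_v : ¬ IsEdge v
  adj_edge : ∀ e x, IsEdge e → (adj e x ↔ x = u ∨ x = v)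
  ground : Finset τ
  -- In the application such a vertex is incident only to simple edges, so admissibility puts it in
  -- `A`. The weights of the two ends and of the bundle edges remain arbitrary.
  w_vertex : ∀ x ∈ ground, ¬ IsEdge x → x ≠ u → x ≠ v → w x ≠ 0
  unique_nbr : ∀ W ⊆ ground, IsEvenSet adj w W → u ∉ W → v ∉ W → (∀ e ∈ W, ¬ IsEdge e) →
    ∀ s ∈ ground, ∀ t ∈ ground, s ∉ W → t ∉ W → ¬ IsEdge s → ¬ IsEdge t → s ≠ u → s ≠ v → t ≠ u →
      t ≠ v → Linked adj ({u, v, s} ∪ W) u s → Linked adj ({u, v, t} ∪ W) u t → s = t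
  -- An arbitrary enumeration, used to break ties between the vertices that compensate for the
  -- parity of an odd end.
  rank : τ → ℕ
  rank_inj : Set.InjOn rank ground

namespace BundleModel

variable {τ : Type*} [DecidableEq τ] {M : BundleModel τ} {x x' e s t p : τ} {I K X Y : Finset τ}

/-- `x`, `x'` are the two ends of the bundle, in some order. -/
def Ends (M : BundleModel τ) (x x' : τ) : Prop := (x = M.u ∧ x' = M.v) ∨ (x = M.v ∧ x' = M.u)

/-- The token sets of the even semi-induced subgraphs. -/
def Ok (M : BundleModel τ) (X : Finset τ) : Prop :=
  X ⊆ M.ground ∧ (∀ e ∈ X, M.IsEdge e → M.u ∈ X ∧ M.v ∈ X) ∧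
    (M.u ∈ X → M.v ∈ X → ∃ e ∈ X, M.IsEdge e) ∧ IsEvenSet M.adj M.w X

lemma Ends.symm (h : M.Ends x x') : M.Ends x' x :=
  Or.imp And.symm And.symm (Or.symm h)

lemma Ends.ne (h : M.Ends x x') : x ≠ x' := by
  rcases h with ⟨rfl, rfl⟩ | ⟨rfl, rfl⟩
  exacts [M.ne, M.ne.symm]

lemma Ends.adj (h : M.Ends x x') : M.adj x x' := by
  rcases h with ⟨rfl, rfl⟩ | ⟨rfl, rfl⟩
  exacts [M.adj_ends, M.symm M.adj_ends]

lemma Ends.not_isEdge (h : M.Ends x x') : ¬ M.IsEdge x := by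
  rcases h with ⟨rfl, rfl⟩ | ⟨rfl, rfl⟩
  exacts [M.not_isEdge_u, M.not_isEdge_v]

lemma Ends.ne_edge (h : M.Ends x x') (he : M.IsEdge e) : x ≠ e := by
  rintro rfl
  exact h.not_isEdge he

lemma Ends.adj_edge (h : M.Ends x x') (he : M.IsEdge e) : M.adj x e := by
  refine M.symm ((M.adj_edge e x he).2 ?_)
  rcases h with ⟨rfl, rfl⟩ | ⟨rfl, rfl⟩
  exacts [Or.inl rfl, Or.inr rfl]

lemma Ends.eq_or_eq (h : M.Ends x x') (he : M.IsEdge e) (ht : M.adj t e) : t = x ∨ t = x' := by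
  have := (M.adj_edge e t he).1 (M.symm ht)
  rcases h with ⟨rfl, rfl⟩ | ⟨rfl, rfl⟩
  exacts [this, this.symm]

lemma Ends.w_vertex (h : M.Ends x x') (ht : t ∈ M.ground) (hte : ¬ M.IsEdge t) (htx : t ≠ x)
    (htx' : t ≠ x') : M.w t ≠ 0 := by
  rcases h with ⟨rfl, rfl⟩ | ⟨rfl, rfl⟩
  exacts [M.w_vertex t ht hte htx htx', M.w_vertex t ht hte htx' htx]

lemma Ends.cases (h : M.Ends x x') {y y' : τ} (h' : M.Ends y y') :
    (y = x ∧ y' = x') ∨ (y = x' ∧ y' = x) := by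
  rcases h with ⟨rfl, rfl⟩ | ⟨rfl, rfl⟩
  exacts [h', Or.symm h']

lemma ends (M : BundleModel τ) : M.Ends M.u M.v := Or.inl ⟨rfl, rfl⟩

lemma Ends.both (h : M.Ends x x') : (M.u ∈ X ∧ M.v ∈ X) ↔ (x ∈ X ∧ x' ∈ X) := by
  rcases h with ⟨rfl, rfl⟩ | ⟨rfl, rfl⟩
  exacts [Iff.rfl, and_comm]

lemma Ok.even (h : M.Ok X) : IsEvenSet M.adj M.w X := h.2.2.2

lemma Ok.mem_of_edge (hX : M.Ok X) (h : M.Ends x x') (he : e ∈ X) (hee : M.IsEdge e) : x ∈ X :=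
  (h.both.1 (hX.2.1 e he hee)).1

lemma Ok.exists_edge (hX : M.Ok X) (h : M.Ends x x') (hx : x ∈ X) (hx' : x' ∈ X) :
    ∃ e ∈ X, M.IsEdge e := by
  have := h.both.2 ⟨hx, hx'⟩
  exact hX.2.2.1 this.1 this.2

lemma Ok.not_isEdge (hX : M.Ok X) (h : M.Ends x x') (hx : x ∉ X) : ∀ e ∈ X, ¬ M.IsEdge e :=
  fun _ he hee => hx (hX.mem_of_edge h he hee)

lemma ok_of_mem (hI : M.Ok I) (h : M.Ends x x') (hx : x ∈ I) (hx' : x' ∈ I) (hIX : I ⊆ X)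
    (hX : X ⊆ M.ground) (hev : IsEvenSet M.adj M.w X) : M.Ok X := by
  have := h.both.2 ⟨hx, hx'⟩
  obtain ⟨e, he, hee⟩ := hI.exists_edge h hx hx'
  exact ⟨hX, fun _ _ _ => ⟨hIX this.1, hIX this.2⟩, fun _ _ => ⟨e, hIX he, hee⟩, hev⟩

lemma ok_of_edge (h : M.Ends x x') (hx : x ∈ X) (hx' : x' ∈ X) (he : e ∈ X) (hee : M.IsEdge e)
    (hX : X ⊆ M.ground) (hev : IsEvenSet M.adj M.w X) : M.Ok X := by
  have := h.both.2 ⟨hx, hx'⟩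
  exact ⟨hX, fun _ _ _ => ⟨this.1, this.2⟩, fun _ _ => ⟨e, he, hee⟩, hev⟩

lemma ok_of_notMem (h : M.Ends x x') (hx : x ∉ X) (hX : X ⊆ M.ground)
    (hno : ∀ e ∈ X, ¬ M.IsEdge e) (hev : IsEvenSet M.adj M.w X) : M.Ok X := by
  refine ⟨hX, fun e he hee => absurd hee (hno e he), fun hu hv => ?_, hev⟩
  exact absurd (h.both.1 ⟨hu, hv⟩).1 hx

lemma Ok.of_subset (hY : M.Ok Y) (h : M.Ends x x') (hx : x ∉ Y) (hX : X ⊆ Y)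
    (hev : IsEvenSet M.adj M.w X) : M.Ok X :=
  ok_of_notMem h (fun hx' => hx (hX hx')) (hX.trans hY.1)
    (fun e he => hY.not_isEdge h hx e (hX he)) hev

lemma Ok.w_ne_zero (hY : M.Ok Y) (h : M.Ends x x') (hx : x ∉ Y) (ht : t ∈ Y) (htx' : t ≠ x') :
    M.w t ≠ 0 :=
  h.w_vertex (hY.1 ht) (hY.not_isEdge h hx t ht) (fun htx => hx (htx ▸ ht)) htx'

lemma zmod_two (a : ZMod 2) : a = 0 ∨ a = 1 := by revert a; decide

lemma even_union (hI : IsEvenSet M.adj M.w I) {D : Finset τ} (hD : ∀ d ∈ D, d ∉ I) {r : τ}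
    (hr : r ∈ D) (hlink : ∀ d ∈ D, M.w d ≠ 0 → Linked M.adj (D ∪ I) r d)
    (hsum : ∑ d ∈ D, M.w d = 0) : IsEvenSet M.adj M.w (D ∪ I) := by
  refine hI.of_linked M.symm Finset.subset_union_right (Finset.mem_union_left _ hr) ?_ ?_
  · intro t ht htI
    exact hlink t ((Finset.mem_union.1 ht).resolve_right htI)
  · rw [sum_union_of_even hI hD, hsum]

lemma cov_of_subset {D : Finset τ} (hI : M.Ok I) (hJ : M.Ok (D ∪ I)) (hD : ∀ d ∈ D, d ∉ I)
    (hne : D.Nonempty) (hmin : ∀ K, M.Ok K → I ⊆ K → K ⊆ D ∪ I → (∃ d ∈ D, d ∈ K) →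
      (∑ d ∈ D, if d ∈ K then M.w d else 0) = 0 → D ⊆ K) : Cov M.Ok I (D ∪ I) := by
  obtain ⟨d, hd⟩ := hne
  refine ⟨hI, hJ, ⟨Finset.subset_union_right, fun h => hD d hd (h (Finset.mem_union_left _ hd))⟩, ?_⟩
  intro K hK hIK hKJ
  obtain ⟨k, hkK, hkI⟩ := Finset.exists_of_ssubset hIK
  have h0 := hK.even.sum
  rw [sum_between hI.even hD hIK.subset hKJ] at h0
  exact hKJ.antisymm (Finset.union_subset (hmin K hK hIK.subset hKJ
    ⟨k, (Finset.mem_union.1 (hKJ hkK)).resolve_right hkI, hkK⟩ h0) hIK.subset)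

/-- Once both ends are present, bundle edges of weight zero are dead: they connect nothing new.
Every other token outside `X` is odd, so an odd component can be extended by an odd token. -/
lemma exists_next_odd (h : M.Ends x x') (hY : M.Ok Y) (hXY : X ⊆ Y) (hI : IsEvenSet M.adj M.w I)
    (hIX : I ⊆ X) (hx : x ∈ X) (hx' : x' ∈ X)
    (hlink : ∀ t ∈ X, t ∉ I → M.w t ≠ 0 → Linked M.adj X x t) (hsum : ∑ t ∈ X, M.w t ≠ 0) :
    ∃ p ∈ Y, p ∉ X ∧ M.w p ≠ 0 ∧ Linked M.adj (insert p X) x p := by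
  obtain ⟨p, hpY, hpX, hpD, q, hq, hlq, hqp⟩ := exists_next_of_dead hY.even hXY hI hIX hx hlink hsum
    (fun d => M.IsEdge d ∧ M.w d = 0) (by
      rintro d ⟨hd, hd0⟩
      refine ⟨hd0, fun t hdt => ?_⟩
      rcases h.eq_or_eq hd (M.symm hdt) with rfl | rfl
      · exact Linked.refl
      · exact Linked.of_adj h.adj hx')
  refine ⟨p, hpY, hpX, ?_, hlq.insert_of_adj hx hqp⟩
  by_cases hpe : M.IsEdge p
  · exact fun h0 => hpD ⟨hpe, h0⟩
  · exact h.w_vertex (hY.1 hpY) hpe (by rintro rfl; exact hpX hx) (by rintro rfl; exact hpX hx')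

/-! ### The covers -/

/-- Adding the missing end `x` forces adding a bundle edge, since `x'` is already there. An edge of
the same weight as `x` is all that is needed. -/
lemma cov_activate (h : M.Ends x x') (hI : M.Ok I) (hx' : x' ∈ I) (hx : x ∉ I)
    (hxg : x ∈ M.ground) (heg : e ∈ M.ground) (he : M.IsEdge e) (hw : M.w e = M.w x) :
    Cov M.Ok I ({x, e} ∪ I) := by
  have heI : e ∉ I := fun h' => hx (hI.mem_of_edge h h' he)
  have hxe := h.ne_edge he
  have hD : ∀ d ∈ ({x, e} : Finset τ), d ∉ I := by simp [hx, heI]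
  have hev : IsEvenSet M.adj M.w ({x, e} ∪ I) := by
    refine even_union hI.even hD (r := x) (by simp) ?_ ?_
    · intro d hd _
      simp only [Finset.mem_insert, Finset.mem_singleton] at hd
      rcases hd with rfl | rfl
      · exact Linked.refl
      · exact Linked.of_adj (h.adj_edge he) (by simp)
    · rw [Finset.sum_pair hxe, hw]
      exact CharTwo.add_self_eq_zero _
  have hok : M.Ok ({x, e} ∪ I) := by
    refine ok_of_edge h (by simp) (by simp [hx']) (e := e) (by simp) he ?_ hev
    intro z hz
    simp only [Finset.mem_union, Finset.mem_insert, Finset.mem_singleton] at hz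
    rcases hz with (rfl | rfl) | hz
    exacts [hxg, heg, hI.1 hz]
  refine cov_of_subset hI hok hD (by simp) ?_
  intro K hK hIK hKJ hd _
  have hxK : x ∈ K := by
    obtain ⟨d, hd, hdK⟩ := hd
    simp only [Finset.mem_insert, Finset.mem_singleton] at hd
    rcases hd with rfl | rfl
    · exact hdK
    · exact hK.mem_of_edge h hdK he
  obtain ⟨e', he'K, he'⟩ := hK.exists_edge h hxK (hIK hx')
  have := hKJ he'K
  simp only [Finset.mem_union, Finset.mem_insert, Finset.mem_singleton] at this
  rcases this with (rfl | rfl) | h2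
  · exact absurd he' h.not_isEdge
  · simp [Finset.insert_subset_iff, hxK, he'K]
  · exact absurd (hI.mem_of_edge h h2 he') hx

/-- When the edge has the wrong parity, an odd token `s` repairs it. The condition `hedge` excludes
the case of an odd end `x` and an odd edge `s`, in which `{x, s} ∪ I` would already be even and
smaller. -/
lemma cov_activate_pair (h : M.Ends x x') (hI : M.Ok I) (hx' : x' ∈ I) (hx : x ∉ I)
    (hxg : x ∈ M.ground) (heg : e ∈ M.ground) (hsg : s ∈ M.ground) (he : M.IsEdge e)
    (hw : M.w e ≠ M.w x) (hs : s ∉ I) (hsx : s ≠ x) (hse : s ≠ e) (hws : M.w s ≠ 0)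
    (hedge : M.IsEdge s → M.w x = 0) (hlink : Linked M.adj ({x, e, s} ∪ I) x s) :
    Cov M.Ok I ({x, e, s} ∪ I) := by
  have heI : e ∉ I := fun h' => hx (hI.mem_of_edge h h' he)
  have hxe := h.ne_edge he
  have hD : ∀ d ∈ ({x, e, s} : Finset τ), d ∉ I := by simp [hx, heI, hs]
  have hsum3 : ∀ f : τ → ZMod 2, ∑ d ∈ ({x, e, s} : Finset τ), f d = f x + (f e + f s) := by
    intro f
    rw [Finset.sum_insert (by simp [hxe, hsx.symm]), Finset.sum_pair hse.symm]
  have hev : IsEvenSet M.adj M.w ({x, e, s} ∪ I) := by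
    refine even_union hI.even hD (r := x) (by simp) ?_ ?_
    · intro d hd _
      simp only [Finset.mem_insert, Finset.mem_singleton] at hd
      rcases hd with rfl | rfl | rfl
      · exact Linked.refl
      · exact Linked.of_adj (h.adj_edge he) (by simp)
      · exact hlink
    · rw [hsum3]
      revert hw hws
      generalize M.w x = a, M.w e = b, M.w s = c
      revert a b c; decide
  have hok : M.Ok ({x, e, s} ∪ I) := by
    refine ok_of_edge h (by simp) (by simp [hx']) (e := e) (by simp) he ?_ hev
    intro z hz
    simp only [Finset.mem_union, Finset.mem_insert, Finset.mem_singleton] at hz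
    rcases hz with (rfl | rfl | rfl) | hz
    exacts [hxg, heg, hsg, hI.1 hz]
  refine cov_of_subset hI hok hD (by simp) ?_
  intro K hK hIK hKJ hd h0
  rw [hsum3] at h0
  have hws1 := ZMod.eq_one_of_ne_zero hws
  have hxK : x ∈ K := by
    by_contra hxK
    have heK : e ∉ K := fun h' => hxK (hK.mem_of_edge h h' he)
    obtain ⟨d, hd, hdK⟩ := hd
    simp only [Finset.mem_insert, Finset.mem_singleton] at hd
    rcases hd with rfl | rfl | rfl
    · exact hxK hdK
    · exact heK hdK
    · simp [hxK, heK, hdK, hws1] at h0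
  obtain ⟨e', he'K, he'⟩ := hK.exists_edge h hxK (hIK hx')
  have := hKJ he'K
  simp only [Finset.mem_union, Finset.mem_insert, Finset.mem_singleton] at this
  rcases this with (rfl | rfl | rfl) | h2
  · exact absurd he' h.not_isEdge
  · have hsK : s ∈ K := by
      by_contra hsK
      simp only [hxK, he'K, hsK, if_true, if_false, add_zero] at h0
      revert hw h0
      generalize M.w x = a, M.w e' = b
      revert a b; decide
    simp [Finset.insert_subset_iff, hxK, he'K, hsK]
  · have heK : e ∈ K := by
      by_contra heK
      simp [hxK, heK, he'K, hws1, hedge he'] at h0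
    simp [Finset.insert_subset_iff, hxK, he'K, heK]
  · exact absurd (hI.mem_of_edge h h2 he') hx

/-- Bringing in the missing end `x` is always possible in one cover below `Y`: with an edge of the
weight of `x` if `Y` has one, and otherwise with any edge of `Y` and one more odd token. With `Y`
itself a cover of `I`, this classifies the covers containing `x`. -/
lemma exists_activation (h : M.Ends x x') (hI : M.Ok I) (hY : M.Ok Y) (hIY : I ⊆ Y) (hx' : x' ∈ I)
    (hx : x ∉ I) (hxY : x ∈ Y) : ∃ z, Cov M.Ok I z ∧ x ∈ z ∧ z ⊆ Y ∧
      ((∃ e, M.IsEdge e ∧ M.w e = M.w x ∧ z = {x, e} ∪ I) ∨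
        ∃ e s, M.IsEdge e ∧ M.w e ≠ M.w x ∧ M.w s ≠ 0 ∧ s ∉ I ∧ s ≠ x ∧ s ≠ e ∧
          (M.IsEdge s → M.w x = 0) ∧ Linked M.adj z x s ∧ z = {x, e, s} ∪ I) := by
  by_cases hex : ∃ e ∈ Y, M.IsEdge e ∧ M.w e = M.w x
  · obtain ⟨e, heY, he, hw⟩ := hex
    refine ⟨_, cov_activate h hI hx' hx (hY.1 hxY) (hY.1 heY) he hw, by simp, ?_,
      Or.inl ⟨e, he, hw, rfl⟩⟩
    simp [Finset.insert_subset_iff, hxY, heY, hIY]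
  · push Not at hex
    obtain ⟨e, heY, he⟩ := hY.exists_edge h hxY (hIY hx')
    have hw := hex e heY he
    have heI : e ∉ I := fun h' => hx (hI.mem_of_edge h h' he)
    have hxe := h.ne_edge he
    obtain ⟨p, hpY, hpX, hwp, hlink⟩ := exists_next_odd h hY (X := {x, e} ∪ I)
      (by simp [Finset.insert_subset_iff, hxY, heY, hIY]) hI.even
      Finset.subset_union_right (by simp) (by simp [hx'])
      (by
        intro t ht htI _
        simp only [Finset.mem_union, Finset.mem_insert, Finset.mem_singleton, htI, or_false] at ht
        rcases ht with rfl | rfl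
        · exact Linked.refl
        · exact Linked.of_adj (h.adj_edge he) (by simp))
      (by
        rw [sum_union_of_even hI.even (by simp [hx, heI]), Finset.sum_pair hxe]
        revert hw
        generalize M.w x = a, M.w e = b
        revert a b; decide)
    simp only [Finset.mem_union, Finset.mem_insert, Finset.mem_singleton, not_or] at hpX
    have heq : insert p ({x, e} ∪ I) = {x, e, p} ∪ I := by ext; simp; tauto
    rw [heq] at hlink
    have hedge : M.IsEdge p → M.w x = 0 := by
      intro hp
      have := hex p hpY hp
      rw [ZMod.eq_one_of_ne_zero hwp] at this
      exact (zmod_two _).resolve_right (Ne.symm this)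
    refine ⟨{x, e, p} ∪ I, cov_activate_pair h hI hx' hx (hY.1 hxY) (hY.1 heY) (hY.1 hpY) he hw
      hpX.2 hpX.1.1 hpX.1.2 hwp hedge hlink, by simp, ?_,
      Or.inr ⟨e, p, he, hw, hwp, hpX.2, hpX.1.1, hpX.1.2, hedge, hlink, rfl⟩⟩
    simp [Finset.insert_subset_iff, hxY, heY, hIY, hpY]

lemma cov_linked_pair (hI : M.Ok I) (hJ : M.Ok ({s, t} ∪ I)) (hs : s ∉ I) (ht : t ∉ I)
    (hst : s ≠ t) (hws : M.w s ≠ 0) (hwt : M.w t ≠ 0) : Cov M.Ok I ({s, t} ∪ I) :=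
  cov_pair (fun _ hK => Ok.even hK) hI hJ hs ht hst hws hwt

lemma even_linked_pair (hI : IsEvenSet M.adj M.w I) (hs : s ∉ I) (ht : t ∉ I) (hst : s ≠ t)
    (hws : M.w s ≠ 0) (hwt : M.w t ≠ 0) (hlink : Linked M.adj ({s, t} ∪ I) s t) :
    IsEvenSet M.adj M.w ({s, t} ∪ I) := by
  refine even_pair M.symm hI hs ht hst ?_ (fun _ => hlink)
  rw [ZMod.eq_one_of_ne_zero hws, ZMod.eq_one_of_ne_zero hwt]
  decide

/-- With both ends in `I`, an even token is added alone and an odd token needs an odd partner. If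
the component of `t` contains the ends, the dead edges can be avoided; if not, the next token cannot
be a bundle edge, since edges are adjacent only to the ends. -/
lemma exists_cov_mem (h : M.Ends x x') (hI : M.Ok I) (hx : x ∈ I) (hx' : x' ∈ I) (hY : M.Ok Y)
    (hIY : I ⊆ Y) (ht : t ∈ Y) (htI : t ∉ I) : ∃ z, Cov M.Ok I z ∧ t ∈ z ∧ z ⊆ Y ∧
      (z = insert t I ∨ ∃ p, p ≠ t ∧ p ∉ I ∧ M.w t ≠ 0 ∧ M.w p ≠ 0 ∧
        Linked M.adj ({t, p} ∪ I) t p ∧ z = {t, p} ∪ I) := by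
  have hsub : insert t I ⊆ Y := Finset.insert_subset ht hIY
  by_cases hw : M.w t = 0
  · refine ⟨_, cov_single hI (ok_of_mem hI h hx hx' (Finset.subset_insert _ _) (hsub.trans hY.1) ?_)
      htI, by simp, hsub, Or.inl rfl⟩
    refine hI.even.of_linked M.symm (Finset.subset_insert _ _) (r := t) (by simp) ?_ ?_
    · intro y hy hyI hwy
      obtain rfl : y = t := by simpa [hyI] using hy
      exact absurd hw hwy
    · rw [Finset.sum_insert htI, hI.even.sum, hw, add_zero]
  · have hlk : ∀ y ∈ insert t I, y ∉ I → M.w y ≠ 0 → Linked M.adj (insert t I) t y := by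
      intro y hy hyI _
      obtain rfl : y = t := by simpa [hyI] using hy
      exact Linked.refl
    have hsum : ∑ y ∈ insert t I, M.w y ≠ 0 := by
      rw [Finset.sum_insert htI, hI.even.sum, add_zero]; exact hw
    obtain ⟨p, hpY, hpX, hwp, hlink⟩ : ∃ p ∈ Y, p ∉ insert t I ∧ M.w p ≠ 0 ∧
        Linked M.adj (insert p (insert t I)) t p := by
      by_cases hl : Linked M.adj (insert t I) t x
      · obtain ⟨p, hpY, hpX, hwp, hlink⟩ := exists_next_odd h hY hsub hI.even
          (Finset.subset_insert _ _) (Finset.mem_insert_of_mem hx) (Finset.mem_insert_of_mem hx')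
          (fun y hy hyI hwy =>
            (hl.symm M.symm (by simp)).trans (hlk y hy hyI hwy)) hsum
        exact ⟨p, hpY, hpX, hwp,
          (hl.mono (Finset.subset_insert _ _) (by simp)).trans hlink⟩
      · obtain ⟨p, hpY, hpX, q, hq, hlq, hqp⟩ := exists_next hY.even hsub hI.even
          (Finset.subset_insert _ _) (r := t) (by simp) hlk hsum
        refine ⟨p, hpY, hpX, h.w_vertex (hY.1 hpY) ?_ ?_ ?_, hlq.insert_of_adj (by simp) hqp⟩
        · intro hp
          rcases h.eq_or_eq hp hqp with rfl | rfl
          · exact hl hlq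
          · exact hl (hlq.trans (Linked.of_adj h.symm.adj (Finset.mem_insert_of_mem hx)))
        · rintro rfl; exact hpX (Finset.mem_insert_of_mem hx)
        · rintro rfl; exact hpX (Finset.mem_insert_of_mem hx')
    simp only [Finset.mem_insert, not_or] at hpX
    have heq : insert p (insert t I) = {t, p} ∪ I := by ext; simp; tauto
    rw [heq] at hlink
    have hsub' : {t, p} ∪ I ⊆ Y := by
      simp [Finset.insert_subset_iff, ht, hpY, hIY]
    refine ⟨{t, p} ∪ I, cov_linked_pair hI (ok_of_mem hI h hx hx' Finset.subset_union_right
      (hsub'.trans hY.1) (even_linked_pair hI.even htI hpX.2 (Ne.symm hpX.1) hw hwp hlink)) htI hpX.2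
      (Ne.symm hpX.1) hw hwp, by simp, hsub', Or.inr ⟨p, hpX.1, hpX.2, hw, hwp, hlink, rfl⟩⟩

lemma cov_insert_end (h : M.Ends x x') (hI : M.Ok I) (hx : x ∉ I) (hx' : x' ∉ I)
    (hxg : x ∈ M.ground) (hw : M.w x = 0) : Cov M.Ok I (insert x I) := by
  refine cov_single hI (ok_of_notMem h.symm ?_ (Finset.insert_subset hxg hI.1) ?_ ?_) hx
  · simp [hx', h.ne.symm]
  · intro e he
    rcases Finset.mem_insert.1 he with rfl | he
    · exact h.not_isEdge
    · exact hI.not_isEdge h hx e he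
  · refine hI.even.of_linked M.symm (Finset.subset_insert _ _) (r := x) (by simp) ?_ ?_
    · intro y hy hyI hwy
      obtain rfl : y = x := by simpa [hyI] using hy
      exact absurd hw hwy
    · rw [Finset.sum_insert hx, hI.even.sum, hw, add_zero]

lemma exists_start_pair (h : M.Ends x x') (hI : M.Ok I) (hY : M.Ok Y) (hIY : I ⊆ Y) (hx : x ∉ I)
    (hxY : x ∈ Y) (hx' : x' ∉ Y) (hw : M.w x ≠ 0) :
    ∃ p ∈ Y, p ∉ I ∧ p ≠ x ∧ Linked M.adj ({x, p} ∪ I) x p ∧ Cov M.Ok I ({x, p} ∪ I) := by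
  obtain ⟨p, hpY, hpI, hxp, hl, hc⟩ := exists_pair M.symm (fun K hK => Ok.even hK)
    (fun K hK hev => hY.of_subset h.symm hx' hK hev) hY hI hIY (fun t ht _ => by
      by_cases htx : t = x
      · rwa [htx]
      · exact hY.w_ne_zero h.symm hx' ht htx) hxY hx
  exact ⟨p, hpY, hpI, hxp.symm, hl, hc⟩

/-- By parity an intermediate even set contains both odd ends or neither. With both it needs a
bundle edge, and `e` is the only one available. -/
lemma cov_both (h : M.Ends x x') (hI : M.Ok I) (hx : x ∉ I) (hx' : x' ∉ I) (hxg : x ∈ M.ground)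
    (hxg' : x' ∈ M.ground) (hw : M.w x ≠ 0) (hw' : M.w x' ≠ 0) (heg : e ∈ M.ground)
    (he : M.IsEdge e) (hwe : M.w e = 0) : Cov M.Ok I ({x, x', e} ∪ I) := by
  have heI : e ∉ I := fun h' => hx (hI.mem_of_edge h h' he)
  have hxe := h.ne_edge he
  have hxe' := h.symm.ne_edge he
  have hD : ∀ d ∈ ({x, x', e} : Finset τ), d ∉ I := by simp [hx, heI, hx']
  have hw1 := ZMod.eq_one_of_ne_zero hw
  have hw1' := ZMod.eq_one_of_ne_zero hw'
  have hsum3 : ∀ f : τ → ZMod 2, ∑ d ∈ ({x, x', e} : Finset τ), f d = f x + (f x' + f e) := by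
    intro f
    rw [Finset.sum_insert (by simp [hxe, h.ne]), Finset.sum_pair hxe']
  have hev : IsEvenSet M.adj M.w ({x, x', e} ∪ I) := by
    refine even_union hI.even hD (r := x) (by simp) ?_ ?_
    · intro d hd _
      simp only [Finset.mem_insert, Finset.mem_singleton] at hd
      rcases hd with rfl | rfl | rfl
      · exact Linked.refl
      · exact Linked.of_adj h.adj (by simp)
      · exact Linked.of_adj (h.adj_edge he) (by simp)
    · rw [hsum3, hw1, hw1', hwe]
      decide
  have hok : M.Ok ({x, x', e} ∪ I) := by
    refine ok_of_edge h (by simp) (by simp) (e := e) (by simp) he ?_ hev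
    simp [Finset.insert_subset_iff, hxg, hxg', heg, hI.1]
  refine cov_of_subset hI hok hD (by simp) ?_
  intro K hK hIK hKJ hd h0
  rw [hsum3, hw1, hw1', hwe] at h0
  have aux : x ∈ K ∧ x' ∈ K := by
    obtain ⟨d, hd, hdK⟩ := hd
    simp only [Finset.mem_insert, Finset.mem_singleton] at hd
    by_cases h1 : x ∈ K <;> by_cases h2 : x' ∈ K <;> simp [h1, h2] at h0
    · exact ⟨h1, h2⟩
    · rcases hd with rfl | rfl | rfl
      · exact absurd hdK h1
      · exact absurd hdK h2
      · exact absurd (hK.mem_of_edge h hdK he) h1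
  obtain ⟨e', he'K, he'⟩ := hK.exists_edge h aux.1 aux.2
  have := hKJ he'K
  simp only [Finset.mem_union, Finset.mem_insert, Finset.mem_singleton] at this
  rcases this with (rfl | rfl | rfl) | h2
  · exact absurd he' h.not_isEdge
  · exact absurd he' h.symm.not_isEdge
  · simp [Finset.insert_subset_iff, aux, he'K]
  · exact absurd (hI.mem_of_edge h h2 he') hx

/-- The two ends must come together with an edge, and parity then forces both odd edges. -/
lemma cov_both_pair (h : M.Ends x x') (hI : M.Ok I) (hx : x ∉ I) (hx' : x' ∉ I) (hxg : x ∈ M.ground)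
    (hxg' : x' ∈ M.ground) (hw : M.w x ≠ 0) (hw' : M.w x' ≠ 0) (heg : e ∈ M.ground)
    (he : M.IsEdge e) (hwe : M.w e ≠ 0) {f : τ} (hfg : f ∈ M.ground) (hf : M.IsEdge f)
    (hwf : M.w f ≠ 0) (hef : e ≠ f) : Cov M.Ok I ({x, x', e, f} ∪ I) := by
  have heI : e ∉ I := fun h' => hx (hI.mem_of_edge h h' he)
  have hfI : f ∉ I := fun h' => hx (hI.mem_of_edge h h' hf)
  have hxe := h.ne_edge he
  have hxe' := h.symm.ne_edge he
  have hxf := h.ne_edge hf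
  have hxf' := h.symm.ne_edge hf
  have hD : ∀ d ∈ ({x, x', e, f} : Finset τ), d ∉ I := by simp [hx, heI, hx', hfI]
  have hw1 := ZMod.eq_one_of_ne_zero hw
  have hw1' := ZMod.eq_one_of_ne_zero hw'
  have hwe1 := ZMod.eq_one_of_ne_zero hwe
  have hwf1 := ZMod.eq_one_of_ne_zero hwf
  have hsum4 : ∀ g : τ → ZMod 2,
      ∑ d ∈ ({x, x', e, f} : Finset τ), g d = g x + (g x' + (g e + g f)) := by
    intro g
    rw [Finset.sum_insert (by simp [hxe, h.ne, hxf]), Finset.sum_insert (by simp [hxe', hxf']),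
      Finset.sum_pair hef]
  have hev : IsEvenSet M.adj M.w ({x, x', e, f} ∪ I) := by
    refine even_union hI.even hD (r := x) (by simp) ?_ ?_
    · intro d hd _
      simp only [Finset.mem_insert, Finset.mem_singleton] at hd
      rcases hd with rfl | rfl | rfl | rfl
      · exact Linked.refl
      · exact Linked.of_adj h.adj (by simp)
      · exact Linked.of_adj (h.adj_edge he) (by simp)
      · exact Linked.of_adj (h.adj_edge hf) (by simp)
    · rw [hsum4, hw1, hw1', hwe1, hwf1]
      decide
  have hok : M.Ok ({x, x', e, f} ∪ I) := by
    refine ok_of_edge h (by simp) (by simp) (e := e) (by simp) he ?_ hev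
    simp [Finset.insert_subset_iff, hxg, hxg', heg, hfg, hI.1]
  refine cov_of_subset hI hok hD (by simp) ?_
  intro K hK hIK hKJ hd h0
  rw [hsum4, hw1, hw1', hwe1, hwf1] at h0
  have hiff : x ∈ K ∧ x' ∈ K := by
    by_contra hno
    have heK : e ∉ K := fun h' =>
      hno ⟨hK.mem_of_edge h h' he, hK.mem_of_edge h.symm h' he⟩
    have hfK : f ∉ K := fun h' =>
      hno ⟨hK.mem_of_edge h h' hf, hK.mem_of_edge h.symm h' hf⟩
    obtain ⟨d, hd, hdK⟩ := hd
    simp only [Finset.mem_insert, Finset.mem_singleton] at hd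
    by_cases h1 : x ∈ K <;> by_cases h2 : x' ∈ K <;> simp [h1, h2, heK, hfK] at h0
    · exact hno ⟨h1, h2⟩
    · rcases hd with rfl | rfl | rfl | rfl
      exacts [h1 hdK, h2 hdK, heK hdK, hfK hdK]
  obtain ⟨e', he'K, he'⟩ := hK.exists_edge h hiff.1 hiff.2
  have hmem : e ∈ K ∨ f ∈ K := by
    have := hKJ he'K
    simp only [Finset.mem_union, Finset.mem_insert, Finset.mem_singleton] at this
    rcases this with (rfl | rfl | rfl | rfl) | h2
    · exact absurd he' h.not_isEdge
    · exact absurd he' h.symm.not_isEdge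
    · exact Or.inl he'K
    · exact Or.inr he'K
    · exact absurd (hI.mem_of_edge h h2 he') hx
  have h110 : (1 : ZMod 2) + 1 = 0 := by decide
  by_cases h1 : e ∈ K <;> by_cases h2 : f ∈ K <;> simp [hiff, h1, h2, h110] at h0 hmem
  simp [Finset.insert_subset_iff, hiff, h1, h2]

/-- Otherwise the components of `u` and `v` over `I`, together with all bundle edges in `Y`, form a
union of components of `Y`. The two odd ends cancel, so its weight is that of the edges, which is
odd. -/
lemma exists_start_next (hI : M.Ok I) (hu : M.u ∉ I) (hv : M.v ∉ I) (hY : M.Ok Y) (hIY : I ⊆ Y)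
    (huY : M.u ∈ Y) (hvY : M.v ∈ Y) (hw : M.w M.u ≠ 0) (hw' : M.w M.v ≠ 0)
    [DecidablePred M.IsEdge] (hsum : ∑ e ∈ Y with M.IsEdge e, M.w e ≠ 0) :
    ∃ x x' p, M.Ends x x' ∧ p ∈ Y ∧ p ∉ I ∧ p ≠ x ∧ p ≠ x' ∧ ¬ M.IsEdge p ∧
      Linked M.adj ({x, p} ∪ I) x p := by
  by_contra! hno
  apply hsum
  have hmem : ∀ {x x'}, M.Ends x x' → ∀ y ∈ block M.adj (insert x I) x, ∀ t ∈ Y, M.adj y t →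
      t ∈ block M.adj (insert x I) x ∨ t = x' ∨ M.IsEdge t := by
    intro x x' h y hy t ht hyt
    by_cases htX : t ∈ insert x I
    · exact Or.inl (isClosedIn_block.2 y hy t htX hyt)
    · by_contra! hcon
      simp only [Finset.mem_insert, not_or] at htX
      refine hno x x' t h ht htX.2 htX.1 hcon.2.1 hcon.2.2 ?_
      have := (mem_block.1 hy).2.insert_of_adj (by simp) hyt
      have heq : insert t (insert x I) = {x, t} ∪ I := by ext; simp; tauto
      rwa [heq] at this
  set Z := block M.adj (insert M.u I) M.u ∪ block M.adj (insert M.v I) M.v ∪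
    Y.filter M.IsEdge with hZ
  have huZ : M.u ∈ Z := by simp [hZ, mem_block, Linked.refl]
  have hvZ : M.v ∈ Z := by simp [hZ, mem_block, Linked.refl]
  have hcl : IsClosedIn M.adj Z Y := by
    refine ⟨Finset.union_subset (Finset.union_subset ?_ ?_) (Finset.filter_subset _ _), ?_⟩
    · exact isClosedIn_block.1.trans (Finset.insert_subset huY hIY)
    · exact isClosedIn_block.1.trans (Finset.insert_subset hvY hIY)
    · intro y hy t ht hyt
      by_cases hte : M.IsEdge t
      · simp [hZ, ht, hte]
      rcases Finset.mem_union.1 hy with hy | hy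
      · rcases Finset.mem_union.1 hy with hy | hy
        · rcases hmem M.ends y hy t ht hyt with h | rfl | h
          · simp only [hZ, Finset.mem_union, h, true_or]
          · exact hvZ
          · exact absurd h hte
        · rcases hmem M.ends.symm y hy t ht hyt with h | rfl | h
          · simp only [hZ, Finset.mem_union, h, true_or, or_true]
          · exact huZ
          · exact absurd h hte
      · rcases M.ends.eq_or_eq (Finset.mem_filter.1 hy).2 (M.symm hyt) with rfl | rfl
        exacts [huZ, hvZ]
  have h0 := hY.even Z hcl
  rw [hcl.sum_eq hI.even hIY] at h0
  have hZI : Z \ I = insert M.u (insert M.v (Y.filter M.IsEdge)) := by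
    ext t
    have hb : ∀ x, t ∈ block M.adj (insert x I) x → t ∉ I → t = x := by
      intro x ht htI
      have := (mem_block.1 ht).1
      simpa [htI] using this
    constructor
    · intro ht
      rw [Finset.mem_sdiff] at ht
      rcases Finset.mem_union.1 ht.1 with h | h
      · rcases Finset.mem_union.1 h with h | h
        · simp [hb _ h ht.2]
        · simp [hb _ h ht.2]
      · simp only [Finset.mem_insert, h, or_true]
    · intro ht
      rw [Finset.mem_sdiff]
      rcases Finset.mem_insert.1 ht with rfl | ht
      · exact ⟨huZ, hu⟩
      rcases Finset.mem_insert.1 ht with rfl | ht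
      · exact ⟨hvZ, hv⟩
      · exact ⟨Finset.mem_union_right _ ht, fun h' =>
          hu (hI.mem_of_edge M.ends h' (Finset.mem_filter.1 ht).2)⟩
  rw [hZI, Finset.sum_insert (by simp [M.ne, M.not_isEdge_u]),
    Finset.sum_insert (by simp [M.not_isEdge_v]), ← add_assoc, ZMod.eq_one_of_ne_zero hw,
    ZMod.eq_one_of_ne_zero hw', show (1 : ZMod 2) + 1 = 0 by decide, zero_add] at h0
  exact h0

/-- If the bundle cannot be entered through one of its ends, it is entered through both. -/
lemma exists_start_both (hI : M.Ok I) (hu : M.u ∉ I) (hv : M.v ∉ I) (hY : M.Ok Y) (hIY : I ⊆ Y)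
    (huY : M.u ∈ Y) (hvY : M.v ∈ Y) (hw : M.w M.u ≠ 0) (hw' : M.w M.v ≠ 0)
    (hno : ¬ ∃ x x' p, M.Ends x x' ∧ p ∈ Y ∧ p ∉ I ∧ p ≠ x ∧ p ≠ x' ∧ ¬ M.IsEdge p ∧
      Linked M.adj ({x, p} ∪ I) x p) :
    (∃ e ∈ Y, M.IsEdge e ∧ M.w e = 0 ∧ Cov M.Ok I ({M.u, M.v, e} ∪ I)) ∨
    (∃ e ∈ Y, ∃ f ∈ Y, M.IsEdge e ∧ M.IsEdge f ∧ e ≠ f ∧ M.w e ≠ 0 ∧ M.w f ≠ 0 ∧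
      Cov M.Ok I ({M.u, M.v, e, f} ∪ I)) := by
  classical
  obtain ⟨e, heY, he⟩ := hY.2.2.1 huY hvY
  by_cases hwe : M.w e = 0
  · exact Or.inl ⟨e, heY, he, hwe, cov_both M.ends hI hu hv (hY.1 huY) (hY.1 hvY) hw hw' (hY.1 heY)
      he hwe⟩
  by_cases hf : ∃ f ∈ Y, M.IsEdge f ∧ f ≠ e
  · obtain ⟨f, hfY, hf, hfe⟩ := hf
    by_cases hwf : M.w f = 0
    · exact Or.inl ⟨f, hfY, hf, hwf, cov_both M.ends hI hu hv (hY.1 huY) (hY.1 hvY) hw hw'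
        (hY.1 hfY) hf hwf⟩
    · exact Or.inr ⟨e, heY, f, hfY, he, hf, hfe.symm, hwe, hwf, cov_both_pair M.ends hI hu hv
        (hY.1 huY) (hY.1 hvY) hw hw' (hY.1 heY) he hwe (hY.1 hfY) hf hwf hfe.symm⟩
  -- If `e` is the only bundle edge in `Y`, it is odd, and `exists_start_next` yields an entrance
  -- through one end.
  · push Not at hf
    refine absurd (exists_start_next hI hu hv hY hIY huY hvY hw hw' ?_) hno
    have : Y.filter M.IsEdge = {e} := by
      ext f
      simp only [Finset.mem_filter, Finset.mem_singleton]
      exact ⟨fun h => hf f h.1 h.2, fun h => h ▸ ⟨heY, he⟩⟩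
    rwa [this, Finset.sum_singleton]

end BundleModel
end EvenSubgraph

/-! ### The key ordering the covers, and exchange for covers containing both ends. -/

namespace EvenSubgraph
namespace BundleModel

variable {τ : Type*} [DecidableEq τ] {M : BundleModel τ} {x x' e s t p : τ}
  {I J X Y a b y z z' : Finset τ}

open Classical in
/-- The key of a cover `J` of `I` when exactly one end of the bundle is not in `I`, namely `x`. -/
noncomputable def activationKey (M : BundleModel τ) (x : τ) (I J : Finset τ) : ℕ∞ :=
  -- Covers bringing in `x` come first. Among them, trouble arises only when `x` is odd and only
  -- even edges are used: then a compensating vertex `s` is also added. These covers are put after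
  -- the ones using an odd edge and are sorted by the rank of `s`, the only term of the sum.
  if x ∉ J then ⊤ else if M.w x = 0 ∨ ∃ e ∈ J, M.IsEdge e ∧ M.w e ≠ 0 then 0 else
    ((1 + ∑ t ∈ J \ I with t ≠ x ∧ ¬ M.IsEdge t, M.rank t : ℕ) : ℕ∞)

open Classical in
/-- The key of a cover `J` of `I` when no end of the bundle is in `I`. -/
noncomputable def startKey (M : BundleModel τ) (J : Finset τ) : ℕ∞ :=
  -- Covers entering through exactly one end come first, except through an odd end when the other
  -- end is even: then the even end, which can be added alone, has priority.
  if ∃ x x', M.Ends x x' ∧ x ∈ J ∧ x' ∉ J ∧ (M.w x = 0 ∨ M.w x' ≠ 0) then 0 else ⊤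

open Classical in
/-- The key of a cover `J` of `I`: covers with a smaller key have to come earlier. -/
noncomputable def key (M : BundleModel τ) (I J : Finset τ) : ℕ∞ :=
  if M.u ∈ I then (if M.v ∈ I then ⊤ else M.activationKey M.v I J)
  else if M.v ∈ I then M.activationKey M.u I J else M.startKey J

lemma key_of_both (h : M.Ends x x') (hx : x ∈ I) (hx' : x' ∈ I) : M.key I J = ⊤ := by
  have := h.both.2 ⟨hx, hx'⟩
  simp [key, this]

lemma key_of_one (h : M.Ends x x') (hx' : x' ∈ I) (hx : x ∉ I) :
    M.key I J = M.activationKey x I J := by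
  rcases h with ⟨rfl, rfl⟩ | ⟨rfl, rfl⟩ <;> simp [key, hx, hx']

lemma key_of_none (h : M.Ends x x') (hx : x ∉ I) (hx' : x' ∉ I) : M.key I J = M.startKey J := by
  rcases h with ⟨rfl, rfl⟩ | ⟨rfl, rfl⟩ <;> simp [key, hx, hx']

lemma activationKey_lt_top : M.activationKey x I J < ⊤ ↔ x ∈ J := by
  unfold activationKey
  split_ifs with h1 h2
  · simp [h1]
  · simpa using h1
  · simp [h1]

lemma startKey_eq_zero (h : M.Ends x x') (hx : x ∈ J) (hx' : x' ∉ J)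
    (hw : M.w x = 0 ∨ M.w x' ≠ 0) : M.startKey J = 0 :=
  if_pos ⟨x, x', h, hx, hx', hw⟩

lemma exists_of_startKey_lt_top (h : M.startKey J < ⊤) :
    ∃ x x', M.Ends x x' ∧ x ∈ J ∧ x' ∉ J ∧ (M.w x = 0 ∨ M.w x' ≠ 0) := by
  by_contra hno
  simp [startKey, hno] at h

lemma startKey_eq_top (h : M.Ends x x') (hx : x ∈ J ↔ x' ∈ J) : M.startKey J = ⊤ := by
  refine if_neg ?_
  rintro ⟨y, y', h', hy, hy', -⟩
  rcases h.cases h' with ⟨rfl, rfl⟩ | ⟨rfl, rfl⟩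
  · exact hy' (hx.1 hy)
  · exact hy' (hx.2 hy)

lemma startKey_eq_top_of_weight (h : M.Ends x x') (hx : x ∈ J) (hw : M.w x ≠ 0) (hw' : M.w x' = 0) :
    M.startKey J = ⊤ := by
  refine if_neg ?_
  rintro ⟨y, y', h', hy, hy', hyw⟩
  rcases h.cases h' with ⟨rfl, rfl⟩ | ⟨rfl, rfl⟩
  · rcases hyw with hyw | hyw
    exacts [hw hyw, hyw hw']
  · exact hy' hx

/-! ### The exchange property -/

/-- When `b` misses an end of the bundle which is in `y`, and the other end is in `I`. -/
lemma exchange_activation (h : M.Ends x x') (hx' : x' ∈ I) (hb : Cov M.Ok I b) (hx : x ∉ b)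
    (hy : M.Ok y) (hby : b ⊆ y) (hxy : x ∈ y) :
    ∃ c z, Cov M.Ok I c ∧ M.key I c < M.key I b ∧ Cov M.Ok b z ∧ c ⊆ z ∧ z ⊆ y := by
  have hIb := hb.2.2.1.subset
  obtain ⟨z, hz, hxz, hzy, -⟩ := exists_activation h hb.2.1 hy hby (hIb hx') hx hxy
  have hxI : x ∉ I := fun h' => hx (hIb h')
  -- Applying activation again, over `I` and inside `z`, gives a cover containing `x`. Its key is
  -- finite, whereas the key of `b` is `⊤`.
  obtain ⟨c, hc, hxc, hcz, -⟩ := exists_activation h hb.1 hz.2.1 (hIb.trans hz.2.2.1.subset) hx' hxI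
    hxz
  refine ⟨c, z, hc, ?_, hz, hcz, hzy⟩
  rw [key_of_one h hx' hxI, key_of_one h hx' hxI]
  have h1 := activationKey_lt_top (M := M) (I := I).2 hxc
  have h2 := mt (activationKey_lt_top (M := M) (I := I)).1 hx
  rw [not_lt_top_iff] at h2
  rwa [h2]

/-- Below a set that misses an end there are no bundle edges, and all new tokens are odd (the end
`x'` by assumption), so the semimodular case applies. -/
lemma exchange_semimodular (h : M.Ends x x') (ha : Cov M.Ok I a) (hb : Cov M.Ok I b) (hab : a ≠ b)
    (hy : M.Ok y) (hay : a ⊆ y) (hby : b ⊆ y) (hxy : x ∉ y)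
    (hw : x' ∈ y → x' ∉ I → M.w x' ≠ 0) : ∃ z, Cov M.Ok b z ∧ a ⊆ z ∧ z ⊆ y := by
  refine exists_cov_superset M.symm (fun K hK => Ok.even hK)
    (fun K hK hev => hy.of_subset h hxy hK hev) hy ?_ ha hb hab hay hby
  intro t ht htI
  by_cases htx : t = x'
  · subst htx; exact hw ht htI
  · exact hy.w_ne_zero h hxy ht htx

lemma absorb_one (h : M.Ends x x') (hb : M.Ok b) (hx : x ∈ b) (hx' : x' ∈ b) (hy : M.Ok y)
    (hby : b ⊆ y) (ht : t ∈ y) (htb : t ∉ b) (ha : a ⊆ insert t b) :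
    ∃ z, Cov M.Ok b z ∧ a ⊆ z ∧ z ⊆ y := by
  obtain ⟨z, hz, htz, hzy, -⟩ := exists_cov_mem h hb hx hx' hy hby ht htb
  exact ⟨z, hz, ha.trans (Finset.insert_subset htz hz.2.2.1.subset), hzy⟩

/-- Above a `b` containing the bundle, two linked odd tokens are absorbed by one cover: together if
both are new, and by completing the new one otherwise. -/
lemma absorb_two (h : M.Ends x x') (ha : Cov M.Ok I a) (hb : Cov M.Ok I b) (hab : a ≠ b)
    (hx : x ∈ b) (hx' : x' ∈ b) (hy : M.Ok y) (hby : b ⊆ y) (hs : s ∈ y) (ht : t ∈ y)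
    (hst : s ≠ t) (hws : M.w s ≠ 0) (hwt : M.w t ≠ 0) (hsub : a ⊆ {s, t} ∪ b)
    (hlink : s ∉ b → t ∉ b → Linked M.adj ({s, t} ∪ b) s t) :
    ∃ z, Cov M.Ok b z ∧ a ⊆ z ∧ z ⊆ y := by
  by_cases hsb : s ∈ b
  · by_cases htb : t ∈ b
    · exact absurd (ha.eq_of_subset hb (hsub.trans (by
        simp [hsb, htb]))) hab
    · refine absorb_one h hb.2.1 hx hx' hy hby ht htb (hsub.trans ?_)
      simp [hsb]
  · by_cases htb : t ∈ b
    · refine absorb_one h hb.2.1 hx hx' hy hby hs hsb (hsub.trans ?_)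
      simp [htb]
    · have hsub' : {s, t} ∪ b ⊆ y := by simp [Finset.insert_subset_iff, hs, ht, hby]
      refine ⟨{s, t} ∪ b, cov_linked_pair hb.2.1 (ok_of_mem hb.2.1 h hx hx'
        Finset.subset_union_right (hsub'.trans hy.1) ?_) hsb htb hst hws hwt, hsub, hsub'⟩
      exact even_linked_pair hb.2.1.even hsb htb hst hws hwt (hlink hsb htb)

/-- An edge of the bundle is not needed for connecting other tokens. -/
lemma Linked.erase_edge (h : M.Ends x x') (he : M.IsEdge e) (hx : x ∈ X) (hx' : x' ∈ X)
    (hl : Linked M.adj X s t) (hse : s ≠ e) (hte : t ≠ e) : Linked M.adj (X.erase e) s t := by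
  intro C hC hs
  have hCX : C ⊆ X := hC.1.trans (Finset.erase_subset _ _)
  have hxe := h.ne_edge he
  have hxe' := h.symm.ne_edge he
  by_cases hxC : x ∈ C
  · have hx'C : x' ∈ C := hC.2 x hxC x' (Finset.mem_erase.2 ⟨hxe', hx'⟩) h.adj
    by_cases heX : e ∈ X
    · have := hl (insert e C) ⟨Finset.insert_subset heX hCX, ?_⟩ (Finset.mem_insert_of_mem hs)
      · exact (Finset.mem_insert.1 this).resolve_left hte
      · intro y hy z hz hyz
        by_cases hze : z = e
        · simp [hze]
        rcases Finset.mem_insert.1 hy with rfl | hy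
        · rcases h.eq_or_eq he (M.symm hyz) with rfl | rfl <;> simp [hxC, hx'C]
        · exact Finset.mem_insert_of_mem (hC.2 y hy z (Finset.mem_erase.2 ⟨hze, hz⟩) hyz)
    · rw [Finset.erase_eq_of_notMem heX] at hC
      exact hl C hC hs
  · have hx'C : x' ∉ C := fun h' => hxC (hC.2 x' h' x (Finset.mem_erase.2 ⟨hxe, hx⟩) h.symm.adj)
    refine hl C ⟨hCX, fun y hy z hz hyz => ?_⟩ hs
    by_cases hze : z = e
    · subst hze
      rcases h.eq_or_eq he hyz with rfl | rfl
      exacts [absurd hy hxC, absurd hy hx'C]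
    · exact hC.2 y hy z (Finset.mem_erase.2 ⟨hze, hz⟩) hyz

/-- Here the edge is even and `s` is a vertex, so the key does not depend on the edge. Edges can
therefore be swapped without changing the key. -/
lemma activationKey_light (h : M.Ends x x') (hI : M.Ok I) (hx : x ∉ I) (hw : M.w x ≠ 0)
    (he : M.IsEdge e) (hwe : M.w e = 0) (hs : s ∉ I) (hsx : s ≠ x) (hse : ¬ M.IsEdge s) :
    M.activationKey x I ({x, e, s} ∪ I) = ((1 + M.rank s : ℕ) : ℕ∞) := by
  classical
  have h1 : x ∈ ({x, e, s} ∪ I : Finset τ) := by simp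
  have h2 : ¬ ∃ f ∈ ({x, e, s} ∪ I : Finset τ), M.IsEdge f ∧ M.w f ≠ 0 := by
    rintro ⟨f, hf, hfe, hwf⟩
    simp only [Finset.mem_union, Finset.mem_insert, Finset.mem_singleton] at hf
    rcases hf with (rfl | rfl | rfl) | hf
    · exact h.not_isEdge hfe
    · exact hwf hwe
    · exact hse hfe
    · exact hx (hI.mem_of_edge h hf hfe)
  have h3 : (({x, e, s} ∪ I) \ I : Finset τ).filter (fun t => t ≠ x ∧ ¬ M.IsEdge t) = {s} := by
    ext t
    simp only [Finset.mem_filter, Finset.mem_sdiff, Finset.mem_union, Finset.mem_insert,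
      Finset.mem_singleton]
    constructor
    · rintro ⟨⟨(rfl | rfl | rfl) | h1, h2⟩, h3, h4⟩
      · exact absurd rfl h3
      · exact absurd he h4
      · rfl
      · exact absurd h1 h2
    · rintro rfl
      exact ⟨⟨by simp, hs⟩, hsx, hse⟩
  rw [activationKey, if_neg (not_not.2 h1), if_neg (by rintro (h0 | h0); exacts [hw h0, h2 h0])]
  congr 2
  rw [← Finset.sum_singleton M.rank s, ← h3]
  congr

/-- A cover entering the bundle through both ends. -/
lemma _root_.EvenSubgraph.Cov.exists_eq_both (ha : Cov M.Ok I a) (hu : M.u ∉ I) (hv : M.v ∉ I)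
    (hua : M.u ∈ a) (hva : M.v ∈ a) :
    (∃ e ∈ a, M.IsEdge e ∧ M.w e = 0 ∧ a = {M.u, M.v, e} ∪ I) ∨
    (∃ e ∈ a, ∃ f ∈ a, M.IsEdge e ∧ M.IsEdge f ∧ e ≠ f ∧ M.w e ≠ 0 ∧ M.w f ≠ 0 ∧
      a = {M.u, M.v, e, f} ∪ I) := by
  have hIa := ha.2.2.1.subset
  -- An even end could be added alone, giving a smaller cover without the other end.
  have hwend : ∀ {x x'}, M.Ends x x' → x ∉ I → x' ∉ I → x ∈ a → x' ∈ a → M.w x ≠ 0 := by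
    intro x x' h hx hx' hxa hxa' hw
    have hc := cov_insert_end h ha.1 hx hx' (ha.2.1.1 hxa) hw
    rw [← hc.eq_of_subset ha (Finset.insert_subset hxa hIa), Finset.mem_insert] at hxa'
    rcases hxa' with h' | h'
    exacts [h.ne h'.symm, hx' h']
  -- An entrance `p` would give the smaller even set `{x, p} ∪ I` containing only one end.
  have hno : ¬ ∃ x x' p, M.Ends x x' ∧ p ∈ a ∧ p ∉ I ∧ p ≠ x ∧ p ≠ x' ∧ ¬ M.IsEdge p ∧
      Linked M.adj ({x, p} ∪ I) x p := by
    rintro ⟨x, x', p, h, hpa, hpI, hpx, hpx', hpE, hl⟩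
    obtain ⟨hxa, hxa'⟩ := h.both.1 ⟨hua, hva⟩
    obtain ⟨hxI, hxI'⟩ : x ∉ I ∧ x' ∉ I := by
      rcases h with ⟨rfl, rfl⟩ | ⟨rfl, rfl⟩
      exacts [⟨hu, hv⟩, ⟨hv, hu⟩]
    have hsub : {x, p} ∪ I ⊆ a := by simp [Finset.insert_subset_iff, hxa, hpa, hIa]
    have hwx := hwend h hxI hxI' hxa hxa'
    have hwp := h.w_vertex (ha.2.1.1 hpa) hpE hpx hpx'
    have hok : M.Ok ({x, p} ∪ I) := by
      refine ok_of_notMem h.symm ?_ (hsub.trans ha.2.1.1) ?_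
        (even_linked_pair ha.1.even hxI hpI hpx.symm hwx hwp hl)
      · simp [hxI', hpx'.symm, h.ne.symm]
      · intro e he
        simp only [Finset.mem_union, Finset.mem_insert, Finset.mem_singleton] at he
        rcases he with (rfl | rfl) | he
        exacts [h.not_isEdge, hpE, ha.1.not_isEdge h hxI e he]
    have := (cov_linked_pair ha.1 hok hxI hpI hpx.symm hwx hwp).eq_of_subset ha hsub
    rw [← this] at hxa'
    simp [hxI', hpx'.symm, h.ne.symm] at hxa'
  rcases exists_start_both ha.1 hu hv ha.2.1 hIa hua hva (hwend M.ends hu hv hua hva)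
    (hwend M.ends.symm hv hu hva hua) hno with ⟨e, hea, he, hwe, hc⟩ |
      ⟨e, hea, f, hfa, he, hf, hef, hwe, hwf, hc⟩
  · exact Or.inl ⟨e, hea, he, hwe, (hc.eq_of_subset ha
      (by simp [Finset.insert_subset_iff, hua, hva, hea, hIa])).symm⟩
  · exact Or.inr ⟨e, hea, f, hfa, he, hf, hef, hwe, hwf, (hc.eq_of_subset ha
      (by simp [Finset.insert_subset_iff, hua, hva, hea, hfa, hIa])).symm⟩

/-- The exchange property for covers containing the bundle. -/
lemma exchange_of_both (ha : Cov M.Ok I a) (hb : Cov M.Ok I b) (hab : a ≠ b)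
    (hkey : M.key I a ≤ M.key I b) (hy : M.Ok y) (hay : a ⊆ y) (hby : b ⊆ y)
    (hu : M.u ∈ b) (hv : M.v ∈ b) :
    ∃ c z, Cov M.Ok I c ∧ (c = a ∨ M.key I c < M.key I b) ∧ Cov M.Ok b z ∧ c ⊆ z ∧ z ⊆ y := by
  suffices hsuff : (∃ z, Cov M.Ok b z ∧ a ⊆ z ∧ z ⊆ y) ∨ ∃ c z, Cov M.Ok I c ∧
      M.key I c < M.key I b ∧ Cov M.Ok b z ∧ c ⊆ z ∧ z ⊆ y by
    rcases hsuff with ⟨z, h1, h2, h3⟩ | ⟨c, z, h1, h2, h3⟩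
    · exact ⟨a, z, ha, Or.inl rfl, h1, h2, h3⟩
    · exact ⟨c, z, h1, Or.inr h2, h3⟩
  have hIa := ha.2.2.1.subset
  have hIb := hb.2.2.1.subset
  have hboth : ∀ {x x'}, M.Ends x x' → x ∈ b := fun h => (h.both.1 ⟨hu, hv⟩).1
  -- a cover avoiding an end of the bundle which is not in `I`
  have hpair : ∀ {x x'}, M.Ends x x' → x ∉ a → (x' ∈ a → x' ∉ I → M.w x' ≠ 0) →
      ∃ z, Cov M.Ok b z ∧ a ⊆ z ∧ z ⊆ y := by
    intro x x' h hxa hw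
    have hwa : ∀ t ∈ a, t ∉ I → M.w t ≠ 0 := by
      intro t ht htI
      by_cases htx : t = x'
      · subst htx; exact hw ht htI
      · exact ha.2.1.w_ne_zero h hxa ht htx
    obtain ⟨s, t, hs, ht, hst, hl, heq⟩ := ha.exists_eq_pair M.symm (fun K hK => Ok.even hK)
      (fun K hK hev => ha.2.1.of_subset h hxa hK hev) hwa
    have hsa : s ∈ a := by simp [heq]
    have hta : t ∈ a := by simp [heq]
    refine absorb_two M.ends ha hb hab hu hv hy hby (hay hsa) (hay hta) hst (hwa s hsa hs)
      (hwa t hta ht) ?_ ?_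
    · rw [heq]; exact Finset.union_subset_union_right hIb
    · intro _ _
      exact hl.mono (Finset.union_subset_union_right hIb) (by simp)
  -- covers of a set containing exactly one of the ends
  have hact : ∀ {x x'}, M.Ends x x' → x' ∈ I → x ∉ I → (∃ z, Cov M.Ok b z ∧ a ⊆ z ∧ z ⊆ y) ∨
      ∃ c z, Cov M.Ok I c ∧ M.key I c < M.key I b ∧ Cov M.Ok b z ∧ c ⊆ z ∧ z ⊆ y := by
    intro x x' h hx' hx
    by_cases hxa : x ∈ a
    swap
    · exact Or.inl (hpair h hxa (fun _ h' => absurd hx' h'))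
    have hxb := hboth h
    obtain ⟨c, hc, hxc, hca, hform⟩ := exists_activation h ha.1 ha.2.1 hIa hx' hx hxa
    obtain rfl := hc.eq_of_subset ha hca
    rcases hform with ⟨e, he, hwe, heq⟩ | ⟨e, s, he, hwe, hws, hs, hsx, hse, hedge, hl, heq⟩
    · left
      have hea : e ∈ c := by simp [heq]
      have heb : e ∉ b := by
        intro heb
        apply hab
        refine ha.eq_of_subset hb ?_
        rw [heq]
        simp [Finset.insert_subset_iff, hxb, heb, hIb]
      refine absorb_one M.ends hb.2.1 hu hv hy hby (hay hea) heb ?_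
      rw [heq]
      simp [Finset.insert_subset_iff, hxb, hIb.trans (Finset.subset_insert _ _)]
    · have hea : e ∈ c := by simp [heq]
      have hsa : s ∈ c := by simp [heq]
      have hac : c ⊆ {e, s} ∪ b := by
        rw [heq]
        simpa [Finset.insert_subset_iff, hxb] using
          hIb.trans ((Finset.subset_insert _ _).trans (Finset.subset_insert _ _))
      by_cases hwe0 : M.w e = 0
      swap
      · left
        refine absorb_two M.ends ha hb hab hu hv hy hby (hay hea) (hay hsa) hse.symm hwe0 hws hac ?_
        intro _ _
        have h1 : Linked M.adj ({e, s} ∪ b) x s := by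
          refine hl.mono hac ?_
          simp [heq]
        exact (Linked.of_adj (M.symm (h.adj_edge he)) (by simp [hxb])).trans h1
      have hwx : M.w x ≠ 0 := fun h0 => hwe (by rw [hwe0, h0])
      have hsE : ¬ M.IsEdge s := fun h' => hwx (hedge h')
      have hk : M.key I c = ((1 + M.rank s : ℕ) : ℕ∞) := by
        rw [key_of_one h hx' hx, heq]
        exact activationKey_light h ha.1 hx hwx he hwe0 hs hsx hsE
      obtain ⟨d, hd, hxd, hdb, hform'⟩ := exists_activation h hb.1 hb.2.1 hIb hx' hx hxb
      obtain rfl := hd.eq_of_subset hb hdb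
      rcases hform' with ⟨f, hf, hwf, heq'⟩ | ⟨f, t, hf, hwf, hwt, ht, htx, htf, hedge', hl', heq'⟩
      -- As `x` is odd, so is the edge `f`, and `d` has key 0. This cannot be preceded by `c`, whose
      -- key is positive: here the order is essential.
      · exfalso
        have hk0 : M.key I d = 0 := by
          rw [key_of_one h hx' hx, activationKey, if_neg (not_not.2 hxd), if_pos]
          exact Or.inr ⟨f, by simp [heq'], hf, by rwa [hwf]⟩
        rw [hk, hk0, nonpos_iff_eq_zero] at hkey
        norm_cast at hkey
        omega
      · have htE : ¬ M.IsEdge t := fun h' => hwx (hedge' h')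
        have hwf0 : M.w f = 0 := by
          rcases zmod_two (M.w f) with h0 | h0
          · exact h0
          · exact absurd (h0.trans (ZMod.eq_one_of_ne_zero hwx).symm) hwf
        have hk' : M.key I d = ((1 + M.rank t : ℕ) : ℕ∞) := by
          rw [key_of_one h hx' hx, heq']
          exact activationKey_light h ha.1 hx hwx hf hwf0 ht htx htE
        have htd : t ∈ d := by simp [heq']
        have hfd : f ∈ d := by simp [heq']
        rw [hk, hk', Nat.cast_le] at hkey
        by_cases hsd : s ∈ d
        · left
          have heb : e ∉ d := by
            intro heb
            exact hab (ha.eq_of_subset hb (hac.trans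
              (by simp [heb, hsd])))
          refine absorb_one M.ends hb.2.1 hu hv hy hby (hay hea) heb (hac.trans ?_)
          simp [hsd]
        -- Both covers use an even edge with different vertices `s`, `t`, and a single cover of `d`
        -- need not contain both `e` and `s`. The cover `{x, f, s} ∪ I` borrows the edge of `d` and
        -- the vertex of `c`; it has smaller key than `d`, and adding it to `d` only requires adding
        -- `s`.
        · right
          obtain ⟨z, hz, hsz, hzy, -⟩ := exists_cov_mem M.ends hb.2.1 hu hv hy hby (hay hsa) hsd
          have hdz := hz.2.2.1.subset
          -- The link from `x` to `s` does not need the edge `e`, because the two ends are adjacent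
          -- tokens.
          have hlc : Linked M.adj ({x, f, s} ∪ I) x s := by
            have h1 := Linked.erase_edge h he (hxc) (hIa hx') hl (h.ne_edge he) hse
            refine h1.mono ?_ (Finset.mem_erase.2 ⟨h.ne_edge he, hxc⟩)
            rw [heq]
            intro r hr
            simp only [Finset.mem_erase, Finset.mem_union, Finset.mem_insert,
              Finset.mem_singleton] at hr ⊢
            tauto
          have hcov := cov_activate_pair h ha.1 hx' hx (ha.2.1.1 hxa) (hb.2.1.1 hfd) (ha.2.1.1 hsa) hf
            hwf hs hsx (by rintro rfl; exact hsE hf) hws hedge hlc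
          refine ⟨{x, f, s} ∪ I, z, hcov, ?_, hz, ?_, hzy⟩
          · rw [hk', key_of_one h hx' hx, activationKey_light h ha.1 hx hwx hf hwf0 hs hsx hsE,
              Nat.cast_lt]
            have : M.rank s ≠ M.rank t := by
              intro h'
              exact hsd (M.rank_inj (ha.2.1.1 hsa) (hb.2.1.1 htd) h' ▸ htd)
            omega
          · simp [Finset.insert_subset_iff, hdz hxd, hdz hfd, hsz, hIb.trans hdz]
  by_cases huI : M.u ∈ I
  · by_cases hvI : M.v ∈ I
    · left
      obtain ⟨t, hta, htI⟩ := Finset.exists_of_ssubset ha.2.2.1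
      obtain ⟨c, hc, htc, hca, hform⟩ := exists_cov_mem M.ends ha.1 huI hvI ha.2.1 hIa hta htI
      obtain rfl := hc.eq_of_subset ha hca
      rcases hform with heq | ⟨p, hpt, hpI, hwt, hwp, hl, heq⟩
      · have hac : c ⊆ insert t b := by rw [heq]; exact Finset.insert_subset_insert t hIb
        refine absorb_one M.ends hb.2.1 hu hv hy hby (hay hta) ?_ hac
        intro htb
        rw [Finset.insert_eq_of_mem htb] at hac
        exact hab (ha.eq_of_subset hb hac)
      · have hpc : p ∈ c := by simp [heq]
        refine absorb_two M.ends ha hb hab hu hv hy hby (hay hta) (hay hpc) hpt.symm hwt hwp ?_ ?_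
        · rw [heq]; exact Finset.union_subset_union_right hIb
        · intro _ _
          exact hl.mono (Finset.union_subset_union_right hIb) (by simp)
    · exact hact M.ends.symm huI hvI
  · by_cases hvI : M.v ∈ I
    · exact hact M.ends hvI huI
    · left
      -- exactly one end in `a`
      have hone : ∀ {x x'}, M.Ends x x' → x ∉ I → x' ∉ I → x ∈ a → x' ∉ a →
          ∃ z, Cov M.Ok b z ∧ a ⊆ z ∧ z ⊆ y := by
        intro x x' h hx hx' hxa hxa'
        refine hpair h.symm hxa' (fun _ _ hw => ?_)
        have hc := cov_insert_end h ha.1 hx hx' (ha.2.1.1 hxa) hw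
        have h1 := hc.eq_of_subset ha (Finset.insert_subset hxa hIa)
        apply hab
        rw [← h1]
        rw [← h1] at ha
        exact ha.eq_of_subset hb (Finset.insert_subset (hboth h) hIb)
      by_cases hua : M.u ∈ a
      · by_cases hva : M.v ∈ a
        · rcases ha.exists_eq_both huI hvI hua hva with ⟨e, hea, he, hwe, heq⟩ |
            ⟨e, hea, f, hfa, he, hf, hef, hwe, hwf, heq⟩
          · have heb : e ∉ b := by
              intro heb
              refine hab (ha.eq_of_subset hb ?_)
              rw [heq]
              simp [Finset.insert_subset_iff, hu, hv, heb, hIb]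
            refine absorb_one M.ends hb.2.1 hu hv hy hby (hay hea) heb ?_
            rw [heq]
            simp [Finset.insert_subset_iff, hu, hv, hIb.trans (Finset.subset_insert _ _)]
          · refine absorb_two M.ends ha hb hab hu hv hy hby (hay hea) (hay hfa) hef hwe hwf ?_ ?_
            · rw [heq]
              simpa [Finset.insert_subset_iff, hu, hv] using
                hIb.trans ((Finset.subset_insert _ _).trans (Finset.subset_insert _ _))
            · intro _ _
              exact (Linked.of_adj (M.symm (M.ends.adj_edge he)) (by simp [hu])).trans
                (Linked.of_adj (M.ends.adj_edge hf) (by simp))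
        · exact hone M.ends huI hvI hua hva
      · by_cases hva : M.v ∈ a
        · exact hone M.ends.symm hvI huI hva hua
        · exact hpair M.ends hua (fun h => absurd h hva)

end BundleModel
end EvenSubgraph

/-! ### Exchange when an end is missing, coherence, and the resulting atom order. -/

namespace EvenSubgraph
namespace BundleModel

variable {τ : Type*} [DecidableEq τ] {M : BundleModel τ} {x x' e s t p : τ}
  {I J X Y a b y z z' : Finset τ}

lemma Ends.notMem (h : M.Ends x x') (hX : ¬ (M.u ∈ X ∧ M.v ∈ X)) : x ∉ X ∨ x' ∉ X := by
  rw [h.both] at hX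
  tauto

lemma exists_ends_notMem (hX : ¬ (M.u ∈ X ∧ M.v ∈ X)) : ∃ x x', M.Ends x x' ∧ x ∉ X := by
  rcases M.ends.notMem hX with h | h
  exacts [⟨_, _, M.ends, h⟩, ⟨_, _, M.ends.symm, h⟩]

lemma Ends.linked (h : M.Ends x x') {q q' : τ} (h' : M.Ends q q') (hx : x ∈ X) :
    Linked M.adj X q x := by
  rcases h'.cases h with ⟨rfl, rfl⟩ | ⟨rfl, rfl⟩
  · exact Linked.refl
  · exact Linked.of_adj h'.adj hx

/-- The bundle can be entered in only one way. -/
lemma start_unique (h : M.Ends x x') {q q' : τ} (h' : M.Ends q q') (hI : M.Ok I) (hx : x ∉ I)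
    (hx' : x' ∉ I) (hs : s ∈ M.ground) (ht : t ∈ M.ground) (hsI : s ∉ I) (htI : t ∉ I)
    (hse : ¬ M.IsEdge s) (hte : ¬ M.IsEdge t) (hsx : s ≠ x) (hsx' : s ≠ x') (htx : t ≠ x)
    (htx' : t ≠ x') (hls : Linked M.adj ({x, s} ∪ I) x s) (hlt : Linked M.adj ({q, t} ∪ I) q t) :
    s = t := by
  have key : ∀ {q q' r}, M.Ends q q' → Linked M.adj ({q, r} ∪ I) q r →
      Linked M.adj ({M.u, M.v, r} ∪ I) M.u r := by
    intro q q' r h hl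
    have hq : q = M.u ∨ q = M.v := h.imp And.left And.left
    have hq' : q ∈ ({M.u, M.v, r} ∪ I : Finset τ) := by rcases hq with rfl | rfl <;> simp
    refine (h.linked M.ends hq').trans (hl.mono ?_ (by simp))
    intro d hd
    simp only [Finset.mem_union, Finset.mem_insert, Finset.mem_singleton] at hd ⊢
    rcases hd with (rfl | rfl) | hd <;> tauto
  have hl1 := key h hls
  have hl2 := key h' hlt
  rcases h with ⟨rfl, rfl⟩ | ⟨rfl, rfl⟩
  · exact M.unique_nbr I hI.1 hI.even hx hx' (hI.not_isEdge M.ends hx) s hs t ht hsI htI hse hte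
      hsx hsx' htx htx' hl1 hl2
  · exact M.unique_nbr I hI.1 hI.even hx' hx (hI.not_isEdge M.ends hx') s hs t ht hsI htI hse hte
      hsx' hsx htx' htx hl1 hl2

/-- The covers preceding a cover `b` which contains one end of the bundle. -/
lemma subset_of_key_le (h : M.Ends x x') (ha : Cov M.Ok I a) (hb : Cov M.Ok I b) (hab : a ≠ b)
    (hkey : M.key I a ≤ M.key I b) (hxI : x ∉ I) (hxI' : x' ∉ I) (hx : x ∈ b) (hx' : x' ∉ b) :
    (M.w x ≠ 0 ∧ M.w x' = 0) ∨ (x' ∈ a ∧ a ⊆ insert x' b) := by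
  have hIa := ha.2.2.1.subset
  have hIb := hb.2.2.1.subset
  rw [key_of_none h hxI hxI', key_of_none h hxI hxI'] at hkey
  have hins : ∀ {q q'}, M.Ends q q' → q ∉ I → q' ∉ I → M.w q = 0 → ∀ {d}, Cov M.Ok I d → q ∈ d →
      d = insert q I := by
    intro q q' hq hqI hqI' hw d hd hqd
    exact ((cov_insert_end hq hd.1 hqI hqI' (hd.2.1.1 hqd) hw).eq_of_subset hd
      (Finset.insert_subset hqd hd.2.2.1.subset)).symm
  -- If the end `x` is even, then `b` is `insert x I` and has key 0. A different cover of key 0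
  -- enters through the other end, which must then be even as well.
  by_cases hw : M.w x = 0
  · right
    have hb' := hins h hxI hxI' hw hb hx
    rw [startKey_eq_zero h hx hx' (Or.inl hw)] at hkey
    obtain ⟨q, q', hq, hqa, hqa', hqw⟩ := exists_of_startKey_lt_top
      (lt_of_le_of_lt hkey ENat.top_pos)
    rcases h.cases hq with ⟨rfl, rfl⟩ | ⟨rfl, rfl⟩
    · exact absurd ((hins h hxI hxI' hw ha hqa).trans hb'.symm) hab
    · have := hins hq hxI' hxI (hqw.resolve_right (not_not.2 hw)) ha hqa
      refine ⟨hqa, ?_⟩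
      rw [this]
      exact Finset.insert_subset_insert _ hIb
  · by_cases hw' : M.w x' = 0
    · exact Or.inl ⟨hw, hw'⟩
    right
    rw [startKey_eq_zero h hx hx' (Or.inr hw')] at hkey
    obtain ⟨q, q', hq, hqa, hqa', hqw⟩ := exists_of_startKey_lt_top
      (lt_of_le_of_lt hkey ENat.top_pos)
    -- With both ends odd, a cover entering through one end adds exactly that end and one vertex. By
    -- `start_unique` this vertex is the same for all such covers, so `a` and `b` can differ only in
    -- the end they use.
    have hform : ∀ {q q' d}, M.Ends q q' → q ∉ I → Cov M.Ok I d → q ∈ d → q' ∉ d → M.w q ≠ 0 →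
        ∃ s ∈ d, s ∉ I ∧ s ≠ q ∧ s ≠ q' ∧ ¬ M.IsEdge s ∧ Linked M.adj ({q, s} ∪ I) q s ∧
          d = {q, s} ∪ I := by
      intro q q' d hq hqI hd hqd hqd' hw
      obtain ⟨s, hsd, hsI, hsq, hl, hc⟩ := exists_start_pair hq hd.1 hd.2.1 hd.2.2.1.subset hqI hqd
        hqd' hw
      refine ⟨s, hsd, hsI, hsq, fun h' => hqd' (h' ▸ hsd), hd.2.1.not_isEdge hq.symm hqd' s hsd, hl,
        (hc.eq_of_subset hd ?_).symm⟩
      simp [Finset.insert_subset_iff, hqd, hsd, hd.2.2.1.subset]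
    obtain ⟨s, hsb, hsI, hsx, hsx', hse, hls, hbe⟩ := hform h hxI hb hx hx' hw
    rcases h.cases hq with ⟨rfl, rfl⟩ | ⟨rfl, rfl⟩
    · obtain ⟨t, hta, htI, htx, htx', hte, hlt, hae⟩ := hform hq hxI ha hqa hqa' hw
      obtain rfl := start_unique h hq hb.1 hxI hxI' (hb.2.1.1 hsb) (ha.2.1.1 hta) hsI htI hse hte
        hsx hsx' htx htx' hls hlt
      exact absurd (hae.trans hbe.symm) hab
    · obtain ⟨t, hta, htI, htx, htx', hte, hlt, hae⟩ := hform hq hxI' ha hqa hqa' hw'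
      obtain rfl := start_unique h hq hb.1 hxI hxI' (hb.2.1.1 hsb) (ha.2.1.1 hta) hsI htI hse hte
        hsx hsx' htx' htx hls hlt
      refine ⟨hqa, ?_⟩
      rw [hae]
      simp [Finset.insert_subset_iff, hsb, hIb.trans (Finset.subset_insert _ _)]

/-- By `subset_of_key_le`, `a` normally adds only the other end to `b`, so an activation of that end
over `b` contains `a`. In the exceptional case `x` is odd and `x'` even: the earlier cover `insert
x' I` serves if `x'` lies in `y`, and semimodularity applies otherwise. -/
lemma exchange_start_one (h : M.Ends x x') (ha : Cov M.Ok I a) (hb : Cov M.Ok I b) (hab : a ≠ b)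
    (hkey : M.key I a ≤ M.key I b) (hy : M.Ok y) (hay : a ⊆ y) (hby : b ⊆ y) (hxI : x ∉ I)
    (hxI' : x' ∉ I) (hx : x ∈ b) (hx' : x' ∉ b) :
    ∃ c z, Cov M.Ok I c ∧ (c = a ∨ M.key I c < M.key I b) ∧ Cov M.Ok b z ∧ c ⊆ z ∧ z ⊆ y := by
  have hIb := hb.2.2.1.subset
  rcases subset_of_key_le h ha hb hab hkey hxI hxI' hx hx' with ⟨hw, hw'⟩ | ⟨hxa, hsub⟩
  · by_cases hxy : x' ∈ y
    · obtain ⟨z, hz, hxz, hzy, -⟩ := exists_activation h.symm hb.2.1 hy hby hx hx' hxy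
      refine ⟨_, z, cov_insert_end h.symm hb.1 hxI' hxI (hy.1 hxy) hw', Or.inr ?_, hz,
        Finset.insert_subset hxz (hIb.trans hz.2.2.1.subset), hzy⟩
      rw [key_of_none h hxI hxI', key_of_none h hxI hxI', startKey_eq_top_of_weight h hx hw hw',
        startKey_eq_zero h.symm (by simp) (by simp [hxI, h.ne]) (Or.inl hw')]
      exact ENat.top_pos
    · obtain ⟨z, h1, h2, h3⟩ := exchange_semimodular h.symm ha hb hab hy hay hby hxy
        (fun _ _ => hw)
      exact ⟨a, z, ha, Or.inl rfl, h1, h2, h3⟩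
  · obtain ⟨z, hz, hxz, hzy, -⟩ := exists_activation h.symm hb.2.1 hy hby hx hx' (hay hxa)
    exact ⟨a, z, ha, Or.inl rfl, hz, hsub.trans (Finset.insert_subset hxz hz.2.2.1.subset), hzy⟩

lemma ok_linked_pair (h : M.Ends x x') (hb : M.Ok b) (hx : x ∉ b) (hsx : s ≠ x)
    (htx : t ≠ x) (hs : s ∉ b) (ht : t ∉ b) (hsg : s ∈ M.ground) (htg : t ∈ M.ground)
    (hst : s ≠ t) (hws : M.w s ≠ 0) (hwt : M.w t ≠ 0)
    (hse : ¬ M.IsEdge s) (hte : ¬ M.IsEdge t) (hl : Linked M.adj ({s, t} ∪ b) s t) :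
    Cov M.Ok b ({s, t} ∪ b) := by
  refine cov_linked_pair hb (ok_of_notMem h ?_ ?_ ?_
    (even_linked_pair hb.even hs ht hst hws hwt hl)) hs ht hst hws hwt
  · simp [hx, hsx.symm, htx.symm]
  · simp [Finset.insert_subset_iff, hsg, htg, hb.1]
  · intro e he
    simp only [Finset.mem_union, Finset.mem_insert, Finset.mem_singleton] at he
    rcases he with (rfl | rfl) | he
    exacts [hse, hte, hb.not_isEdge h hx e he]

/-- The key of `b` is `⊤`, so any way of entering through one end that `y` permits over `b` gives an
earlier cover: an even end, or an odd end with an entrance vertex. If neither exists and both ends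
lie in `y`, the shape of `a` is so restricted that one cover of `b` contains it. -/
lemma exchange_start_none (ha : Cov M.Ok I a) (hb : Cov M.Ok I b)
    (hab : a ≠ b) (hy : M.Ok y) (hay : a ⊆ y) (hby : b ⊆ y) (hub : M.u ∉ b) (hvb : M.v ∉ b) :
    ∃ c z, Cov M.Ok I c ∧ (c = a ∨ M.key I c < M.key I b) ∧ Cov M.Ok b z ∧ c ⊆ z ∧ z ⊆ y := by
  have hIa := ha.2.2.1.subset
  have hIb := hb.2.2.1.subset
  have hnb : ∀ {x x'}, M.Ends x x' → x ∉ b := by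
    rintro x x' (⟨rfl, rfl⟩ | ⟨rfl, rfl⟩)
    exacts [hub, hvb]
  have hnI : ∀ {x x'}, M.Ends x x' → x ∉ I := fun h h' => hnb h (hIb h')
  have htop : M.key I b = ⊤ := by
    rw [key_of_none M.ends (hnI M.ends) (hnI M.ends.symm)]
    exact startKey_eq_top M.ends (by simp [hub, hvb])
  by_cases h0 : ∃ x x', M.Ends x x' ∧ x ∈ y ∧ M.w x = 0
  · obtain ⟨x, x', h, hxy, hw⟩ := h0
    refine ⟨_, _, cov_insert_end h hb.1 (hnI h) (hnI h.symm) (hy.1 hxy) hw, Or.inr ?_,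
      cov_insert_end h hb.2.1 (hnb h) (hnb h.symm) (hy.1 hxy) hw, Finset.insert_subset_insert _ hIb,
      Finset.insert_subset hxy hby⟩
    rw [htop, key_of_none h (hnI h) (hnI h.symm), startKey_eq_zero h (by simp)
      (by simp [hnI h.symm, h.ne.symm]) (Or.inl hw)]
    exact ENat.top_pos
  have hw : ∀ {x x'}, M.Ends x x' → x ∈ y → M.w x ≠ 0 := fun h hxy hw => h0 ⟨_, _, h, hxy, hw⟩
  by_cases huv : M.u ∈ y ∧ M.v ∈ y
  swap
  · obtain ⟨x, x', h, hxy⟩ := exists_ends_notMem huv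
    obtain ⟨z, h1, h2, h3⟩ := exchange_semimodular h ha hb hab hy hay hby hxy
      (fun h' _ => hw h.symm h')
    exact ⟨a, z, ha, Or.inl rfl, h1, h2, h3⟩
  have hny : ∀ {x x'}, M.Ends x x' → x ∈ y := fun h => (h.both.1 huv).1
  by_cases hα : ∃ x x' p, M.Ends x x' ∧ p ∈ y ∧ p ∉ b ∧ p ≠ x ∧ p ≠ x' ∧ ¬ M.IsEdge p ∧
      Linked M.adj ({x, p} ∪ b) x p
  · obtain ⟨x, x', p, h, hpy, hpb, hpx, hpx', hpe, hl⟩ := hα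
    have hz := ok_linked_pair h.symm hb.2.1 (hnb h.symm) h.ne hpx' (hnb h) hpb (hy.1 (hny h))
      (hy.1 hpy) hpx.symm (hw h (hny h)) (h.w_vertex (hy.1 hpy) hpe hpx hpx') h.not_isEdge hpe hl
    have hxz : x' ∉ ({x, p} ∪ b : Finset τ) := by simp [hnb h.symm, hpx'.symm, h.ne.symm]
    have hIz : I ⊆ {x, p} ∪ b := hIb.trans Finset.subset_union_right
    -- Inside `z` only the end `x` is available, so this cover of `I` enters through `x` alone and
    -- has key 0.
    obtain ⟨q, hq, -, -, -, hc⟩ := exists_start_pair h hb.1 hz.2.1 hIz (hnI h) (by simp) hxz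
      (hw h (hny h))
    have hcz : {x, q} ∪ I ⊆ {x, p} ∪ b :=
      Finset.union_subset (Finset.insert_subset (by simp) (Finset.singleton_subset_iff.2 hq)) hIz
    refine ⟨_, _, hc, Or.inr ?_, hz, hcz, ?_⟩
    · rw [htop, key_of_none h (hnI h) (hnI h.symm), startKey_eq_zero h (by simp)
        (fun h' => hxz (hcz h')) (Or.inr (hw h.symm (hny h.symm)))]
      exact ENat.top_pos
    · exact Finset.union_subset (Finset.insert_subset (hny h) (Finset.singleton_subset_iff.2 hpy))
        hby
  suffices hsuff : ∃ z, Cov M.Ok b z ∧ a ⊆ z ∧ z ⊆ y by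
    obtain ⟨z, h1, h2, h3⟩ := hsuff
    exact ⟨a, z, ha, Or.inl rfl, h1, h2, h3⟩
  have hwu := hw M.ends huv.1
  have hwv := hw M.ends.symm huv.2
  -- exactly one end in `a`
  have hone : ∀ {x x'}, M.Ends x x' → x ∈ a → x' ∉ a → ∃ z, Cov M.Ok b z ∧ a ⊆ z ∧ z ⊆ y := by
    intro x x' h hxa hxa'
    obtain ⟨p, hpa, hpI, hpx, hl, hc⟩ := exists_start_pair h ha.1 ha.2.1 hIa (hnI h) hxa hxa'
      (hw h (hny h))
    have heq := hc.eq_of_subset ha (by simp [Finset.insert_subset_iff, hxa, hpa, hIa])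
    -- A partner outside `b` would be an entrance over `b`. With the partner in `b`, every cover of
    -- `b` containing both ends contains `a`.
    have hpb : p ∈ b := by
      by_contra hpb
      exact hα ⟨x, x', p, h, hay hpa, hpb, hpx, fun h' => hxa' (h' ▸ hpa),
        ha.2.1.not_isEdge h.symm hxa' p hpa,
        hl.mono (Finset.union_subset_union_right hIb) (by simp)⟩
    have huse : ∀ z, Cov M.Ok b z → M.u ∈ z → M.v ∈ z → z ⊆ y →
        ∃ z, Cov M.Ok b z ∧ a ⊆ z ∧ z ⊆ y := by
      intro z hz hu hv hzy
      refine ⟨z, hz, ?_, hzy⟩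
      rw [← heq]
      have hbz := hz.2.2.1.subset
      simp [Finset.insert_subset_iff, (h.both.1 ⟨hu, hv⟩).1, hbz hpb, hIb.trans hbz]
    rcases exists_start_both hb.2.1 hub hvb hy hby huv.1 huv.2 hwu hwv hα with
      ⟨e, he, -, -, hz⟩ | ⟨e, he, f, hf, -, -, -, -, -, hz⟩
    · exact huse _ hz (by simp) (by simp)
        (by simp [Finset.insert_subset_iff, huv.1, huv.2, he, hby])
    · exact huse _ hz (by simp) (by simp)
        (by simp [Finset.insert_subset_iff, huv.1, huv.2, he, hf, hby])
  by_cases hua : M.u ∈ a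
  · by_cases hva : M.v ∈ a
    · rcases ha.exists_eq_both (hnI M.ends) (hnI M.ends.symm) hua hva with ⟨e, hea, he, hwe, heq⟩ |
        ⟨e, hea, f, hfa, he, hf, hef, hwe, hwf, heq⟩
      · refine ⟨_, cov_both M.ends hb.2.1 hub hvb (hy.1 huv.1) (hy.1 huv.2) hwu hwv
          (hy.1 (hay hea)) he hwe, ?_, ?_⟩
        · conv_lhs => rw [heq]
          exact Finset.union_subset_union_right hIb
        · simp [Finset.insert_subset_iff, huv.1, huv.2, hay hea, hby]
      · refine ⟨_, cov_both_pair M.ends hb.2.1 hub hvb (hy.1 huv.1) (hy.1 huv.2) hwu hwv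
          (hy.1 (hay hea)) he hwe (hy.1 (hay hfa)) hf hwf hef, ?_, ?_⟩
        · conv_lhs => rw [heq]
          exact Finset.union_subset_union_right hIb
        · simp [Finset.insert_subset_iff, huv.1, huv.2, hay hea, hay hfa, hby]
    · exact hone M.ends hua hva
  by_cases hva : M.v ∈ a
  · exact hone M.ends.symm hva hua
  -- no end in `a`
  have hwa : ∀ t ∈ a, t ∉ I → M.w t ≠ 0 := by
    intro t ht htI
    exact ha.2.1.w_ne_zero M.ends hua ht (fun h => hva (h ▸ ht))
  obtain ⟨s, t, hs, ht, hst, hl, heq⟩ := ha.exists_eq_pair M.symm (fun K hK => Ok.even hK)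
    (fun K hK hev => ha.2.1.of_subset M.ends hua hK hev) hwa
  have hone' : ∀ {s t}, s ∉ b → t ∈ b → s ∈ a → a = {s, t} ∪ I →
      ∃ z, Cov M.Ok b z ∧ a ⊆ z ∧ z ⊆ y := by
    intro s t hsb htb hsa heq
    have hws := hwa s hsa (fun h' => hsb (hIb h'))
    have hse := ha.2.1.not_isEdge M.ends hua s hsa
    have hsu : s ≠ M.u := fun h' => hua (h' ▸ hsa)
    have hsv : s ≠ M.v := fun h' => hva (h' ▸ hsa)
    obtain ⟨p, hpy, hpX, q, hqX, hlq, hqp⟩ := exists_next hy.even (X := insert s b)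
      (Finset.insert_subset (hay hsa) hby) hb.2.1.even (Finset.subset_insert s b) (r := s) (by simp)
      (by
        intro x hx hxI _
        obtain rfl : x = s := by simpa [hxI] using hx
        exact Linked.refl)
      (by rw [Finset.sum_insert hsb, hb.2.1.even.sum, add_zero]; exact hws)
    rw [Finset.mem_insert, not_or] at hpX
    have hlink : Linked M.adj ({s, p} ∪ b) s p := by
      have := hlq.insert_of_adj (by simp) hqp
      have he : insert p (insert s b) = {s, p} ∪ b := by
        rw [Finset.insert_comm, Finset.insert_union, Finset.singleton_union]
      rwa [he] at this
    -- If the partner of `s` were an end of the bundle, then `s` would be an entrance over `b`.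
    have hends : ∀ {x x'}, M.Ends x x' → p ≠ x := by
      rintro x x' h rfl
      refine hα ⟨p, x', s, h, hay hsa, hsb, Ne.symm hpX.1, ?_, hse, ?_⟩
      · rcases h with ⟨rfl, rfl⟩ | ⟨rfl, rfl⟩ <;> assumption
      · rw [Finset.pair_comm]
        exact hlink.symm M.symm (by simp)
    have hpe : ¬ M.IsEdge p := by
      intro hpe
      -- A bundle edge can be reached only from an end, and no end is present.
      have hno : ∀ {x x'}, M.Ends x x' → x ∉ insert s b := by
        rintro x x' (⟨rfl, rfl⟩ | ⟨rfl, rfl⟩) <;>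
          simp [hub, hvb, Ne.symm hsu, Ne.symm hsv]
      rcases M.ends.eq_or_eq hpe hqp with rfl | rfl
      exacts [hno M.ends hqX, hno M.ends.symm hqX]
    have hz := ok_linked_pair M.ends hb.2.1 hub hsu (hends M.ends) hsb hpX.2 (hy.1 (hay hsa))
      (hy.1 hpy) (Ne.symm hpX.1) hws (M.w_vertex p (hy.1 hpy) hpe (hends M.ends)
        (hends M.ends.symm)) hse hpe hlink
    refine ⟨_, hz, ?_, ?_⟩
    · conv_lhs => rw [heq]
      simp only [Finset.insert_union, Finset.singleton_union]
      refine Finset.insert_subset_insert _ ?_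
      exact Finset.insert_subset (Finset.mem_insert_of_mem htb)
        (hIb.trans (Finset.subset_insert _ _))
    · simp [Finset.insert_subset_iff, hay hsa, hpy, hby]
  have hsa : s ∈ a := by simp [heq]
  have hta : t ∈ a := by simp [heq]
  by_cases hsb : s ∈ b
  · by_cases htb : t ∈ b
    · refine absurd (ha.eq_of_subset hb ?_) hab
      rw [heq]
      simp [Finset.insert_subset_iff, hsb, htb, hIb]
    · exact hone' htb hsb hta (by rw [Finset.pair_comm]; exact heq)
  · by_cases htb : t ∈ b
    · exact hone' hsb htb hsa heq
    · refine ⟨_, ok_linked_pair M.ends hb.2.1 hub (fun h' => hua (h' ▸ hsa))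
        (fun h' => hua (h' ▸ hta)) hsb htb (hy.1 (hay hsa)) (hy.1 (hay hta)) hst (hwa s hsa hs)
        (hwa t hta ht) (ha.2.1.not_isEdge M.ends hua s hsa) (ha.2.1.not_isEdge M.ends hua t hta)
        (hl.mono (Finset.union_subset_union_right hIb) (by simp)), ?_, ?_⟩
      · conv_lhs => rw [heq]
        exact Finset.union_subset_union_right hIb
      · simp [Finset.insert_subset_iff, hay hsa, hay hta, hby]

/-- The exchange property. -/
lemma exchange (ha : Cov M.Ok I a) (hb : Cov M.Ok I b) (hab : a ≠ b)
    (hkey : M.key I a ≤ M.key I b) (hy : M.Ok y) (hay : a ⊆ y) (hby : b ⊆ y) :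
    ∃ c z, Cov M.Ok I c ∧ (c = a ∨ M.key I c < M.key I b) ∧ Cov M.Ok b z ∧ c ⊆ z ∧ z ⊆ y := by
  have hIb := hb.2.2.1.subset
  by_cases huv : M.u ∈ b ∧ M.v ∈ b
  · exact exchange_of_both ha hb hab hkey hy hay hby huv.1 huv.2
  obtain ⟨x, x', h, hx⟩ := exists_ends_notMem huv
  have hxI : x ∉ I := fun h' => hx (hIb h')
  by_cases hxI' : x' ∈ I
  · by_cases hxy : x ∈ y
    · obtain ⟨c, z, h1, h2, h3⟩ := exchange_activation h hxI' hb hx hy hby hxy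
      exact ⟨c, z, h1, Or.inr h2, h3⟩
    · obtain ⟨z, h1, h2, h3⟩ := exchange_semimodular h ha hb hab hy hay hby hxy
        (fun _ h' => absurd hxI' h')
      exact ⟨a, z, ha, Or.inl rfl, h1, h2, h3⟩
  by_cases hx' : x' ∈ b
  · exact exchange_start_one h.symm ha hb hab hkey hy hay hby hxI' hxI hx' hx
  · obtain ⟨hu, hv⟩ : M.u ∉ b ∧ M.v ∉ b := by
      rcases h with ⟨rfl, rfl⟩ | ⟨rfl, rfl⟩
      exacts [⟨hx, hx'⟩, ⟨hx', hx⟩]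
    exact exchange_start_none ha hb hab hy hay hby hu hv

/-- The coherence property. -/
lemma coherent (ha : Cov M.Ok I a) (hb : Cov M.Ok I b) (hz' : Cov M.Ok b z')
    (hlt : M.key b z' < M.key b z) (hab : a ≠ b) (hkey : M.key I a ≤ M.key I b) :
    ∃ a', Cov M.Ok I a' ∧ a' ⊆ z' ∧ a' ≠ b ∧ (a' = a ∨ M.key I a' < M.key I b) := by
  have hIb := hb.2.2.1.subset
  have hbz := hz'.2.2.1.subset
  -- Having to precede some other cover, `z'` has a finite key and hence brings in an end of the
  -- bundle. This end, or `a` itself, provides the required cover of `I` below `z'`.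
  have hlt' : M.key b z' < ⊤ := lt_of_lt_of_le hlt le_top
  by_cases huv : M.u ∈ b ∧ M.v ∈ b
  · rw [key_of_both M.ends huv.1 huv.2] at hlt'
    exact absurd hlt' (lt_irrefl _)
  obtain ⟨x, x', h, hx⟩ := exists_ends_notMem huv
  have hxI : x ∉ I := fun h' => hx (hIb h')
  by_cases hx' : x' ∈ b
  · rw [key_of_one h hx' hx, activationKey_lt_top] at hlt'
    by_cases hxI' : x' ∈ I
    · obtain ⟨c, hc, hxc, hcz, -⟩ := exists_activation h ha.1 hz'.2.1 (hIb.trans hbz) hxI' hxI hlt'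
      refine ⟨c, hc, hcz, fun h' => hx (h' ▸ hxc), Or.inr ?_⟩
      rw [key_of_one h hxI' hxI, key_of_one h hxI' hxI]
      have h2 := mt (activationKey_lt_top (M := M) (I := I)).1 hx
      rw [not_lt_top_iff] at h2
      rw [h2]
      exact activationKey_lt_top.2 hxc
    · rcases subset_of_key_le h.symm ha hb hab hkey hxI' hxI hx' hx with ⟨hw', hw⟩ | ⟨hxa, hsub⟩
      · refine ⟨_, cov_insert_end h ha.1 hxI hxI' (hz'.2.1.1 hlt') hw,
          Finset.insert_subset hlt' (hIb.trans hbz), fun h' => hx (h' ▸ by simp), Or.inr ?_⟩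
        rw [key_of_none h hxI hxI', key_of_none h hxI hxI',
          startKey_eq_top_of_weight h.symm hx' hw' hw,
          startKey_eq_zero h (by simp) (by simp [hxI', h.ne.symm]) (Or.inl hw)]
        exact ENat.top_pos
      · exact ⟨a, ha, hsub.trans (Finset.insert_subset hlt' hbz), hab, Or.inl rfl⟩
  · have hxI' : x' ∉ I := fun h' => hx' (hIb h')
    rw [key_of_none h hx hx'] at hlt'
    obtain ⟨q, q', hq, hqz, hqz', hqw⟩ := exists_of_startKey_lt_top hlt'
    obtain ⟨hqb, hqb'⟩ : q ∉ b ∧ q' ∉ b := by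
      rcases h.cases hq with ⟨rfl, rfl⟩ | ⟨rfl, rfl⟩
      exacts [⟨hx, hx'⟩, ⟨hx', hx⟩]
    have hqI : q ∉ I := fun h' => hqb (hIb h')
    have hqI' : q' ∉ I := fun h' => hqb' (hIb h')
    -- The same end already enters over `I` inside `z'`. The cover `c` misses the other end because
    -- `z'` does, so its key is 0, while `b` has key `⊤`.
    obtain ⟨c, hc, hcz, hqc⟩ : ∃ c, Cov M.Ok I c ∧ c ⊆ z' ∧ q ∈ c := by
      by_cases hw : M.w q = 0
      · exact ⟨_, cov_insert_end hq ha.1 hqI hqI' (hz'.2.1.1 hqz) hw,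
          Finset.insert_subset hqz (hIb.trans hbz), by simp⟩
      · obtain ⟨r, hr, -, -, -, hc⟩ := exists_start_pair hq ha.1 hz'.2.1 (hIb.trans hbz) hqI hqz
          hqz' hw
        exact ⟨_, hc, by simp [Finset.insert_subset_iff, hqz, hr, hIb.trans hbz], by simp⟩
    refine ⟨c, hc, hcz, fun h' => hqb (h' ▸ hqc), Or.inr ?_⟩
    rw [key_of_none hq hqI hqI', key_of_none hq hqI hqI', startKey_eq_top (J := b) hq (by simp [hqb, hqb']),
      startKey_eq_zero hq hqc (fun h' => hqz' (hcz h')) hqw]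
    exact ENat.top_pos

/-- The poset of a graph with a single bundle has an atom order. -/
theorem exists_isAtomOrder (M : BundleModel τ) :
    ∃ R, IsAtomOrder (P := {X : Finset τ // M.Ok X}) R :=
  ⟨_, isAtomOrder_of_key M.key (fun _ _ _ _ ha hb hab hk hy hay hby =>
    exchange ha hb hab hk hy hay hby) (fun _ _ _ _ _ ha hb _ hz' hlt hab hk _ =>
    coherent ha hb hz' hlt hab hk)⟩

end BundleModel
end EvenSubgraph

/-! ### From even semi-induced subgraphs to even sets of tokens. -/

namespace EvenSubgraph

section EvenSets

variable {τ : Type*} [DecidableEq τ] {Γ : τ → τ → Prop} {w : τ → ZMod 2} {X C : Finset τ} {s t : τ}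

lemma block_eq_of_linked (hΓ : ∀ ⦃x y⦄, Γ x y → Γ y x) (h : Linked Γ X s t) (hs : s ∈ X) :
    block Γ X s = block Γ X t := by
  ext r
  simp only [mem_block]
  exact ⟨fun h' => ⟨h'.1, (h.symm hΓ hs).trans h'.2⟩, fun h' => ⟨h'.1, h.trans h'.2⟩⟩

/-- A union of components is peeled off one block at a time. -/
lemma isEvenSet_of_block (hΓ : ∀ ⦃x y⦄, Γ x y → Γ y x)
    (h : ∀ t ∈ X, ∑ r ∈ block Γ X t, w r = 0) : IsEvenSet Γ w X := by
  intro C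
  induction C using Finset.strongInduction with
  | H C ih =>
    intro hC
    rcases C.eq_empty_or_nonempty with rfl | ⟨t, ht⟩
    · simp
    have hsub : block Γ X t ⊆ C := fun r hr => (mem_block.1 hr).2 C hC ht
    have htb : t ∈ block Γ X t := mem_block.2 ⟨hC.1 ht, Linked.refl⟩
    rw [← Finset.sum_sdiff hsub, h t (hC.1 ht), add_zero]
    refine ih _ (Finset.sdiff_ssubset hsub ⟨t, htb⟩) ⟨Finset.sdiff_subset.trans hC.1, ?_⟩
    intro x hx y hy hxy
    rw [Finset.mem_sdiff] at hx ⊢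
    exact ⟨hC.2 x hx.1 y hy hxy, fun hyb => hx.2 (isClosedIn_block.2 y hyb x (hC.1 hx.1) (hΓ hxy))⟩

end EvenSets

section Tokens

variable {α β : Type*} {G H I I' : Graph α β} {A : Set (α ⊕ β)}

/-- The adjacency of the vertices and the multiple edges of a graph: a multiple edge is adjacent to
its ends. -/
def tokAdj (H : Graph α β) : α ⊕ β → α ⊕ β → Prop
  | .inl x, .inl y => H.Adj x y
  | .inl x, .inr e => IsMultiple H e ∧ H.Inc e x
  | .inr e, .inl x => IsMultiple H e ∧ H.Inc e x
  | .inr _, .inr _ => False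

lemma tokAdj_symm : ∀ ⦃s t : α ⊕ β⦄, tokAdj H s t → tokAdj H t s := by
  rintro (x | e) (y | f) h
  exacts [h.symm, h, h, h]

open Classical in
/-- The weight of a token is one if it belongs to `A`, and zero otherwise. -/
noncomputable def weight {τ : Type*} (A : Set τ) (t : τ) : ZMod 2 := if t ∈ A then 1 else 0

lemma weight_ne_zero {τ : Type*} {A : Set τ} {t : τ} : weight A t ≠ 0 ↔ t ∈ A := by
  simp [weight]

lemma weight_of_mem {τ : Type*} {A : Set τ} {t : τ} (h : t ∈ A) : weight A t = 1 := if_pos h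

lemma weight_of_notMem {τ : Type*} {A : Set τ} {t : τ} (h : t ∉ A) : weight A t = 0 := if_neg h

lemma sum_weight_eq_zero_iff {τ : Type*} {A : Set τ} {X : Finset τ} :
    ∑ t ∈ X, weight A t = 0 ↔ Even (A ∩ X).ncard := by
  classical
  have : A ∩ X = ((X.filter (· ∈ A) : Finset τ) : Set τ) := by ext; simp [and_comm]
  rw [this, Set.ncard_coe_finset, ← ZMod.natCast_eq_zero_iff_even]
  simp [weight, Finset.sum_boole]

/-- The sets of vertices and multiple edges of `H` which come from even semi-induced subgraphs. -/
structure TokenOk [DecidableEq α] [DecidableEq β] (H : Graph α β) (A : Set (α ⊕ β))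
    (X : Finset (α ⊕ β)) : Prop where
  subset : (X : Set (α ⊕ β)) ⊆ labels H
  mem_of_inc : ∀ e x, Sum.inr e ∈ X → H.Inc e x → Sum.inl x ∈ X
  exists_edge : ∀ e x y, IsMultiple H e → H.IsLink e x y → Sum.inl x ∈ X → Sum.inl y ∈ X →
    ∃ f, H.IsLink f x y ∧ Sum.inr f ∈ X
  even : IsEvenSet (tokAdj H) (weight A) X

/-- The subgraph with a given set of vertices and multiple edges. -/
def ofTokens (H : Graph α β) (X : Finset (α ⊕ β)) : Graph α β :=
  (H.restrict {e | IsMultiple H e → Sum.inr e ∈ X}).induce {x | Sum.inl x ∈ X}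

/-- `t` is a vertex or an edge of `I`. -/
def IsToken (I : Graph α β) : α ⊕ β → Prop
  | .inl x => x ∈ V(I)
  | .inr e => e ∈ E(I)

open Classical in
/-- The vertices and those edges of `I` which are multiple in `H`. -/
noncomputable def toTokens (hH : (labels H).Finite) (I : Graph α β) : Finset (α ⊕ β) :=
  hH.toFinset.filter (IsToken I)

@[simp] lemma inl_mem_labels {x : α} : Sum.inl x ∈ labels H ↔ x ∈ V(H) := by simp [labels]

@[simp] lemma inr_mem_labels {e : β} : Sum.inr e ∈ labels H ↔ IsMultiple H e := by simp [labels]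

lemma IsMultiple.exists_isLink {e : β} (h : IsMultiple H e) : ∃ x y, H.IsLink e x y := by
  obtain ⟨_, x, y, -, h, -⟩ := h
  exact ⟨x, y, h⟩

lemma IsMultiple.congr {e f : β} {x y : α} (h : IsMultiple H e) (he : H.IsLink e x y)
    (hf : H.IsLink f x y) : IsMultiple H f := by
  obtain ⟨g, x', y', hge, hl, hg⟩ := h
  by_cases hfe : f = e
  · subst hfe
    exact ⟨g, x', y', hge, hl, hg⟩
  · exact ⟨e, x, y, Ne.symm hfe, hf, he⟩

lemma IsMultiple.mono (hle : I ≤ H) {e : β} (h : IsMultiple I e) : IsMultiple H e := by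
  obtain ⟨g, x, y, hge, hl, hg⟩ := h
  exact ⟨g, x, y, hge, hl.mono hle, hg.mono hle⟩

lemma ofTokens_isLink {X : Finset (α ⊕ β)} {e : β} {x y : α} : (ofTokens H X).IsLink e x y ↔
    H.IsLink e x y ∧ (IsMultiple H e → Sum.inr e ∈ X) ∧ Sum.inl x ∈ X ∧ Sum.inl y ∈ X := by
  simp only [ofTokens, Graph.induce_isLink, Graph.restrict_isLink, Set.mem_ofPred_eq]
  tauto

lemma mem_ofTokens {X : Finset (α ⊕ β)} {x : α} : x ∈ V(ofTokens H X) ↔ Sum.inl x ∈ X := Iff.rfl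

lemma ofTokens_mono {X Y : Finset (α ⊕ β)} (h : X ⊆ Y) : ofTokens H X ≤ ofTokens H Y := by
  refine ⟨fun x hx => h hx, fun e x y hl => ?_⟩
  rw [ofTokens_isLink] at hl ⊢
  exact ⟨hl.1, fun he => h (hl.2.1 he), h hl.2.2.1, h hl.2.2.2⟩

lemma inl_mem_toTokens (hH : (labels H).Finite) (hI : I ≤ H) {x : α} :
    Sum.inl x ∈ toTokens hH I ↔ x ∈ V(I) := by
  simp only [toTokens, Finset.mem_filter, Set.Finite.mem_toFinset, inl_mem_labels]
  exact ⟨And.right, fun h => ⟨hI.vertexSet_mono h, h⟩⟩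

lemma inr_mem_toTokens (hH : (labels H).Finite) {e : β} :
    Sum.inr e ∈ toTokens hH I ↔ IsMultiple H e ∧ e ∈ E(I) := by
  simp only [toTokens, Finset.mem_filter, Set.Finite.mem_toFinset, inr_mem_labels]
  rfl

/-- The edge of `I` provided by semi-inducedness must be `e`, the only edge of `H` with these ends.
Hence simple edges carry no information and tokens suffice. -/
lemma IsSemiInduced.isLink_of_not_isMultiple (hI : IsSemiInduced I H) {e : β} {x y : α}
    (hl : H.IsLink e x y) (hx : x ∈ V(I)) (hy : y ∈ V(I)) (he : ¬ IsMultiple H e) :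
    I.IsLink e x y := by
  obtain ⟨f, hf⟩ := hI.2 x hx y hy hl.adj
  by_cases hfe : f = e
  · rwa [← hfe]
  · exact absurd ⟨f, x, y, hfe, hl, hf.mono hI.1⟩ he

lemma ofTokens_toTokens (hH : (labels H).Finite) (hI : IsSemiInduced I H) :
    ofTokens H (toTokens hH I) = I := by
  refine Graph.ext ?_ ?_
  · ext x
    rw [mem_ofTokens, inl_mem_toTokens hH hI.1]
  · intro e x y
    rw [ofTokens_isLink, inl_mem_toTokens hH hI.1, inl_mem_toTokens hH hI.1, inr_mem_toTokens]
    constructor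
    · rintro ⟨hl, he, hx, hy⟩
      by_cases hm : IsMultiple H e
      · exact (hI.1.isLink_iff (he hm).2).2 hl
      · exact hI.isLink_of_not_isMultiple hl hx hy hm
    · exact fun hl => ⟨hl.mono hI.1, fun hm => ⟨hm, hl.edge_mem⟩, hl.left_mem, hl.right_mem⟩

lemma toTokens_subset (hH : (labels H).Finite) : (toTokens hH I : Set (α ⊕ β)) ⊆ labels H := by
  intro t ht
  simp only [toTokens, Finset.mem_coe, Finset.mem_filter] at ht
  exact hH.mem_toFinset.1 ht.1

/-- The component of `I` containing a vertex `x`. -/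
abbrev componentOf (I : Graph α β) (x : α) : Graph α β :=
  I.induce {y | Relation.ReflTransGen I.Adj x y}

lemma mem_edgeSet_componentOf {x : α} {e : β} :
    e ∈ E(componentOf I x) ↔ ∃ y z, I.IsLink e y z ∧ Relation.ReflTransGen I.Adj x y := by
  constructor
  · intro h
    obtain ⟨y, z, hl⟩ := Graph.exists_isLink_of_mem_edgeSet h
    rw [Graph.induce_isLink] at hl
    exact ⟨y, z, hl.1, hl.2.1⟩
  · rintro ⟨y, z, hl, h⟩
    have : (componentOf I x).IsLink e y z := by
      rw [Graph.induce_isLink]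
      exact ⟨hl, h, h.tail hl.adj⟩
    exact this.edge_mem

variable [DecidableEq α] [DecidableEq β]

lemma TokenOk.toTokens_ofTokens (hH : (labels H).Finite) {X : Finset (α ⊕ β)} (hX : TokenOk H A X) :
    toTokens hH (ofTokens H X) = X := by
  have hle : ofTokens H X ≤ H := by
    refine ⟨fun x hx => inl_mem_labels.1 (hX.subset hx), fun e x y hl => (ofTokens_isLink.1 hl).1⟩
  ext (x | e)
  · rw [inl_mem_toTokens hH hle, mem_ofTokens]
  · rw [inr_mem_toTokens]
    constructor
    · rintro ⟨hm, he⟩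
      obtain ⟨x, y, hl⟩ := Graph.exists_isLink_of_mem_edgeSet he
      exact (ofTokens_isLink.1 hl).2.1 hm
    · intro he
      have hm := inr_mem_labels.1 (hX.subset he)
      obtain ⟨x, y, hl⟩ := hm.exists_isLink
      exact ⟨hm, (ofTokens_isLink.2 ⟨hl, fun _ => he, hX.mem_of_inc e x he hl.inc_left,
        hX.mem_of_inc e y he hl.inc_right⟩).edge_mem⟩

lemma TokenOk.isSemiInduced {X : Finset (α ⊕ β)} (hX : TokenOk H A X) :
    IsSemiInduced (ofTokens H X) H := by
  refine ⟨⟨fun x hx => inl_mem_labels.1 (hX.subset hx),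
    fun e x y hl => (ofTokens_isLink.1 hl).1⟩, ?_⟩
  rintro x hx y hy ⟨e, he⟩
  rw [mem_ofTokens] at hx hy
  by_cases hm : IsMultiple H e
  · obtain ⟨f, hf, hfX⟩ := hX.exists_edge e x y hm he hx hy
    exact ⟨f, ofTokens_isLink.2 ⟨hf, fun _ => hfX, hx, hy⟩⟩
  · exact ⟨e, ofTokens_isLink.2 ⟨he, fun h => absurd h hm, hx, hy⟩⟩

/-- Walks in `I` link its vertices as tokens, because token adjacency of vertices is adjacency in
`H` and `I` has the same adjacencies between its vertices. Multiple edges hang on their ends, so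
they create no further connections. -/
lemma block_toTokens (hH : (labels H).Finite) (hI : IsSemiInduced I H) {x : α} (hx : x ∈ V(I)) :
    (block (tokAdj H) (toTokens hH I) (Sum.inl x) : Set (α ⊕ β)) =
      labels H ∩ (Sum.inl '' V(componentOf I x) ∪ Sum.inr '' E(componentOf I x)) := by
  classical
  set X := toTokens hH I
  have hreach : ∀ y, Relation.ReflTransGen I.Adj x y → y ∈ V(I) := by
    intro y hy
    rcases hy.cases_tail with rfl | ⟨z, -, hz⟩
    exacts [hx, hz.right_mem]
  have hlink : ∀ y, Relation.ReflTransGen I.Adj x y →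
      Linked (tokAdj H) X (Sum.inl x) (Sum.inl y) := by
    intro y hy
    induction hy with
    | refl => exact Linked.refl
    | tail _ hz ih =>
      exact ih.trans (Linked.of_adj (hz.mono hI.1) ((inl_mem_toTokens hH hI.1).2 hz.right_mem))
  apply Set.Subset.antisymm
  · intro t ht
    rw [Finset.mem_coe, mem_block] at ht
    refine ⟨toTokens_subset hH ht.1, ?_⟩
    have hC : IsClosedIn (tokAdj H) (X.filter fun t =>
        t ∈ (Sum.inl '' V(componentOf I x) ∪ Sum.inr '' E(componentOf I x) : Set (α ⊕ β))) X := by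
      refine ⟨Finset.filter_subset _ _, ?_⟩
      intro s hs r hr hsr
      rw [Finset.mem_filter] at hs ⊢
      refine ⟨hr, ?_⟩
      rcases s with y | e <;> rcases r with z | f
      · left
        have hy : Relation.ReflTransGen I.Adj x y := by simpa using hs.2
        exact ⟨z, hy.tail (hI.2 y (hreach y hy) z ((inl_mem_toTokens hH hI.1).1 hr) hsr), rfl⟩
      · right
        have hy : Relation.ReflTransGen I.Adj x y := by simpa using hs.2
        have hf := ((inr_mem_toTokens hH).1 hr).2
        have hinc := (hI.1.inc_congr hf).2 hsr.2
        obtain ⟨z, hz⟩ := hinc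
        exact ⟨f, mem_edgeSet_componentOf.2 ⟨y, z, hz, hy⟩, rfl⟩
      · left
        have he : e ∈ E(componentOf I x) := by simpa using hs.2
        obtain ⟨a, b, hl, ha⟩ := mem_edgeSet_componentOf.1 he
        rcases hsr.2.eq_or_eq_of_isLink (hl.mono hI.1) with rfl | rfl
        · exact ⟨z, ha, rfl⟩
        · exact ⟨z, ha.tail hl.adj, rfl⟩
      · exact hsr.elim
    have := ht.2 _ hC (Finset.mem_filter.2 ⟨(inl_mem_toTokens hH hI.1).2 hx,
      Or.inl ⟨x, Relation.ReflTransGen.refl, rfl⟩⟩)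
    exact (Finset.mem_filter.1 this).2
  · rintro _ ⟨hl, ⟨y, hy, rfl⟩ | ⟨e, he, rfl⟩⟩
    · exact mem_block.2 ⟨(inl_mem_toTokens hH hI.1).2 (hreach y hy), hlink y hy⟩
    · obtain ⟨a, b, hab, ha⟩ := mem_edgeSet_componentOf.1 he
      have heX : Sum.inr e ∈ X := (inr_mem_toTokens hH).2 ⟨inr_mem_labels.1 hl, hab.edge_mem⟩
      refine mem_block.2 ⟨heX, (hlink a ha).trans (Linked.of_adj ?_ heX)⟩
      exact ⟨inr_mem_labels.1 hl, (hab.mono hI.1).inc_left⟩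

/-- Because `A` contains no simple edges, counting elements of `A` in a component of `I` amounts to
summing weights over the corresponding block. Every block contains a vertex, so components of `I`
account for all of them. -/
lemma isEven_iff (hH : (labels H).Finite) (hA : A ⊆ labels H) (hI : IsSemiInduced I H) :
    IsEven A I ↔ IsEvenSet (tokAdj H) (weight A) (toTokens hH I) := by
  have hset : ∀ x ∈ V(I), A ∩ (Sum.inl '' V(componentOf I x) ∪ Sum.inr '' E(componentOf I x)) =
      A ∩ (block (tokAdj H) (toTokens hH I) (Sum.inl x)) := by
    intro x hx
    rw [block_toTokens hH hI hx, ← Set.inter_assoc, Set.inter_eq_left.2 hA]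
  have hblock : ∀ x ∈ V(I), (∑ t ∈ block (tokAdj H) (toTokens hH I) (Sum.inl x), weight A t = 0 ↔
      Even (A ∩ (Sum.inl '' V(componentOf I x) ∪ Sum.inr '' E(componentOf I x))).ncard) := by
    intro x hx
    rw [sum_weight_eq_zero_iff, hset x hx]
  constructor
  · intro h
    refine isEvenSet_of_block tokAdj_symm ?_
    have hv : ∀ x ∈ V(I), ∑ t ∈ block (tokAdj H) (toTokens hH I) (Sum.inl x), weight A t = 0 :=
      fun x hx => (hblock x hx).2 (h _ ⟨x, hx, rfl⟩)
    rintro (x | e) ht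
    · exact hv x ((inl_mem_toTokens hH hI.1).1 ht)
    · have he := (inr_mem_toTokens hH).1 ht
      obtain ⟨x, y, hl⟩ := Graph.exists_isLink_of_mem_edgeSet he.2
      rw [block_eq_of_linked tokAdj_symm (t := Sum.inl x) (Linked.of_adj ?_ ?_) ht]
      · exact hv x hl.left_mem
      · exact ⟨he.1, (hl.mono hI.1).inc_left⟩
      · exact (inl_mem_toTokens hH hI.1).2 hl.left_mem
  · rintro h _ ⟨x, hx, rfl⟩
    exact (hblock x hx).1 (h _ isClosedIn_block)

lemma tokenOk_toTokens (hH : (labels H).Finite) (hA : A ⊆ labels H) (hI : IsSemiInduced I H)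
    (hev : IsEven A I) : TokenOk H A (toTokens hH I) where
  subset := toTokens_subset hH
  mem_of_inc := by
    intro e x he hx
    rw [inr_mem_toTokens] at he
    rw [inl_mem_toTokens hH hI.1]
    exact ((hI.1.inc_congr he.2).2 hx).vertex_mem
  exists_edge := by
    intro e x y hm hl hx hy
    rw [inl_mem_toTokens hH hI.1] at hx hy
    obtain ⟨f, hf⟩ := hI.2 x hx y hy hl.adj
    exact ⟨f, hf.mono hI.1, (inr_mem_toTokens hH).2 ⟨hm.congr hl (hf.mono hI.1), hf.edge_mem⟩⟩
  even := (isEven_iff hH hA hI).1 hev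

/-- The even semi-induced subgraphs, as sets of vertices and multiple edges. -/
noncomputable def evenPosetIso (hH : (labels H).Finite) (hA : A ⊆ labels H) :
    EvenPoset H A ≃o {X : Finset (α ⊕ β) // TokenOk H A X} where
  toFun I := ⟨toTokens hH I.1, tokenOk_toTokens hH hA I.2.1 I.2.2⟩
  invFun X := ⟨ofTokens H X.1, X.2.isSemiInduced, (isEven_iff hH hA X.2.isSemiInduced).2 (by
    rw [X.2.toTokens_ofTokens hH]; exact X.2.even)⟩
  left_inv I := Subtype.ext (ofTokens_toTokens hH I.2.1)
  right_inv X := Subtype.ext (X.2.toTokens_ofTokens hH)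
  map_rel_iff' := by
    intro I I'
    constructor
    · intro h
      have := ofTokens_mono (H := H) (show toTokens hH I.1 ⊆ toTokens hH I'.1 from h)
      rwa [ofTokens_toTokens hH I.2.1, ofTokens_toTokens hH I'.2.1] at this
    · intro h
      have h' : I.1 ≤ I'.1 := h
      rintro (x | e) ht
      · exact (inl_mem_toTokens hH I'.2.1.1).2 (h'.vertexSet_mono ((inl_mem_toTokens hH I.2.1.1).1 ht))
      · have := (inr_mem_toTokens hH).1 ht
        exact (inr_mem_toTokens hH).2 ⟨this.1, Graph.IsSubgraph.edgeSet_mono h' this.2⟩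

end Tokens
end EvenSubgraph

/-! ### Admissibility without reference to components. -/

namespace EvenSubgraph

section Admissible

variable {α β : Type*} {H : Graph α β} {A : Set (α ⊕ β)}

lemma componentOf_isLink {x a b : α} {e : β} : (componentOf H x).IsLink e a b ↔
    H.IsLink e a b ∧ Relation.ReflTransGen H.Adj x a := by
  rw [Graph.induce_isLink]
  exact ⟨fun h => ⟨h.1, h.2.1⟩, fun h => ⟨h.1, h.2, h.2.tail h.1.adj⟩⟩

lemma componentOf_le {x : α} (hx : x ∈ V(H)) : componentOf H x ≤ H := by
  refine Graph.induce_le fun y hy => ?_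
  rcases Relation.ReflTransGen.cases_tail hy with rfl | ⟨z, -, hz⟩
  exacts [hx, hz.right_mem]

lemma isBundle_componentOf {x : α} {B : Set β} : IsBundle (componentOf H x) B ↔
    B.Nontrivial ∧ ∃ a b, B = {e | H.IsLink e a b} ∧ Relation.ReflTransGen H.Adj x a := by
  constructor
  · rintro ⟨hB, a, b, rfl⟩
    obtain ⟨e, he⟩ := hB.nonempty
    have ha := (componentOf_isLink.1 he).2
    refine ⟨hB, a, b, ?_, ha⟩
    ext f
    exact componentOf_isLink.trans (and_iff_left ha)
  · rintro ⟨hB, a, b, rfl, ha⟩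
    refine ⟨hB, a, b, ?_⟩
    ext f
    exact (componentOf_isLink.trans (and_iff_left ha)).symm

lemma IsBundle.isMultiple {B : Set β} (hB : IsBundle H B) {e : β} (he : e ∈ B) : IsMultiple H e := by
  obtain ⟨hB, x, y, rfl⟩ := hB
  obtain ⟨f, hf, hfe⟩ := hB.exists_ne e
  exact ⟨f, x, y, hfe, he, hf⟩

lemma IsMultiple.isBundle {e : β} {x y : α} (he : IsMultiple H e) (hl : H.IsLink e x y) :
    IsBundle H {f | H.IsLink f x y} := by
  obtain ⟨f, x', y', hfe, hl', hf⟩ := he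
  refine ⟨⟨e, hl, f, ?_, hfe.symm⟩, x, y, rfl⟩
  rcases hl'.eq_and_eq_or_eq_and_eq hl with ⟨rfl, rfl⟩ | ⟨rfl, rfl⟩
  exacts [hf, hf.symm]

lemma isMultiple_componentOf {x a b : α} {e : β} (hm : IsMultiple H e) (hl : H.IsLink e a b)
    (ha : Relation.ReflTransGen H.Adj x a) : IsMultiple (componentOf H x) e :=
  IsBundle.isMultiple (B := {f | H.IsLink f a b})
    (isBundle_componentOf.2 ⟨(hm.isBundle hl).1, a, b, rfl, ha⟩) hl

/-- The elements of `A` among the edges of a component are partitioned by the bundles, each of which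
contributes an even number. -/
lemma even_inter_edgeSet_componentOf (hH : (labels H).Finite) (hA : A ⊆ labels H)
    (hB : ∀ B, IsBundle H B → Even (A ∩ Sum.inr '' B).ncard) (x : α) :
    Even (A ∩ Sum.inr '' E(componentOf H x)).ncard := by
  classical
  set T : Finset (α ⊕ β) := hH.toFinset.filter (· ∈ Sum.inr '' E(componentOf H x)) with hT
  have hAT : A ∩ Sum.inr '' E(componentOf H x) = A ∩ T := by
    ext t
    simp only [hT, Set.mem_inter_iff, Finset.coe_filter, Set.Finite.mem_toFinset, Set.mem_ofPred_eq]
    exact ⟨fun h => ⟨h.1, hA h.1, h.2⟩, fun h => ⟨h.1, h.2.2⟩⟩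
  rw [hAT, ← sum_weight_eq_zero_iff]
  let bundle : α ⊕ β → Set β := fun t =>
    {f | ∃ a b e, t = Sum.inr e ∧ H.IsLink e a b ∧ H.IsLink f a b}
  have hbundle : ∀ {e a b}, H.IsLink e a b → bundle (Sum.inr e) = {f | H.IsLink f a b} := by
    intro e a b hl
    ext f
    constructor
    · rintro ⟨a', b', e', he, hl', hf⟩
      cases he
      rcases hl.eq_and_eq_or_eq_and_eq hl' with ⟨rfl, rfl⟩ | ⟨rfl, rfl⟩
      exacts [hf, hf.symm]
    · exact fun hf => ⟨a, b, e, rfl, hl, hf⟩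
  rw [← Finset.sum_fiberwise_of_maps_to (t := T.image bundle) (g := bundle)
    (fun t ht => Finset.mem_image_of_mem _ ht)]
  refine Finset.sum_eq_zero fun b hb => ?_
  obtain ⟨t, ht, rfl⟩ := Finset.mem_image.1 hb
  rw [Finset.mem_filter, hH.mem_toFinset] at ht
  obtain ⟨hm, e, he, rfl⟩ := ht
  rw [inr_mem_labels] at hm
  obtain ⟨a, b, hl, ha⟩ := mem_edgeSet_componentOf.1 he
  rw [sum_weight_eq_zero_iff]
  convert hB _ (hm.isBundle hl) using 2
  ext t
  simp only [Set.mem_inter_iff, Finset.coe_filter, Set.mem_ofPred_eq, and_congr_right_iff]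
  intro htA
  constructor
  · rintro ⟨htT, hbt⟩
    rw [Finset.mem_filter] at htT
    obtain ⟨-, f, hf, rfl⟩ := htT
    obtain ⟨a', b', hl', -⟩ := mem_edgeSet_componentOf.1 hf
    rw [hbundle hl, hbundle hl'] at hbt
    exact ⟨f, hbt.subset (show H.IsLink f a' b' from hl'), rfl⟩
  · rintro ⟨f, hf, rfl⟩
    refine ⟨?_, by rw [hbundle hl, hbundle hf]⟩
    rw [Finset.mem_filter, hH.mem_toFinset]
    exact ⟨hA htA, f, mem_edgeSet_componentOf.2 ⟨a, b, hf, ha⟩, rfl⟩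

/-- The bundles contribute evenly to each component, so only the vertices decide its parity. -/
lemma isEven_self_iff (hH : (labels H).Finite) (hA : A ⊆ labels H)
    (hB : ∀ B, IsBundle H B → Even (A ∩ Sum.inr '' B).ncard) :
    IsEven A H ↔ ∀ x ∈ V(H), Even (A ∩ Sum.inl '' V(componentOf H x)).ncard := by
  have key : ∀ x, Even (A ∩ (Sum.inl '' V(componentOf H x) ∪
      Sum.inr '' E(componentOf H x))).ncard ↔ Even (A ∩ Sum.inl '' V(componentOf H x)).ncard := by
    intro x
    rw [Set.inter_union_distrib_left, Set.ncard_union_eq ?_ ((hH.subset hA).inter_of_left _)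
      ((hH.subset hA).inter_of_left _), Nat.even_add]
    · simp [even_inter_edgeSet_componentOf hH hA hB x]
    · rw [Set.disjoint_left]
      rintro _ ⟨-, y, -, rfl⟩ ⟨-, e, -, he⟩
      cases he
  constructor
  · intro h x hx
    exact (key x).1 (h _ ⟨x, hx, rfl⟩)
  · rintro h _ ⟨x, hx, rfl⟩
    exact (key x).2 (h x hx)

/-- A description of the admissible sets which does not refer to components. -/
lemma admissible_iff (hH : (labels H).Finite) : Admissible H A ↔ A ⊆ labels H ∧
    (∀ x ∈ V(H), (∀ e, H.Inc e x → ¬ IsMultiple H e) → Sum.inl x ∈ A) ∧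
    (∀ B, IsBundle H B → (A ∩ Sum.inr '' B).Nonempty ∧ Even (A ∩ Sum.inr '' B).ncard) ∧
    IsEven A H := by
  have hV : ∀ x, A ∩ labels (componentOf H x) ∩ Sum.inl '' V(componentOf H x) =
      A ∩ Sum.inl '' V(componentOf H x) := by
    intro x
    rw [Set.inter_assoc]
    congr 1
    exact Set.inter_eq_right.2 Set.subset_union_left
  have hE : ∀ x B, IsBundle (componentOf H x) B →
      A ∩ labels (componentOf H x) ∩ Sum.inr '' B = A ∩ Sum.inr '' B := by
    intro x B hB
    rw [Set.inter_assoc]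
    congr 1
    refine Set.inter_eq_right.2 ?_
    rintro _ ⟨e, he, rfl⟩
    exact inr_mem_labels.2 (hB.isMultiple he)
  constructor
  · rintro ⟨hA, h⟩
    have hB : ∀ B, IsBundle H B → (A ∩ Sum.inr '' B).Nonempty ∧ Even (A ∩ Sum.inr '' B).ncard := by
      intro B hB
      obtain ⟨hB', a, b, rfl⟩ := id hB
      obtain ⟨e, he⟩ := hB'.nonempty
      have hK := h _ ⟨a, he.left_mem, rfl⟩
      have hBK : IsBundle (componentOf H a) {e | H.IsLink e a b} :=
        isBundle_componentOf.2 ⟨hB', a, b, rfl, Relation.ReflTransGen.refl⟩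
      rw [← hE a _ hBK]
      exact ⟨hK.bundle_nonempty _ hBK, hK.bundle_even _ hBK⟩
    refine ⟨hA, ?_, hB, (isEven_self_iff hH hA fun B h => (hB B h).2).2 ?_⟩
    · intro x hx hs
      refine ((h _ ⟨x, hx, rfl⟩).mem_of_simple x Relation.ReflTransGen.refl ?_).1
      exact fun e he hm => hs e (he.mono (componentOf_le hx)) (hm.mono (componentOf_le hx))
    · intro x hx
      rw [← hV]
      exact (h _ ⟨x, hx, rfl⟩).even_vertices
  · rintro ⟨hA, hs, hB, hev⟩
    refine ⟨hA, ?_⟩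
    rintro _ ⟨x, hx, rfl⟩
    refine ⟨?_, ?_, ?_, ?_⟩
    · change Even (A ∩ labels (componentOf H x) ∩ Sum.inl '' V(componentOf H x)).ncard
      rw [hV]
      exact (isEven_self_iff hH hA fun B h => (hB B h).2).1 hev x hx
    · intro v hv hvs
      refine ⟨hs v ((componentOf_le hx).vertexSet_mono hv) ?_, inl_mem_labels.2 hv⟩
      rintro e ⟨y, hl⟩ hm
      exact hvs e ⟨y, componentOf_isLink.2 ⟨hl, hv⟩⟩ (isMultiple_componentOf hm hl hv)
    · intro B hBK
      obtain ⟨hB', a, b, rfl, -⟩ := isBundle_componentOf.1 hBK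
      change (A ∩ labels (componentOf H x) ∩ Sum.inr '' {e | H.IsLink e a b}).Nonempty
      rw [hE x _ hBK]
      exact (hB _ ⟨hB', a, b, rfl⟩).1
    · intro B hBK
      obtain ⟨hB', a, b, rfl, -⟩ := isBundle_componentOf.1 hBK
      change Even (A ∩ labels (componentOf H x) ∩ Sum.inr '' {e | H.IsLink e a b}).ncard
      rw [hE x _ hBK]
      exact (hB _ ⟨hB', a, b, rfl⟩).2

end Admissible

/-! ### The product decomposition, and CL-shellability from the two structural conditions. -/

section Product

lemma IsClosedIn.of_subset {τ : Type*} {Γ : τ → τ → Prop} {C X Y : Finset τ}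
    (h : IsClosedIn Γ C X) (hCY : C ⊆ Y) (hYX : Y ⊆ X) :
    IsClosedIn Γ C Y :=
  ⟨hCY, fun x hx y hy hxy => h.2 x hx y (hYX hy) hxy⟩

variable {τ : Type*} [DecidableEq τ] {Γ : τ → τ → Prop} {w : τ → ZMod 2} {g X Y C D : Finset τ}
  {s t : τ}

lemma IsEvenSet.inter (hX : IsEvenSet Γ w X) (hXg : X ⊆ g)
    (hD : IsClosedIn Γ D g) : IsEvenSet Γ w (X ∩ D) := by
  intro C hC
  refine hX C ⟨hC.1.trans Finset.inter_subset_left, fun x hx y hy hxy => ?_⟩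
  refine hC.2 x hx y (Finset.mem_inter.2 ⟨hy, ?_⟩) hxy
  exact hD.2 x (Finset.mem_inter.1 (hC.1 hx)).2 y (hXg hy) hxy

variable {α β : Type*} [DecidableEq α] [DecidableEq β] {H : Graph α β} {A : Set (α ⊕ β)}

lemma TokenOk.subset_toFinset (hH : (labels H).Finite) {X : Finset (α ⊕ β)} (hX : TokenOk H A X) :
    X ⊆ hH.toFinset := fun _ ht => hH.mem_toFinset.2 (hX.subset ht)

lemma TokenOk.inter (hH : (labels H).Finite) {X D : Finset (α ⊕ β)} (hX : TokenOk H A X)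
    (hD : IsClosedIn (tokAdj H) D hH.toFinset) : TokenOk H A (X ∩ D) where
  subset := fun t ht => hX.subset (Finset.mem_inter.1 ht).1
  mem_of_inc := by
    intro e x he hx
    rw [Finset.mem_inter] at he ⊢
    have hxX := hX.mem_of_inc e x he.1 hx
    exact ⟨hxX, hD.2 _ he.2 _ (hX.subset_toFinset hH hxX) ⟨inr_mem_labels.1 (hX.subset he.1), hx⟩⟩
  exists_edge := by
    intro e x y he hl hx hy
    rw [Finset.mem_inter] at hx hy
    obtain ⟨f, hf, hfX⟩ := hX.exists_edge e x y he hl hx.1 hy.1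
    exact ⟨f, hf, Finset.mem_inter.2 ⟨hfX, hD.2 _ hx.2 _ (hX.subset_toFinset hH hfX)
      ⟨he.congr hl hf, hf.inc_left⟩⟩⟩
  even := hX.even.inter (hX.subset_toFinset hH) hD

/-- The components of the graph of tokens. -/
abbrev Blocks (Γ : τ → τ → Prop) (g : Finset τ) : Type _ := {D : Finset τ // ∃ t ∈ g, D = block Γ g t}

lemma Blocks.isClosedIn (D : Blocks Γ g) : IsClosedIn Γ D.1 g := by
  obtain ⟨D, t, -, rfl⟩ := D
  exact isClosedIn_block

lemma Blocks.eq_of_mem (hΓ : ∀ ⦃x y⦄, Γ x y → Γ y x) (D D' : Blocks Γ g) (h : t ∈ D.1)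
    (h' : t ∈ D'.1) : D = D' := by
  obtain ⟨D, s, hs, rfl⟩ := D
  obtain ⟨D', s', hs', rfl⟩ := D'
  refine Subtype.ext ?_
  change block Γ g s = block Γ g s'
  rw [block_eq_of_linked hΓ (mem_block.1 h).2 hs, block_eq_of_linked hΓ (mem_block.1 h').2 hs']

open Classical in
/-- The union of sets of tokens in the components. -/
noncomputable def unionBlocks {Γ : τ → τ → Prop} {g : Finset τ} (f : Blocks Γ g → Finset τ) :
    Finset τ := g.filter fun t => ∃ D, t ∈ f D

lemma mem_unionBlocks {f : Blocks Γ g → Finset τ} (hf : ∀ D, f D ⊆ D.1) :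
    t ∈ unionBlocks f ↔ ∃ D, t ∈ f D := by
  simp only [unionBlocks, Finset.mem_filter, and_iff_right_iff_imp]
  rintro ⟨D, hD⟩
  exact D.isClosedIn.1 (hf D hD)

lemma unionBlocks_subset {f : Blocks Γ g → Finset τ} : unionBlocks f ⊆ g := by
  intro t ht
  simp only [unionBlocks, Finset.mem_filter] at ht
  exact ht.1

lemma unionBlocks_inter (hΓ : ∀ ⦃x y⦄, Γ x y → Γ y x) {f : Blocks Γ g → Finset τ}
    (hf : ∀ D, f D ⊆ D.1) (D : Blocks Γ g) : unionBlocks f ∩ D.1 = f D := by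
  ext t
  rw [Finset.mem_inter, mem_unionBlocks hf]
  constructor
  · rintro ⟨⟨D', h'⟩, h⟩
    rwa [Blocks.eq_of_mem hΓ D D' h (hf D' h')]
  · exact fun h => ⟨⟨D, h⟩, hf D h⟩

lemma tokenOk_unionBlocks (hH : (labels H).Finite)
    {f : Blocks (tokAdj H) hH.toFinset → Finset (α ⊕ β)} (hf : ∀ D, f D ⊆ D.1)
    (hok : ∀ D, TokenOk H A (f D)) : TokenOk H A (unionBlocks f) where
  subset := by
    intro t ht
    obtain ⟨D, hD⟩ := (mem_unionBlocks hf).1 ht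
    exact (hok D).subset hD
  mem_of_inc := by
    intro e x he hx
    rw [mem_unionBlocks hf] at he ⊢
    obtain ⟨D, hD⟩ := he
    exact ⟨D, (hok D).mem_of_inc e x hD hx⟩
  exists_edge := by
    intro e x y he hl hx hy
    rw [mem_unionBlocks hf] at hx hy
    obtain ⟨D, hD⟩ := hx
    obtain ⟨D', hD'⟩ := hy
    have hyD := D.isClosedIn.2 _ (hf D hD) (Sum.inl y) (D'.isClosedIn.1 (hf D' hD')) hl.adj
    obtain rfl := Blocks.eq_of_mem tokAdj_symm D D' hyD (hf D' hD')
    obtain ⟨f', hf', hfX⟩ := (hok D).exists_edge e x y he hl hD hD'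
    exact ⟨f', hf', (mem_unionBlocks hf).2 ⟨D, hfX⟩⟩
  even := by
    refine isEvenSet_of_block tokAdj_symm fun t ht => ?_
    obtain ⟨D, hD⟩ := (mem_unionBlocks hf).1 ht
    have hcl : IsClosedIn (tokAdj H) (f D) (unionBlocks f) := by
      rw [← unionBlocks_inter tokAdj_symm hf D, Finset.inter_comm]
      exact D.isClosedIn.inter unionBlocks_subset
    exact (hok D).even _ (isClosedIn_block.of_subset
      (fun r hr => (mem_block.1 hr).2 _ hcl hD) hcl.1)

/-- The poset of even sets of tokens is the product of those of the components. -/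
noncomputable def tokenOkIso (hH : (labels H).Finite) : {X : Finset (α ⊕ β) // TokenOk H A X} ≃o
    ∀ D : Blocks (tokAdj H) hH.toFinset, {X : Finset (α ⊕ β) // TokenOk H A X ∧ X ⊆ D.1} where
  toFun X D := ⟨X.1 ∩ D.1, X.2.inter hH D.isClosedIn, Finset.inter_subset_right⟩
  invFun f := ⟨unionBlocks fun D => (f D).1,
    tokenOk_unionBlocks hH (fun D => (f D).2.2) (fun D => (f D).2.1)⟩
  left_inv X := by
    refine Subtype.ext ?_
    ext t
    change t ∈ unionBlocks _ ↔ _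
    rw [mem_unionBlocks fun D => Finset.inter_subset_right]
    constructor
    · rintro ⟨D, hD⟩
      exact (Finset.mem_inter.1 hD).1
    · intro ht
      have htg := X.2.subset_toFinset hH ht
      exact ⟨⟨_, t, htg, rfl⟩, Finset.mem_inter.2 ⟨ht, mem_block.2 ⟨htg, Linked.refl⟩⟩⟩
  right_inv f := by
    funext D
    exact Subtype.ext (unionBlocks_inter tokAdj_symm (fun D => (f D).2.2) D)
  map_rel_iff' := by
    intro X Y
    constructor
    · intro h t ht
      have htg := X.2.subset_toFinset hH ht
      have := h ⟨_, t, htg, rfl⟩ (Finset.mem_inter.2 ⟨ht, mem_block.2 ⟨htg, Linked.refl⟩⟩)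
      exact (Finset.mem_inter.1 this).1
    · intro h D
      exact Finset.inter_subset_inter_right h

/-- An order isomorphism between subtypes given by equivalent predicates. -/
def subtypeIso {P : Type*} [PartialOrder P] {p q : P → Prop} (h : ∀ x, p x ↔ q x) :
    {x // p x} ≃o {x // q x} where
  toEquiv := Equiv.subtypeEquivRight h
  map_rel_iff' := Iff.rfl

/-- Two multiple edges in the same component have the same ends. -/
def BundlesSeparated (H : Graph α β) (g : Finset (α ⊕ β)) : Prop :=
  ∀ e f, IsMultiple H e → IsMultiple H f → Linked (tokAdj H) g (Sum.inr e) (Sum.inr f) →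
    ∀ x y, H.IsLink e x y → H.IsLink f x y

/-- A bundle together with an even set of other vertices has at most one further neighbor. -/
def UniqueNeighbor (H : Graph α β) : Prop :=
  ∀ e u v, IsMultiple H e → H.IsLink e u v → ∀ W : Finset (α ⊕ β),
    (∀ r ∈ W, ∃ x ∈ V(H), r = Sum.inl x) → IsEvenSet (tokAdj H) (fun _ => 1) W → Sum.inl u ∉ W →
    Sum.inl v ∉ W → ∀ s ∈ V(H), ∀ t ∈ V(H), Sum.inl s ∉ W → Sum.inl t ∉ W → s ≠ u → s ≠ v →
    t ≠ u → t ≠ v → Linked (tokAdj H) ({Sum.inl u, Sum.inl v, Sum.inl s} ∪ W) (Sum.inl u) (Sum.inl s) →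
    Linked (tokAdj H) ({Sum.inl u, Sum.inl v, Sum.inl t} ∪ W) (Sum.inl u) (Sum.inl t) → s = t

/-- A component either has no multiple edge, in which case all its tokens are odd, or has a single
bundle by `BundlesSeparated` and is an instance of `BundleModel`. Vertices off the bundle are
incident only to simple edges and thus belong to `A`. -/
theorem exists_isAtomOrder_block (hH : (labels H).Finite) [H.Loopless]
    (hs : ∀ x ∈ V(H), (∀ e, H.Inc e x → ¬ IsMultiple H e) → Sum.inl x ∈ A)
    (h1 : BundlesSeparated H hH.toFinset) (h2 : UniqueNeighbor H)
    (D : Blocks (tokAdj H) hH.toFinset) :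
    ∃ R, IsAtomOrder (P := {X : Finset (α ⊕ β) // TokenOk H A X ∧ X ⊆ D.1}) R := by
  classical
  have hDcl := D.isClosedIn
  have hDmul : ∀ e x y, IsMultiple H e → H.IsLink e x y → Sum.inl x ∈ D.1 → Sum.inr e ∈ D.1 :=
    fun e x y hm hl hx => hDcl.2 _ hx _ (hH.mem_toFinset.2 (inr_mem_labels.2 hm)) ⟨hm, hl.inc_left⟩
  have hDm : ∀ e, Sum.inr e ∈ D.1 → IsMultiple H e :=
    fun e he => inr_mem_labels.1 (hH.mem_toFinset.1 (hDcl.1 he))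
  have hDv : ∀ x, Sum.inl x ∈ D.1 → x ∈ V(H) :=
    fun x hx => inl_mem_labels.1 (hH.mem_toFinset.1 (hDcl.1 hx))
  by_cases hD : ∃ e, Sum.inr e ∈ D.1
  · obtain ⟨e, he⟩ := hD
    have hm := hDm e he
    obtain ⟨u, v, hl⟩ := hm.exists_isLink
    have hDE : ∀ f, Sum.inr f ∈ D.1 → H.IsLink f u v := by
      intro f hf
      refine h1 e f hm (hDm f hf) ?_ u v hl
      obtain ⟨D, t, ht, rfl⟩ := D
      exact ((mem_block.1 he).2.symm tokAdj_symm ht).trans (mem_block.1 hf).2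
    obtain ⟨r, hr⟩ : ∃ r : α ⊕ β → ℕ, Set.InjOn r D.1 :=
      Set.countable_iff_exists_injOn.1 (Finset.countable_toSet D.1)
    have hvert : ∀ s ∈ D.1, (¬ ∃ f, s = Sum.inr f ∧ H.IsLink f u v) → ∃ x, s = Sum.inl x := by
      rintro (x | f) hs hn
      · exact ⟨x, rfl⟩
      · exact absurd ⟨f, rfl, hDE f hs⟩ hn
    have hodd : ∀ s ∈ D.1, (¬ ∃ f, s = Sum.inr f ∧ H.IsLink f u v) → s ≠ Sum.inl u →
        s ≠ Sum.inl v → weight A s ≠ 0 := by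
      intro s hsD hn hsu hsv
      obtain ⟨x, rfl⟩ := hvert s hsD hn
      refine weight_ne_zero.2 (hs x (hDv x hsD) fun f hf hfm => ?_)
      obtain ⟨y, hfl⟩ := hf
      rcases hfl.left_eq_or_eq (hDE f (hDmul f x y hfm hfl hsD)) with rfl | rfl
      exacts [hsu rfl, hsv rfl]
    let M : BundleModel (α ⊕ β) :=
      { adj := tokAdj H
        symm := tokAdj_symm
        w := weight A
        IsEdge := fun s => ∃ f, s = Sum.inr f ∧ H.IsLink f u v
        u := Sum.inl u
        v := Sum.inl v
        ne := fun h => hl.ne (Sum.inl.inj h)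
        adj_ends := hl.adj
        not_isEdge_u := by rintro ⟨f, hf, -⟩; cases hf
        not_isEdge_v := by rintro ⟨f, hf, -⟩; cases hf
        adj_edge := by
          rintro _ (x | f') ⟨f, rfl, hf⟩
          · simp only [Sum.inl.injEq]
            constructor
            · exact fun h => h.2.eq_or_eq_of_isLink hf
            · rintro (rfl | rfl)
              exacts [⟨hm.congr hl hf, hf.inc_left⟩, ⟨hm.congr hl hf, hf.inc_right⟩]
          · simp [tokAdj]
        ground := D.1
        w_vertex := hodd
        unique_nbr := by
          intro W hW hWev hu hv hWe s hsD t htD hsW htW hse hte hsu hsv htu htv hls hlt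
          obtain ⟨s, rfl⟩ := hvert s hsD hse
          obtain ⟨t, rfl⟩ := hvert t htD hte
          rw [h2 e u v hm hl W ?_ ?_ hu hv s (hDv s hsD) t (hDv t htD) hsW htW
            (fun h => hsu (h ▸ rfl)) (fun h => hsv (h ▸ rfl)) (fun h => htu (h ▸ rfl))
            (fun h => htv (h ▸ rfl)) hls hlt]
          · intro r hr
            obtain ⟨x, rfl⟩ := hvert r (hW hr) (hWe r hr)
            exact ⟨x, hDv x (hW hr), rfl⟩
          -- Vertices of `W` are off the bundle and so have weight 1; evenness for `A` thus agrees
          -- with the weight-one evenness in `UniqueNeighbor`.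
          · intro C hC
            rw [← hWev C hC]
            refine Finset.sum_congr rfl fun r hr => ?_
            have hrW := hC.1 hr
            exact (ZMod.eq_one_of_ne_zero (hodd r (hW hrW) (hWe r hrW) (fun h => hu (h ▸ hrW))
              (fun h => hv (h ▸ hrW)))).symm
        rank := r
        rank_inj := hr }
    obtain ⟨R, hR⟩ := M.exists_isAtomOrder
    refine ⟨_, hR.of_orderIso (subtypeIso (p := fun X => TokenOk H A X ∧ X ⊆ D.1) fun X => ?_)⟩
    constructor
    · rintro ⟨hX, hXD⟩
      refine ⟨hXD, ?_, ?_, hX.even⟩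
      · rintro _ hfX ⟨f, rfl, hf⟩
        exact ⟨hX.mem_of_inc f u hfX hf.inc_left, hX.mem_of_inc f v hfX hf.inc_right⟩
      · intro hu hv
        obtain ⟨f, hf, hfX⟩ := hX.exists_edge e u v hm hl hu hv
        exact ⟨_, hfX, f, rfl, hf⟩
    · rintro ⟨hXD, hX1, hX2, hX3⟩
      refine ⟨⟨fun t ht => hH.mem_toFinset.1 (hDcl.1 (hXD ht)), ?_, ?_, hX3⟩, hXD⟩
      · intro f x hfX hfx
        have hf := hDE f (hXD hfX)
        have := hX1 _ hfX ⟨f, rfl, hf⟩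
        rcases hfx.eq_or_eq_of_isLink hf with rfl | rfl
        exacts [this.1, this.2]
      · intro f x y hfm hfl hx hy
        have hf := hDE f (hDmul f x y hfm hfl (hXD hx))
        rcases hfl.eq_and_eq_or_eq_and_eq hf with ⟨rfl, rfl⟩ | ⟨rfl, rfl⟩
        · obtain ⟨_, he'X, e', rfl, he'⟩ := hX2 hx hy
          exact ⟨e', he', he'X⟩
        · obtain ⟨_, he'X, e', rfl, he'⟩ := hX2 hy hx
          exact ⟨e', he'.symm, he'X⟩
  · push Not at hD
    obtain ⟨R, hR⟩ := exists_isAtomOrder_of_odd (Γ := tokAdj H) (w := weight A) (g := D.1)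
      tokAdj_symm (by
        rintro (x | e) ht
        · refine weight_ne_zero.2 (hs x (hDv x ht) ?_)
          rintro e ⟨y, hl⟩ hm
          exact hD e (hDmul e x y hm hl ht)
        · exact absurd ht (hD e))
    refine ⟨_, hR.of_orderIso (subtypeIso (p := fun X => TokenOk H A X ∧ X ⊆ D.1) fun X => ?_)⟩
    constructor
    · exact fun h => ⟨h.2, h.1.even⟩
    · rintro ⟨hXD, hX⟩
      refine ⟨⟨fun t ht => hH.mem_toFinset.1 (hDcl.1 (hXD ht)), ?_, ?_, hX⟩, hXD⟩
      · exact fun e x he => absurd (hXD he) (hD e)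
      · exact fun e x y hm hl hx => absurd (hDmul e x y hm hl (hXD hx)) (hD e)

/-- Atom orders of the blocks combine through the product and the two isomorphisms. The least
element is the empty graph, and admissibility makes `H` itself even, so it is the greatest element.
-/
theorem clShellable_of_separated (hH : (labels H).Finite) [H.Loopless] (hA : Admissible H A)
    (h1 : BundlesSeparated H hH.toFinset) (h2 : UniqueNeighbor H) :
    CLShellable (EvenPoset H A) := by
  obtain ⟨hAl, hs, -, hev⟩ := (admissible_iff hH).1 hA
  choose R hR using exists_isAtomOrder_block hH hs h1 h2
  have hfin : Finite {X : Finset (α ⊕ β) // TokenOk H A X} := by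
    refine Finite.of_injective (β := hH.toFinset.powerset)
      (fun X => ⟨X.1, Finset.mem_powerset.2 (X.2.subset_toFinset hH)⟩) ?_
    intro X Y h
    exact Subtype.ext (congrArg (fun Z => Z.1) h)
  have : Finite (EvenPoset H A) := Finite.of_equiv _ (evenPosetIso hH hAl).symm.toEquiv
  refine (((IsAtomOrder.pi hR).of_orderIso (tokenOkIso hH)).of_orderIso
    (evenPosetIso hH hAl)).clShellable (b := ⟨⊥, ⟨bot_le, ?_⟩, ?_⟩)
    (u := ⟨H, ⟨le_rfl, fun _ _ _ _ h => h⟩, hev⟩) ?_ ?_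
  · simp
  · rintro K ⟨x, hx, -⟩
    simp at hx
  · exact fun I => (bot_le : ⊥ ≤ I.1)
  · exact fun I => I.2.1.1

end Product
end EvenSubgraph

/-! ### A nonshellable interval produced by a bundle. -/

namespace EvenSubgraph

section Obstruction

variable {τ : Type*}

/-- An interval of the poset of the sets satisfying `Q` which is not shellable. The tokens `a`, `b`
behave like the edges of a bundle with ends `u`, `v`, and the sets containing exactly one of the
two tokens `p i` form two components of the open interval. -/
theorem not_shellable_of_bundle {P : Type*} [PartialOrder P] [Finite P] {Q : Finset τ → Prop}
    (φ : P ≃o {X : Finset τ // Q X}) {I J : Finset τ} (hI : Q I) (hJ : Q J) (hIJ : I ⊆ J)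
    {u v a b : τ} {p : Bool → τ} (hpI : ∀ i, p i ∉ I) (hpJ : ∀ i, p i ∈ J)
    (hpar : ∀ K, Q K → I ⊆ K → K ⊆ J → weight K u + weight K v + weight K a + weight K b +
      weight K (p true) + weight K (p false) = 0)
    (hab : ∀ K, Q K → a ∈ K ∨ b ∈ K → u ∈ K ∧ v ∈ K)
    (huv : ∀ K, Q K → K ⊆ J → u ∈ K → v ∈ K → a ∈ K ∨ b ∈ K)
    (htop : ∀ K, Q K → I ⊆ K → K ⊆ J → u ∈ K → v ∈ K → a ∈ K → b ∈ K → (∀ i, p i ∈ K) → K = J)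
    (hbot : ∀ K, Q K → I ⊆ K → K ⊆ J → u ∉ K → v ∉ K → a ∉ K → b ∉ K → (∀ i, p i ∉ K) → K = I)
    (hm : ∀ i, ∃ m M, Q m ∧ Q M ∧ I ⊆ m ∧ m ⊆ M ∧ M ⊆ J ∧ p i ∈ m ∧ p (!i) ∉ M ∧
      ¬ (u ∈ m ∧ v ∈ m) ∧ u ∈ M ∧ v ∈ M ∧ a ∈ M ∧
      (∀ K, Q K → I ⊆ K → p i ∈ K → u ∈ K → v ∈ K → m ⊆ K) ∧
      (∀ K, Q K → K ⊆ J → a ∉ K → b ∉ K → p (!i) ∉ K → K ⊆ M)) : ¬ Shellable P := by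
  have hpar' : ∀ i K, Q K → I ⊆ K → K ⊆ J → weight K u + weight K v + weight K a + weight K b +
      weight K (p i) + weight K (p (!i)) = 0 := by
    intro i K h1 h2 h3
    have := hpar K h1 h2 h3
    cases i
    · rw [← this, Bool.not_false]; ring
    · exact this
  have h2 : (1 : ZMod 2) + 1 = 0 := by decide
  have hall : ∀ (i : Bool) (q : τ → Prop), q (p i) → q (p (!i)) → ∀ j, q (p j) := by
    intro i q h1 h2 j
    cases i <;> cases j <;> assumption
  have hw1 : ∀ {K : Finset τ} {t : τ}, t ∈ K → weight (K : Set τ) t = 1 :=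
    fun h => weight_of_mem (Finset.mem_coe.2 h)
  have hw0 : ∀ {K : Finset τ} {t : τ}, t ∉ K → weight (K : Set τ) t = 0 :=
    fun h => weight_of_notMem (fun h' => h (Finset.mem_coe.1 h'))
  -- If `u`, `v`, `a`, `b` have even total, all or none of them are present: an edge needs both
  -- ends, and both ends need an edge.
  have aux : ∀ K : Finset τ, weight (K : Set τ) u + weight K v + weight K a + weight K b = 0 →
      (a ∈ K ∨ b ∈ K → u ∈ K ∧ v ∈ K) → (u ∈ K → v ∈ K → a ∈ K ∨ b ∈ K) →
      (u ∉ K ∧ v ∉ K ∧ a ∉ K ∧ b ∉ K) ∨ (u ∈ K ∧ v ∈ K ∧ a ∈ K ∧ b ∈ K) := by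
    intro K e1 e2 e3
    by_cases hu : u ∈ K
    · rw [hw1 hu] at e1
      by_cases hv : v ∈ K
      · right
        rw [hw1 hv, h2, zero_add] at e1
        by_cases ha : a ∈ K <;> by_cases hb : b ∈ K
        · exact ⟨hu, hv, ha, hb⟩
        · rw [hw1 ha, hw0 hb] at e1
          exact absurd e1 (by decide)
        · rw [hw0 ha, hw1 hb] at e1
          exact absurd e1 (by decide)
        · exact absurd (e3 hu hv) (not_or.2 ⟨ha, hb⟩)
      · have ha : a ∉ K := fun h => hv (e2 (Or.inl h)).2
        have hb : b ∉ K := fun h => hv (e2 (Or.inr h)).2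
        rw [hw0 hv, hw0 ha, hw0 hb] at e1
        exact absurd e1 (by decide)
    · have ha : a ∉ K := fun h => hu (e2 (Or.inl h)).1
      have hb : b ∉ K := fun h => hu (e2 (Or.inr h)).1
      by_cases hv : v ∈ K
      · rw [hw0 hu, hw1 hv, hw0 ha, hw0 hb] at e1
        exact absurd e1 (by decide)
      · exact Or.inl ⟨hu, hv, ha, hb⟩
  -- a set containing both tokens
  have aux1 : ∀ i K, Q K → I ⊆ K → K ⊆ J → K ≠ J → p i ∈ K → p (!i) ∈ K →
      u ∉ K ∧ v ∉ K ∧ a ∉ K ∧ b ∉ K := by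
    intro i K hK hIK hKJ hne h3 h4
    have e1 := hpar' i K hK hIK hKJ
    rw [hw1 h3, hw1 h4, add_assoc, h2, add_zero] at e1
    refine (aux K e1 (hab K hK) (huv K hK hKJ)).resolve_right ?_
    rintro ⟨h5, h6, h7, h8⟩
    exact hne (htop K hK hIK hKJ h5 h6 h7 h8 (hall i (· ∈ K) h3 h4))
  -- a set containing none of the tokens
  have aux2 : ∀ i K, Q K → I ⊆ K → K ⊆ J → K ≠ I → p i ∉ K → p (!i) ∉ K →
      u ∈ K ∧ v ∈ K ∧ a ∈ K ∧ b ∈ K := by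
    intro i K hK hIK hKJ hne h3 h4
    have e1 := hpar' i K hK hIK hKJ
    rw [hw0 h3, hw0 h4, add_zero, add_zero] at e1
    refine (aux K e1 (hab K hK) (huv K hK hKJ)).resolve_left ?_
    rintro ⟨h5, h6, h7, h8⟩
    exact hne (hbot K hK hIK hKJ h5 h6 h7 h8 (hall i (· ∉ K) h3 h4))
  -- With exactly one `p` token, parity makes the number of tokens among `u`, `v`, `a`, `b` odd.
  have aux3 : ∀ i K, Q K → I ⊆ K → K ⊆ J → p i ∈ K → p (!i) ∉ K →
      ¬ (u ∉ K ∧ v ∉ K ∧ a ∉ K ∧ b ∉ K) ∧ ¬ (u ∈ K ∧ v ∈ K ∧ a ∈ K ∧ b ∈ K) := by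
    intro i K hK hIK hKJ h3 h4
    have e1 := hpar' i K hK hIK hKJ
    rw [hw1 h3, hw0 h4] at e1
    constructor <;> rintro ⟨hu, hv, ha, hb⟩
    · rw [hw0 hu, hw0 hv, hw0 ha, hw0 hb] at e1
      revert e1; decide
    · rw [hw1 hu, hw1 hv, hw1 ha, hw1 hb] at e1
      revert e1; decide
  set x : P := φ.symm ⟨I, hI⟩ with hx
  set y : P := φ.symm ⟨J, hJ⟩ with hy
  have hlow : ∀ {k : P}, x < k → I ⊆ (φ k).1 ∧ (φ k).1 ≠ I := by
    intro k hk
    rw [hx, OrderIso.symm_apply_lt] at hk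
    exact ⟨hk.le, fun h => hk.ne (Subtype.ext h.symm)⟩
  have hup : ∀ {k : P}, k < y → (φ k).1 ⊆ J ∧ (φ k).1 ≠ J := by
    intro k hk
    rw [hy, OrderIso.lt_symm_apply] at hk
    exact ⟨hk.le, fun h => hk.ne (Subtype.ext h)⟩
  have hIoo : ∀ K (hK : Q K), I ⊆ K → K ⊆ J → K ≠ I → K ≠ J → φ.symm ⟨K, hK⟩ ∈ Set.Ioo x y := by
    intro K hK h1 h2 h3 h4
    constructor
    · rw [hx, φ.symm.lt_iff_lt]
      exact lt_of_le_of_ne h1 (fun h => h3 (congrArg Subtype.val h).symm)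
    · rw [hy, φ.symm.lt_iff_lt]
      exact lt_of_le_of_ne h2 (fun h => h4 (congrArg Subtype.val h))
  have hxy : x < y := by
    rw [hx, hy, φ.symm.lt_iff_lt]
    refine lt_of_le_of_ne hIJ (fun h => hpI true ?_)
    rw [show I = J from congrArg Subtype.val h]
    exact hpJ true
  -- A comparison cannot leave the piece of `p i`. Gaining the other `p` token below `J` would
  -- require losing all of `u`, `v`, `a`, `b`; losing `p i` above `I` would require all four to be
  -- present already. Both contradict `aux3`.
  refine not_shellable_of_disconnected hxy
    (C := fun i => {k | k ∈ Set.Ioo x y ∧ p i ∈ (φ k).1 ∧ p (!i) ∉ (φ k).1})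
    (fun i k hk => hk.1) ?_ ?_ ?_ ?_
  · exact fun k hk hk' => hk'.2.2 hk.2.1
  · intro i
    obtain ⟨m, M, hQm, -, hIm, hmM, hMJ, hpm, hpM, -⟩ := hm i
    refine ⟨φ.symm ⟨m, hQm⟩, hIoo m hQm hIm (hmM.trans hMJ) (fun h => hpI i (h ▸ hpm))
      (fun h => hpM (hmM (h ▸ hpJ (!i)))), ?_⟩
    simpa using ⟨hpm, fun h => hpM (hmM h)⟩
  · rintro i k ⟨hk, hki, hki'⟩ l hl hkl
    obtain ⟨hIk, -⟩ := hlow hk.1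
    obtain ⟨hkJ, -⟩ := hup hk.2
    obtain ⟨hIl, hIl'⟩ := hlow hl.1
    obtain ⟨hlJ, hlJ'⟩ := hup hl.2
    obtain ⟨h3, h4⟩ := aux3 i _ (φ k).2 hIk hkJ hki hki'
    refine ⟨hl, ?_⟩
    rcases hkl with hkl | hkl
    · have hsub : (φ k).1 ⊆ (φ l).1 := φ.le_iff_le.2 hkl
      refine ⟨hsub hki, fun h => h3 ?_⟩
      obtain ⟨hu, hv, ha, hb⟩ := aux1 i _ (φ l).2 hIl hlJ hlJ' (hsub hki) h
      exact ⟨fun h => hu (hsub h), fun h => hv (hsub h), fun h => ha (hsub h), fun h => hb (hsub h)⟩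
    · have hsub : (φ l).1 ⊆ (φ k).1 := φ.le_iff_le.2 hkl
      have hl' : p (!i) ∉ (φ l).1 := fun h => hki' (hsub h)
      refine ⟨by_contra fun h => h4 ?_, hl'⟩
      obtain ⟨hu, hv, ha, hb⟩ := aux2 i _ (φ l).2 hIl hlJ hIl' h hl'
      exact ⟨hsub hu, hsub hv, hsub ha, hsub hb⟩
  · rintro i k ⟨hk, hki, hki'⟩
    obtain ⟨hIk, -⟩ := hlow hk.1
    obtain ⟨hkJ, -⟩ := hup hk.2
    obtain ⟨m, M, hQm, hQM, hIm, hmM, hMJ, hpm, hpM, hmuv, huM, hvM, haM, hm', hM'⟩ := hm i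
    -- No point is isolated: a set containing both ends lies strictly above `m`, which lacks one,
    -- and any other set contains no edge and lies strictly below `M`.
    by_cases huvk : u ∈ (φ k).1 ∧ v ∈ (φ k).1
    · refine ⟨φ.symm ⟨m, hQm⟩, hIoo m hQm hIm (hmM.trans hMJ) (fun h => hpI i (h ▸ hpm))
        (fun h => hpM (hmM (h ▸ hpJ (!i)))), ?_, Or.inr ?_⟩
      · rintro rfl
        exact hmuv (by simpa using huvk)
      · rw [φ.symm_apply_le]
        exact hm' _ (φ k).2 hIk hki huvk.1 huvk.2
    · have hak : a ∉ (φ k).1 := fun h => huvk (hab _ (φ k).2 (Or.inl h))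
      have hbk : b ∉ (φ k).1 := fun h => huvk (hab _ (φ k).2 (Or.inr h))
      refine ⟨φ.symm ⟨M, hQM⟩, hIoo M hQM (hIm.trans hmM) hMJ (fun h => hpI i (h ▸ hmM hpm))
        (fun h => hpM (h ▸ hpJ (!i))), ?_, Or.inl ?_⟩
      · rintro rfl
        exact hak (by simpa using haM)
      · rw [φ.le_symm_apply]
        exact hM' _ (φ k).2 hkJ hak hbk hki'

end Obstruction

/-! ### Construction of PI-graphs and admissible sets. -/

section PIGraph

variable {α β : Type*} {G H : Graph α β}

/-- The induced subgraph on `S`, keeping the bundles selected by `keep` and replacing the other ones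
with simple edges. -/
lemma exists_isPIGraph (G : Graph α β) {S : Set α} (hS : S ⊆ V(G)) {keep : α → α → Prop}
    (hk : ∀ x y, keep x y → keep y x) : ∃ H, IsPIGraph H G ∧ V(H) = S ∧
      (∀ x ∈ S, ∀ y ∈ S, keep x y → ∀ e, G.IsLink e x y → H.IsLink e x y) ∧
      (∀ e x y, H.IsLink e x y → IsMultiple H e → keep x y) := by
  -- A bundle that is not kept is represented by its least edge in a fixed well-order of the edges.
  let R : Set β := {e | ∃ x y, G.IsLink e x y ∧
    (keep x y ∨ ∀ f, G.IsLink f x y → ¬ WellOrderingRel f e)}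
  have hmin : ∀ {e x y}, e ∈ R → G.IsLink e x y → ¬ keep x y →
      ∀ f, G.IsLink f x y → ¬ WellOrderingRel f e := by
    rintro e x y ⟨x', y', hl', h⟩ hl hxy f hf
    rcases hl.eq_and_eq_or_eq_and_eq hl' with ⟨rfl, rfl⟩ | ⟨rfl, rfl⟩
    · exact (h.resolve_left hxy) f hf
    · exact (h.resolve_left fun h' => hxy (hk _ _ h')) f hf.symm
  have huniq : ∀ {e f x y}, e ∈ R → f ∈ R → G.IsLink e x y → G.IsLink f x y → ¬ keep x y →
      e = f := by
    intro e f x y he hf hle hlf hxy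
    rcases trichotomous_of (WellOrderingRel (α := β)) e f with h | h | h
    · exact absurd h (hmin hf hlf hxy e hle)
    · exact h
    · exact absurd h (hmin he hle hxy f hlf)
  refine ⟨(G.restrict R).induce S, ⟨G.restrict R, ⟨⟨Graph.restrict_le, rfl⟩, ?_⟩, ?_⟩, rfl, ?_, ?_⟩
  · intro x y
    by_cases hxy : keep x y
    · exact Or.inl fun e he => by
        rw [Graph.restrict_isLink]
        exact ⟨⟨x, y, he, Or.inl hxy⟩, he⟩
    by_cases hex : ∃ e, G.IsLink e x y
    · right
      obtain ⟨e, he, hemin⟩ := (WellOrderingRel.isWellOrder (α := β)).wf.has_min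
        {e | G.IsLink e x y} hex
      have heR : e ∈ R := ⟨x, y, he, Or.inr hemin⟩
      refine ⟨e, by simpa using ⟨heR, he⟩, ?_⟩
      intro f hf
      rw [Graph.restrict_isLink] at hf
      exact huniq hf.1 heR hf.2 he hxy
    · exact Or.inl fun e he => absurd ⟨e, he⟩ hex
  · refine ⟨Graph.induce_le hS, ?_⟩
    intro e x y hl hx hy
    rw [Graph.induce_isLink]
    exact ⟨hl, hx, hy⟩
  · intro x hx y hy hxy e he
    rw [Graph.induce_isLink, Graph.restrict_isLink]
    exact ⟨⟨⟨x, y, he, Or.inl hxy⟩, he⟩, hx, hy⟩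
  · intro e x y hl hm
    by_contra hxy
    obtain ⟨f, x', y', hfe, hl', hf⟩ := hm
    rw [Graph.induce_isLink, Graph.restrict_isLink] at hl hl' hf
    apply hfe
    rcases hl.1.2.eq_and_eq_or_eq_and_eq hl'.1.2 with ⟨rfl, rfl⟩ | ⟨rfl, rfl⟩
    · exact huniq hf.1.1 hl.1.1 hf.1.2 hl.1.2 hxy
    · exact huniq hf.1.1 hl.1.1 hf.1.2.symm hl.1.2 hxy

lemma IsPIGraph.le (h : IsPIGraph H G) : H ≤ G := by
  obtain ⟨G', h1, h2⟩ := h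
  exact h2.le.trans h1.1.le

lemma IsPIGraph.adj (h : IsPIGraph H G) {x y : α} (hx : x ∈ V(H)) (hy : y ∈ V(H))
    (hxy : G.Adj x y) : H.Adj x y := by
  obtain ⟨G', h1, h2⟩ := h
  rw [h2.adj_congr hx hy]
  obtain ⟨e, he⟩ := hxy
  rcases h1.2 x y with h | ⟨f, hf, -⟩
  exacts [⟨e, h e he⟩, ⟨f, hf⟩]

lemma finite_labels (hV : V(H).Finite) (hE : E(H).Finite) : (labels H).Finite := by
  refine (hV.image _).union ((hE.subset ?_).image _)
  intro e he
  obtain ⟨x, y, hl⟩ := IsMultiple.exists_isLink he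
  exact hl.edge_mem

variable [DecidableEq α] [DecidableEq β] {A : Set (α ⊕ β)}

/-- A set of labels is admissible if it is contained in an even set of tokens. -/
lemma TokenOk.admissible (hH : (labels H).Finite) {J : Finset (α ⊕ β)} (hJ : TokenOk H A J)
    (hAJ : A ⊆ J)
    (hs : ∀ x ∈ V(H), (∀ e, H.Inc e x → ¬ IsMultiple H e) → Sum.inl x ∈ A)
    (hB : ∀ x y e, IsMultiple H e → H.IsLink e x y →
      ∃ f g, f ≠ g ∧ A ∩ Sum.inr '' {e | H.IsLink e x y} = {Sum.inr f, Sum.inr g}) :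
    Admissible H A := by
  have hAl : A ⊆ labels H := hAJ.trans hJ.subset
  refine (admissible_iff hH).2 ⟨hAl, hs, ?_, ?_⟩
  · intro B hBB
    obtain ⟨hB', x, y, rfl⟩ := id hBB
    obtain ⟨e, he⟩ := hB'.nonempty
    obtain ⟨f, g, hfg, h⟩ := hB x y e (hBB.isMultiple he) he
    rw [h]
    refine ⟨⟨_, Or.inl rfl⟩, ?_⟩
    rw [Set.ncard_pair (fun h => hfg (Sum.inr.inj h))]
    exact even_two
  · rw [isEven_iff hH hAl ⟨le_rfl, fun _ _ _ _ h => h⟩]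
    by_cases hne : (toTokens hH H).Nonempty
    · obtain ⟨r, hr⟩ := hne
      have hJX : J ⊆ toTokens hH H := by
        rintro (x | e) ht
        · exact (inl_mem_toTokens hH le_rfl).2 (inl_mem_labels.1 (hJ.subset ht))
        · have hm := inr_mem_labels.1 (hJ.subset ht)
          obtain ⟨x, y, hl⟩ := hm.exists_isLink
          exact (inr_mem_toTokens hH).2 ⟨hm, hl.edge_mem⟩
      have hzero : ∀ t ∉ J, weight A t = 0 := fun t ht => weight_of_notMem fun h => ht (hAJ h)
      -- All the weight lies in `J`, so the linking condition on tokens outside `J` is vacuous and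
      -- any root `r` will do.
      refine hJ.even.of_linked tokAdj_symm hJX hr (fun t _ htJ hw => absurd (hzero t htJ) hw) ?_
      rw [← Finset.sum_subset hJX fun t _ ht => hzero t ht]
      exact hJ.even.sum
    · rw [Finset.not_nonempty_iff_eq_empty.1 hne]
      exact isEvenSet_empty

end PIGraph
end EvenSubgraph

/-! ### At most one further neighbor of a bundle and an even set. -/

namespace EvenSubgraph

section Obstruction

lemma inter_image_eq_pair {α β : Type*} {A : Set (α ⊕ β)} {B : Set β} {a b : β} (ha : a ∈ B) (hb : b ∈ B) (haA : Sum.inr a ∈ A)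
    (hbA : Sum.inr b ∈ A) (h : ∀ e ∈ B, Sum.inr e ∈ A → e = a ∨ e = b) :
    A ∩ Sum.inr '' B = {Sum.inr a, Sum.inr b} := by
  ext t
  constructor
  · rintro ⟨ht, e, he, rfl⟩
    rcases h e he ht with rfl | rfl <;> simp
  · rintro (rfl | rfl)
    exacts [⟨haA, a, ha, rfl⟩, ⟨hbA, b, hb, rfl⟩]

lemma weight_coe {τ : Type*} [DecidableEq τ] {K : Finset τ} {t : τ} :
    weight (K : Set τ) t = if t ∈ K then 1 else 0 := by
  by_cases h : t ∈ K <;> simp [weight, h]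

variable {α β : Type*} [DecidableEq α] [DecidableEq β] {G H : Graph α β} {A : Set (α ⊕ β)}

lemma Linked.of_imp {τ : Type*} {Γ Γ' : τ → τ → Prop} {X : Finset τ} {s t : τ}
    [DecidableEq τ] (h : Linked Γ X s t) (hΓ : ∀ x ∈ X, ∀ y ∈ X, Γ x y → Γ' x y) :
    Linked Γ' X s t :=
  fun _ hC hsC => h _ ⟨hC.1, fun x hx y hy hxy => hC.2 x hx y hy (hΓ x (hC.1 hx) y hy hxy)⟩ hsC

lemma IsEvenSet.of_imp {τ : Type*} {Γ Γ' : τ → τ → Prop} {w w' : τ → ZMod 2} {X : Finset τ}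
    [DecidableEq τ] (h : IsEvenSet Γ w X) (hΓ : ∀ x ∈ X, ∀ y ∈ X, Γ x y → Γ' x y)
    (hw : ∀ x ∈ X, w' x = w x) : IsEvenSet Γ' w' X := by
  intro C hC
  rw [Finset.sum_congr rfl fun x hx => hw x (hC.1 hx)]
  exact h C ⟨hC.1, fun x hx y hy hxy => hC.2 x hx y hy (hΓ x (hC.1 hx) y hy hxy)⟩

/-- A criterion for a set of tokens of a graph with at most two bundles. -/
lemma TokenOk.of_bundles {u v x y : α}
    (hmul : ∀ e, IsMultiple H e → H.IsLink e u v ∨ H.IsLink e x y) {X : Finset (α ⊕ β)}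
    (hX : (X : Set (α ⊕ β)) ⊆ labels H)
    (h1 : ∀ e, Sum.inr e ∈ X → (H.IsLink e u v ∧ Sum.inl u ∈ X ∧ Sum.inl v ∈ X) ∨
      (H.IsLink e x y ∧ Sum.inl x ∈ X ∧ Sum.inl y ∈ X))
    (h2 : Sum.inl u ∈ X → Sum.inl v ∈ X → ∃ f, H.IsLink f u v ∧ Sum.inr f ∈ X)
    (h3 : Sum.inl x ∈ X → Sum.inl y ∈ X → ∃ f, H.IsLink f x y ∧ Sum.inr f ∈ X)
    (hev : IsEvenSet (tokAdj H) (weight A) X) : TokenOk H A X where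
  subset := hX
  mem_of_inc := by
    intro e z he hz
    rcases h1 e he with ⟨hl, hu, hv⟩ | ⟨hl, hu, hv⟩ <;>
    rcases hz.eq_or_eq_of_isLink hl with rfl | rfl <;> assumption
  exists_edge := by
    intro e a b he hl ha hb
    rcases hmul e he with h | h <;>
    rcases hl.eq_and_eq_or_eq_and_eq h with ⟨rfl, rfl⟩ | ⟨rfl, rfl⟩
    · exact h2 ha hb
    · obtain ⟨f, hf, hfX⟩ := h2 hb ha
      exact ⟨f, hf.symm, hfX⟩
    · exact h3 ha hb
    · obtain ⟨f, hf, hfX⟩ := h3 hb ha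
      exact ⟨f, hf.symm, hfX⟩
  even := hev

lemma finite_evenPoset (hH : (labels H).Finite) (hA : A ⊆ labels H) : Finite (EvenPoset H A) := by
  have hfin : Finite {X : Finset (α ⊕ β) // TokenOk H A X} := by
    refine Finite.of_injective (β := hH.toFinset.powerset)
      (fun X => ⟨X.1, Finset.mem_powerset.2 (X.2.subset_toFinset hH)⟩) ?_
    intro X Y h
    exact Subtype.ext (congrArg (fun Z => Z.1) h)
  exact Finite.of_equiv _ (evenPosetIso hH hA).symm.toEquiv

/-- In a graph of the family, the graph obtained from `W` by adding a bundle has at most one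
neighbor. -/
theorem IsGStar.uniqueNeighbor (hG : IsGStar G) : UniqueNeighbor G := by
  intro a u v ham hau W hWv hWev huW hvW s hs t ht hsW htW hsu hsv htu htv hls hlt
  by_contra hst
  have := hG.loopless
  have huv := hau.ne
  obtain ⟨b, hba, hbu⟩ : ∃ b, b ≠ a ∧ G.IsLink b u v := by
    obtain ⟨b, hb, hba⟩ := (ham.isBundle hau).1.exists_ne a
    exact ⟨b, hba, hb⟩
  -- the two neighbors
  set q : Bool → α := fun i => if i then s else t with hq
  have hqV : ∀ i, q i ∈ V(G) := by rintro (_ | _) <;> simpa [hq]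
  have hqW : ∀ i, Sum.inl (q i) ∉ W := by rintro (_ | _) <;> simpa [hq]
  have hqu : ∀ i, q i ≠ u := by rintro (_ | _) <;> simpa [hq]
  have hqv : ∀ i, q i ≠ v := by rintro (_ | _) <;> simpa [hq]
  have hqq : ∀ i, q i ≠ q (!i) := by
    rintro (_ | _)
    exacts [Ne.symm hst, hst]
  have hql : ∀ i, Linked (tokAdj G) ({Sum.inl u, Sum.inl v, Sum.inl (q i)} ∪ W) (Sum.inl u)
      (Sum.inl (q i)) := by
    rintro (_ | _)
    exacts [hlt, hls]
  have hqall : ∀ i j, q j = q i ∨ q j = q (!i) := by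
    intro i j
    cases i <;> cases j <;> simp
  clear_value q
  clear hls hlt hst hsW htW hsu hsv htu htv hs ht
  -- the subgraph
  set S : Set α := {z | Sum.inl z ∈ W ∨ z = u ∨ z = v ∨ ∃ i, z = q i} with hSdef
  have hSV : S ⊆ V(G) := by
    rintro z (hz | rfl | rfl | ⟨i, rfl⟩)
    · obtain ⟨z', hz', h⟩ := hWv _ hz
      rwa [Sum.inl.inj h]
    exacts [hau.left_mem, hau.right_mem, hqV i]
  -- Only the bundle between `u` and `v` survives. With all vertices and the two edges `a`, `b` as
  -- labels, the interval from `W` to `W ∪ {u, v, a, b, s, t}` is the obstruction, the two neighbors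
  -- playing the role of the `p` tokens.
  obtain ⟨H, hPI, hHV, hkeep, hmul⟩ := exists_isPIGraph G hSV
    (keep := fun x y => (x = u ∧ y = v) ∨ (x = v ∧ y = u)) (fun x y h => by tauto)
  have hHG := hPI.le
  have := Graph.Loopless.anti hHG
  have hH : (labels H).Finite := finite_labels (hG.finite_vertexSet.subset hHG.vertexSet_mono)
    (hG.finite_edgeSet.subset (Graph.IsSubgraph.edgeSet_mono hHG))
  have huS : u ∈ S := Or.inr (Or.inl rfl)
  have hvS : v ∈ S := Or.inr (Or.inr (Or.inl rfl))
  have hqS : ∀ i, q i ∈ S := fun i => Or.inr (Or.inr (Or.inr ⟨i, rfl⟩))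
  have hHa : H.IsLink a u v := hkeep u huS v hvS (Or.inl ⟨rfl, rfl⟩) a hau
  have hHb : H.IsLink b u v := hkeep u huS v hvS (Or.inl ⟨rfl, rfl⟩) b hbu
  have hma : IsMultiple H a := ⟨b, u, v, hba, hHa, hHb⟩
  have hmb : IsMultiple H b := hma.congr hHa hHb
  have hmuv : ∀ e, IsMultiple H e → H.IsLink e u v := by
    intro e he
    obtain ⟨x, y, hl⟩ := he.exists_isLink
    rcases hmul e x y hl he with ⟨rfl, rfl⟩ | ⟨rfl, rfl⟩
    exacts [hl, hl.symm]
  set A : Set (α ⊕ β) := Sum.inl '' S ∪ {Sum.inr a, Sum.inr b} with hA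
  have hAv : ∀ z ∈ S, Sum.inl z ∈ A := fun z hz => Or.inl ⟨z, hz, rfl⟩
  have haA : Sum.inr a ∈ A := Or.inr (Or.inl rfl)
  have hbA : Sum.inr b ∈ A := Or.inr (Or.inr rfl)
  have hWS : ∀ r ∈ W, ∃ z ∈ S, r = Sum.inl z := by
    intro r hr
    obtain ⟨z, -, rfl⟩ := hWv r hr
    exact ⟨z, Or.inl hr, rfl⟩
  have hWe : ∀ e, Sum.inr e ∉ W := by
    intro e he
    obtain ⟨z, -, h⟩ := hWS _ he
    cases h
  have hadj : ∀ X : Finset (α ⊕ β), (∀ r ∈ X, ∃ z ∈ S, r = Sum.inl z) → ∀ r ∈ X, ∀ r' ∈ X,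
      tokAdj G r r' → tokAdj H r r' := by
    intro X hX r hr r' hr' h
    obtain ⟨z, hz, rfl⟩ := hX r hr
    obtain ⟨z', hz', rfl⟩ := hX r' hr'
    exact hPI.adj (hHV ▸ hz) (hHV ▸ hz') h
  have hWL : (W : Set (α ⊕ β)) ⊆ labels H := by
    intro r hr
    obtain ⟨z, hz, rfl⟩ := hWS r hr
    exact inl_mem_labels.2 (hHV ▸ hz)
  have hWE : IsEvenSet (tokAdj H) (weight A) W := by
    refine hWev.of_imp (hadj W hWS) fun r hr => ?_
    obtain ⟨z, hz, rfl⟩ := hWS r hr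
    exact weight_of_mem (hAv z hz)
  have hmulor : ∀ e, IsMultiple H e → H.IsLink e u v ∨ H.IsLink e u v :=
    fun e he => Or.inl (hmuv e he)
  have hlu : Sum.inl u ∈ labels H := inl_mem_labels.2 (hHV ▸ huS)
  have hlv : Sum.inl v ∈ labels H := inl_mem_labels.2 (hHV ▸ hvS)
  have hlq : ∀ i, Sum.inl (q i) ∈ labels H := fun i => inl_mem_labels.2 (hHV ▸ hqS i)
  have hla : Sum.inr a ∈ labels H := inr_mem_labels.2 hma
  have hlb : Sum.inr b ∈ labels H := inr_mem_labels.2 hmb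
  have wu : weight A (Sum.inl u) = 1 := weight_of_mem (hAv u huS)
  have wv : weight A (Sum.inl v) = 1 := weight_of_mem (hAv v hvS)
  have wq : ∀ i, weight A (Sum.inl (q i)) = 1 := fun i => weight_of_mem (hAv _ (hqS i))
  have wa : weight A (Sum.inr a) = 1 := weight_of_mem haA
  have wb : weight A (Sum.inr b) = 1 := weight_of_mem hbA
  -- the bottom and the top of the interval
  have hW : TokenOk H A W := TokenOk.of_bundles hmulor hWL (fun e he => absurd he (hWe e))
    (fun h => absurd h huW) (fun h => absurd h huW) hWE
  set D : Finset (α ⊕ β) := {Sum.inl u, Sum.inl v, Sum.inr a, Sum.inr b, Sum.inl (q true),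
    Sum.inl (q false)} with hD
  have hqD : ∀ i, Sum.inl (q i) ∈ D := by rintro (_ | _) <;> simp [hD]
  have hDW : ∀ d ∈ D, d ∉ W := by
    simp [hD, huW, hvW, hWe, hqW]
  have hDsum : ∀ f : α ⊕ β → ZMod 2, ∑ d ∈ D, f d = f (Sum.inl u) + (f (Sum.inl v) +
      (f (Sum.inr a) + (f (Sum.inr b) + (f (Sum.inl (q true)) + f (Sum.inl (q false)))))) := by
    intro f
    have h1 := hqq true
    rw [Bool.not_true] at h1
    rw [hD, Finset.sum_insert (by simp [huv, (hqu _).symm]), Finset.sum_insert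
      (by simp [(hqv _).symm]), Finset.sum_insert (by simp [hba.symm]), Finset.sum_insert (by simp),
      Finset.sum_pair (by simpa using h1)]
  have hqlink : ∀ i X, {Sum.inl u, Sum.inl v, Sum.inl (q i)} ∪ W ⊆ X →
      Linked (tokAdj H) X (Sum.inl u) (Sum.inl (q i)) := by
    intro i X hX
    refine ((hql i).of_imp (hadj _ ?_)).mono hX (by simp)
    intro r hr
    simp only [Finset.mem_union, Finset.mem_insert, Finset.mem_singleton] at hr
    rcases hr with (rfl | rfl | rfl) | hr
    exacts [⟨u, huS, rfl⟩, ⟨v, hvS, rfl⟩, ⟨_, hqS i, rfl⟩, hWS r hr]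
  have hvlink : ∀ X : Finset (α ⊕ β), Sum.inl v ∈ X →
      Linked (tokAdj H) X (Sum.inl u) (Sum.inl v) := fun X hX => Linked.of_adj hHa.adj hX
  have halink : ∀ X : Finset (α ⊕ β), Sum.inr a ∈ X →
      Linked (tokAdj H) X (Sum.inl u) (Sum.inr a) :=
    fun X hX => Linked.of_adj ⟨hma, hHa.inc_left⟩ hX
  have hblink : ∀ X : Finset (α ⊕ β), Sum.inr b ∈ X →
      Linked (tokAdj H) X (Sum.inl u) (Sum.inr b) :=
    fun X hX => Linked.of_adj ⟨hmb, hHb.inc_left⟩ hX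
  have hJ : TokenOk H A (D ∪ W) := by
    refine TokenOk.of_bundles hmulor ?_ ?_ ?_ ?_ ?_
    · intro r hr
      simp only [hD, Finset.coe_union, Finset.coe_insert, Finset.coe_singleton, Set.mem_union,
        Set.mem_insert_iff, Set.mem_singleton_iff] at hr
      rcases hr with (rfl | rfl | rfl | rfl | rfl | rfl) | hr
      exacts [hlu, hlv, hla, hlb, hlq _, hlq _, hWL hr]
    · intro e he
      have : e = a ∨ e = b := by simpa [hD, hWe] using he
      left
      rcases this with rfl | rfl <;> simp [hD, hHa, hHb]
    · exact fun _ _ => ⟨a, hHa, by simp [hD]⟩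
    · exact fun _ _ => ⟨a, hHa, by simp [hD]⟩
    · refine hWE.of_linked tokAdj_symm Finset.subset_union_right (r := Sum.inl u) (by simp [hD]) ?_ ?_
      · intro r hr hrW _
        have hrD := (Finset.mem_union.1 hr).resolve_right hrW
        simp only [hD, Finset.mem_insert, Finset.mem_singleton] at hrD
        rcases hrD with rfl | rfl | rfl | rfl | rfl | rfl
        · exact Linked.refl
        · exact hvlink _ hr
        · exact halink _ hr
        · exact hblink _ hr
        · refine hqlink true _ (Finset.union_subset_union_left ?_)
          simp [hD, Finset.insert_subset_iff]
        · refine hqlink false _ (Finset.union_subset_union_left ?_)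
          simp [hD, Finset.insert_subset_iff]
      · rw [sum_union_of_even hWE hDW, hDsum, wu, wv, wa, wb, wq, wq]
        decide
  have hAJ : A ⊆ (D ∪ W : Finset (α ⊕ β)) := by
    rintro _ (⟨z, (hz | rfl | rfl | ⟨i, rfl⟩), rfl⟩ | rfl | rfl)
    · exact Finset.mem_coe.2 (Finset.mem_union_right _ hz)
    all_goals refine Finset.mem_coe.2 (Finset.mem_union_left _ ?_)
    · simp [hD]
    · simp [hD]
    · exact hqD i
    · simp [hD]
    · simp [hD]
  have hadm : Admissible H A := by
    refine hJ.admissible hH hAJ (fun z hz _ => hAv z (hHV ▸ hz)) ?_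
    intro x y e hm hl
    refine ⟨a, b, hba.symm, inter_image_eq_pair ?_ ?_ haA hbA ?_⟩
    · rcases (hmuv e hm).eq_and_eq_or_eq_and_eq hl with ⟨rfl, rfl⟩ | ⟨rfl, rfl⟩
      exacts [hHa, hHa.symm]
    · rcases (hmuv e hm).eq_and_eq_or_eq_and_eq hl with ⟨rfl, rfl⟩ | ⟨rfl, rfl⟩
      exacts [hHb, hHb.symm]
    · rintro f - (⟨z, -, h⟩ | h | h)
      · cases h
      · exact Or.inl (Sum.inr.inj h)
      · exact Or.inr (Sum.inr.inj h)
  have hAl : A ⊆ labels H := hadm.1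
  have := finite_evenPoset hH hAl
  refine not_shellable_of_bundle (evenPosetIso hH hAl) hW hJ Finset.subset_union_right
    (u := Sum.inl u) (v := Sum.inl v) (a := Sum.inr a) (b := Sum.inr b)
    (p := fun i => Sum.inl (q i)) hqW (fun i => Finset.mem_union_left _ (hqD i)) ?_ ?_ ?_ ?_ ?_ ?_
    (hG.shellable (H, A) ⟨hPI, hadm⟩)
  · intro K hK hWK hKJ
    have h1 := hK.even.sum
    rw [sum_between hWE hDW hWK hKJ, hDsum, wu, wv, wa, wb, wq, wq] at h1
    simp only [weight_coe]
    refine Eq.trans ?_ h1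
    simp only [← add_assoc]
  · rintro K hK (h | h)
    · exact ⟨hK.mem_of_inc a u h hHa.inc_left, hK.mem_of_inc a v h hHa.inc_right⟩
    · exact ⟨hK.mem_of_inc b u h hHb.inc_left, hK.mem_of_inc b v h hHb.inc_right⟩
  · intro K hK hKJ hu hv
    obtain ⟨f, hf, hfK⟩ := hK.exists_edge a u v hma hHa hu hv
    have : f = a ∨ f = b := by simpa [hD, hWe] using hKJ hfK
    rcases this with rfl | rfl
    exacts [Or.inl hfK, Or.inr hfK]
  · intro K hK hWK hKJ hu hv ha hb hi
    refine hKJ.antisymm (Finset.union_subset ?_ hWK)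
    simp [hD, Finset.insert_subset_iff, hu, hv, ha, hb, hi]
  · intro K hK hWK hKJ hu hv ha hb hi
    refine Finset.Subset.antisymm (fun r hr => ?_) hWK
    refine (Finset.mem_union.1 (hKJ hr)).resolve_left fun hrD => ?_
    simp only [hD, Finset.mem_insert, Finset.mem_singleton] at hrD
    rcases hrD with rfl | rfl | rfl | rfl | rfl | rfl
    exacts [hu hr, hv hr, ha hr, hb hr, hi _ hr, hi _ hr]
  · intro i
    -- a neighbor is linked to one of the two ends without using the other one
    obtain ⟨z, z', hz, hzz, hl⟩ : ∃ z z', ((z = u ∧ z' = v) ∨ (z = v ∧ z' = u)) ∧ z ≠ z' ∧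
        Linked (tokAdj H) ({Sum.inl z, Sum.inl (q i)} ∪ W) (Sum.inl z) (Sum.inl (q i)) := by
      by_contra! hno
      have hno' : ∀ z z', ((z = u ∧ z' = v) ∨ (z = v ∧ z' = u)) →
          ∀ r ∈ block (tokAdj H) (insert (Sum.inl z) W) (Sum.inl z),
            ¬ tokAdj H r (Sum.inl (q i)) := by
        intro z z' hz r hr hadj
        refine hno z z' hz (by rcases hz with ⟨rfl, rfl⟩ | ⟨rfl, rfl⟩; exacts [huv, huv.symm]) ?_
        have := (mem_block.1 hr).2.insert_of_adj (by simp) hadj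
        have heq : insert (Sum.inl (q i)) (insert (Sum.inl z) W) =
            ({Sum.inl z, Sum.inl (q i)} ∪ W : Finset (α ⊕ β)) := by ext; simp; tauto
        rwa [heq] at this
      have hbl : ∀ z z' : α, ∀ r ∈ block (tokAdj H) (insert (Sum.inl z) W) (Sum.inl z),
          ∀ r' ∈ ({Sum.inl u, Sum.inl v, Sum.inl (q i)} ∪ W : Finset (α ⊕ β)), tokAdj H r r' →
          r' ∈ block (tokAdj H) (insert (Sum.inl z) W) (Sum.inl z) ∨ r' = Sum.inl u ∨
            r' = Sum.inl v ∨ r' = Sum.inl (q i) := by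
        intro z z' r hr r' hr' hadj
        simp only [Finset.mem_union, Finset.mem_insert, Finset.mem_singleton] at hr'
        rcases hr' with h | h
        · exact Or.inr h
        · exact Or.inl (isClosedIn_block.2 r hr r' (Finset.mem_insert_of_mem h) hadj)
      -- If `q i` were reached through neither end alone, the union of the components of the two
      -- ends over `W` would be closed and would separate `u` from `q i`.
      set C := block (tokAdj H) (insert (Sum.inl u) W) (Sum.inl u) ∪
        block (tokAdj H) (insert (Sum.inl v) W) (Sum.inl v) with hC
      have huC : Sum.inl u ∈ C := by simp [hC, mem_block, Linked.refl]
      have hvC : Sum.inl v ∈ C := by simp [hC, mem_block, Linked.refl]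
      have hCsub : ∀ r ∈ C, r = Sum.inl u ∨ r = Sum.inl v ∨ r ∈ W := by
        intro r hr
        rcases Finset.mem_union.1 hr with h | h
        · have := (mem_block.1 h).1
          rw [Finset.mem_insert] at this
          tauto
        · have := (mem_block.1 h).1
          rw [Finset.mem_insert] at this
          tauto
      have hcl : IsClosedIn (tokAdj H) C ({Sum.inl u, Sum.inl v, Sum.inl (q i)} ∪ W) := by
        constructor
        · intro r hr
          have := hCsub r hr
          simp only [Finset.mem_union, Finset.mem_insert, Finset.mem_singleton]
          tauto
        · intro r hr r' hr' hadj
          rcases Finset.mem_union.1 hr with h | h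
          · rcases hbl u v r h r' hr' hadj with h' | rfl | rfl | rfl
            · exact Finset.mem_union_left _ h'
            · exact huC
            · exact hvC
            · exact absurd hadj (hno' u v (Or.inl ⟨rfl, rfl⟩) r h)
          · rcases hbl v u r h r' hr' hadj with h' | rfl | rfl | rfl
            · exact Finset.mem_union_right _ h'
            · exact huC
            · exact hvC
            · exact absurd hadj (hno' v u (Or.inr ⟨rfl, rfl⟩) r h)
      rcases hCsub _ (hqlink i _ subset_rfl C hcl huC) with h | h | h
      · exact hqu i (Sum.inl.inj h)
      · exact hqv i (Sum.inl.inj h)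
      · exact hqW i h
    have hzS : z ∈ S := by rcases hz with ⟨rfl, rfl⟩ | ⟨rfl, rfl⟩ <;> assumption
    have hzW : Sum.inl z ∉ W := by rcases hz with ⟨rfl, rfl⟩ | ⟨rfl, rfl⟩ <;> assumption
    have hzq : z ≠ q i := by
      rcases hz with ⟨rfl, rfl⟩ | ⟨rfl, rfl⟩
      exacts [(hqu i).symm, (hqv i).symm]
    have hzq' : z' ≠ q i := by
      rcases hz with ⟨rfl, rfl⟩ | ⟨rfl, rfl⟩
      exacts [(hqv i).symm, (hqu i).symm]
    have hzW' : Sum.inl z' ∉ W := by rcases hz with ⟨rfl, rfl⟩ | ⟨rfl, rfl⟩ <;> assumption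
    have hzm : Sum.inl z' ∉ ({Sum.inl z, Sum.inl (q i)} ∪ W : Finset (α ⊕ β)) := by
      simp [hzz.symm, hzq', hzW']
    have hnuv : ¬ (Sum.inl u ∈ ({Sum.inl z, Sum.inl (q i)} ∪ W : Finset (α ⊕ β)) ∧
        Sum.inl v ∈ ({Sum.inl z, Sum.inl (q i)} ∪ W : Finset (α ⊕ β))) := by
      rintro ⟨h1, h2⟩
      rcases hz with ⟨rfl, rfl⟩ | ⟨rfl, rfl⟩
      exacts [hzm h2, hzm h1]
    have hzuv : z = u ∨ z = v := hz.imp And.left And.left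
    have hMW : ∀ d ∈ ({Sum.inl u, Sum.inl v, Sum.inl (q i), Sum.inr a} : Finset (α ⊕ β)),
        d ∉ W := by simp [huW, hvW, hqW, hWe]
    -- The set `m` pairs the neighbor with the end it is linked to; `M` contains both ends, the
    -- neighbor and the edge `a`, four odd tokens.
    refine ⟨{Sum.inl z, Sum.inl (q i)} ∪ W, {Sum.inl u, Sum.inl v, Sum.inl (q i), Sum.inr a} ∪ W,
      ?_, ?_, Finset.subset_union_right, Finset.union_subset_union_left ?_,
      Finset.union_subset_union_left ?_, by simp, ?_, hnuv, by simp, by simp, by simp, ?_, ?_⟩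
    · refine TokenOk.of_bundles hmulor ?_ ?_ ?_ ?_ ?_
      · intro r hr
        simp only [Finset.coe_union, Finset.coe_insert, Finset.coe_singleton, Set.mem_union,
          Set.mem_insert_iff, Set.mem_singleton_iff] at hr
        rcases hr with (rfl | rfl) | hr
        exacts [inl_mem_labels.2 (hHV ▸ hzS), hlq i, hWL hr]
      · intro e he
        simp [hWe] at he
      · exact fun h1 h2 => absurd ⟨h1, h2⟩ hnuv
      · exact fun h1 h2 => absurd ⟨h1, h2⟩ hnuv
      · refine even_pair tokAdj_symm hWE hzW (hqW i) (by simpa using hzq) ?_ (fun _ => hl)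
        rw [wq, weight_of_mem (hAv z hzS)]
        decide
    · refine TokenOk.of_bundles hmulor ?_ ?_ ?_ ?_ ?_
      · intro r hr
        simp only [Finset.coe_union, Finset.coe_insert, Finset.coe_singleton, Set.mem_union,
          Set.mem_insert_iff, Set.mem_singleton_iff] at hr
        rcases hr with (rfl | rfl | rfl | rfl) | hr
        exacts [hlu, hlv, hlq i, hla, hWL hr]
      · intro e he
        have : e = a := by simpa [hWe] using he
        subst this
        simp [hHa]
      · exact fun _ _ => ⟨a, hHa, by simp⟩
      · exact fun _ _ => ⟨a, hHa, by simp⟩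
      · refine hWE.of_linked tokAdj_symm Finset.subset_union_right (r := Sum.inl u) (by simp) ?_ ?_
        · intro r hr hrW _
          have hrD := (Finset.mem_union.1 hr).resolve_right hrW
          simp only [Finset.mem_insert, Finset.mem_singleton] at hrD
          rcases hrD with rfl | rfl | rfl | rfl
          · exact Linked.refl
          · exact hvlink _ hr
          · refine hqlink i _ (Finset.union_subset_union_left ?_)
            simp [Finset.insert_subset_iff]
          · exact halink _ hr
        · rw [sum_union_of_even hWE hMW, Finset.sum_insert (by simp [huv, (hqu _).symm]),
            Finset.sum_insert (by simp [(hqv _).symm]), Finset.sum_pair (by simp), wu, wv, wa, wq]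
          decide
    · rcases hzuv with rfl | rfl <;> simp [Finset.insert_subset_iff]
    · simp [Finset.insert_subset_iff, hD]
      cases i <;> simp
    · simp [hqu, hqv, (hqq i).symm, hqW]
    · intro K hK hWK hi hu hv
      rcases hzuv with rfl | rfl <;> simp [Finset.insert_subset_iff, hu, hv, hi, hWK]
    · intro K hK hKJ ha hb hi r hr
      rcases Finset.mem_union.1 (hKJ hr) with hrD | hrW
      · have hqr : ∀ j, r = Sum.inl (q j) → r = Sum.inl (q i) := by
          rintro j rfl
          rcases hqall i j with h | h
          · rw [h]
          · rw [h] at hr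
            exact absurd hr hi
        simp only [hD, Finset.mem_insert, Finset.mem_singleton] at hrD
        rcases hrD with h | h | rfl | rfl | h | h
        · simp [h]
        · simp [h]
        · exact absurd hr ha
        · exact absurd hr hb
        · simp [hqr _ h]
        · simp [hqr _ h]
      · exact Finset.mem_union_right _ hrW

end Obstruction
end EvenSubgraph

/-! ### At most one bundle in each component. -/

namespace EvenSubgraph

section Obstruction

variable {α β : Type*} [DecidableEq α] [DecidableEq β] {G H : Graph α β} {A : Set (α ⊕ β)}

lemma linked_block {τ : Type*} [DecidableEq τ] {Γ : τ → τ → Prop} {X : Finset τ} {s t : τ}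
    (h : Linked Γ X s t) : Linked Γ (block Γ X s) s t := by
  intro C hC hsC
  exact h C ⟨hC.1.trans isClosedIn_block.1, fun x hx y hy hxy =>
    hC.2 x hx y (isClosedIn_block.2 x (hC.1 hx) y hy hxy) hxy⟩ hsC

/-- There is a subset of `I` which contains all elements but possibly `x` and has even size. -/
lemma exists_even_subset {τ : Type*} [DecidableEq τ] (I : Finset τ) {x : τ} (hx : x ∈ I) :
    ∃ A : Set τ, A ⊆ I ∧ (∀ r ∈ I, r ≠ x → r ∈ A) ∧ ∑ r ∈ I, weight A r = 0 := by
  by_cases h : ∑ r ∈ I, weight (I : Set τ) r = 0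
  · exact ⟨I, subset_rfl, fun r hr _ => hr, h⟩
  refine ⟨(I.erase x : Finset τ), Finset.coe_subset.2 (Finset.erase_subset _ _),
    fun r hr hrx => Finset.mem_coe.2 (Finset.mem_erase.2 ⟨hrx, hr⟩), ?_⟩
  rw [← Finset.add_sum_erase I _ hx, weight_of_mem (Finset.mem_coe.2 hx)] at h
  rw [← Finset.add_sum_erase I _ hx, weight_of_notMem (by simp), zero_add]
  have heq : ∑ r ∈ I.erase x, weight ((I.erase x : Finset τ) : Set τ) r =
      ∑ r ∈ I.erase x, weight (I : Set τ) r := by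
    refine Finset.sum_congr rfl fun r hr => ?_
    rw [weight_of_mem (Finset.mem_coe.2 hr),
      weight_of_mem (Finset.mem_coe.2 (Finset.mem_of_mem_erase hr))]
  rw [heq]
  revert h
  generalize ∑ r ∈ I.erase x, weight (I : Set τ) r = c
  revert c; decide

/-- Two bundles joined by a connected set `I`, which contains an end of one of them. -/
theorem IsGStar.false_of_two_bundles (hG : IsGStar G) {u v x y : α} {a b : β} {p : Bool → β}
    (hba : b ≠ a) (hau : G.IsLink a u v) (hbu : G.IsLink b u v) (hpp : p true ≠ p false)
    (hpl : ∀ i, G.IsLink (p i) x y) {I : Finset (α ⊕ β)} (hIv : ∀ r ∈ I, ∃ z ∈ V(G), r = Sum.inl z)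
    (hxI : Sum.inl x ∈ I) (huI : Sum.inl u ∉ I) (hvI : Sum.inl v ∉ I) (hyI : Sum.inl y ∉ I)
    (hyu : y ≠ u) (hlink : ∀ r ∈ I, Linked (tokAdj G) I (Sum.inl x) r)
    (hadj : ∃ r ∈ I, tokAdj G r (Sum.inl v)) : False := by
  have := hG.loopless
  have huv := hau.ne
  have hxu : x ≠ u := fun h => huI (h ▸ hxI)
  have hxv : x ≠ v := fun h => hvI (h ▸ hxI)
  have hpi : ∀ i, p i ≠ p (!i) := by
    rintro (_ | _)
    exacts [hpp.symm, hpp]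
  have hpall : ∀ i j, p j = p i ∨ p j = p (!i) := by
    intro i j
    cases i <;> cases j <;> simp
  -- the subgraph
  set S : Set α := {z | Sum.inl z ∈ I ∨ z = u ∨ z = v ∨ z = y} with hSdef
  have hSV : S ⊆ V(G) := by
    rintro z (hz | rfl | rfl | rfl)
    · obtain ⟨z', hz', h⟩ := hIv _ hz
      rwa [Sum.inl.inj h]
    exacts [hau.left_mem, hau.right_mem, (hpl true).right_mem]
  obtain ⟨H, hPI, hHV, hkeep, hmul⟩ := exists_isPIGraph G hSV
    (keep := fun z z' => (z = u ∧ z' = v) ∨ (z = v ∧ z' = u) ∨ (z = x ∧ z' = y) ∨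
      (z = y ∧ z' = x)) (fun x y h => by tauto)
  have hHG := hPI.le
  have := Graph.Loopless.anti hHG
  have hH : (labels H).Finite := finite_labels (hG.finite_vertexSet.subset hHG.vertexSet_mono)
    (hG.finite_edgeSet.subset (Graph.IsSubgraph.edgeSet_mono hHG))
  have huS : u ∈ S := Or.inr (Or.inl rfl)
  have hvS : v ∈ S := Or.inr (Or.inr (Or.inl rfl))
  have hyS : y ∈ S := Or.inr (Or.inr (Or.inr rfl))
  have hxS : x ∈ S := Or.inl hxI
  have hHa : H.IsLink a u v := hkeep u huS v hvS (Or.inl ⟨rfl, rfl⟩) a hau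
  have hHb : H.IsLink b u v := hkeep u huS v hvS (Or.inl ⟨rfl, rfl⟩) b hbu
  have hHp : ∀ i, H.IsLink (p i) x y := fun i =>
    hkeep x hxS y hyS (Or.inr (Or.inr (Or.inl ⟨rfl, rfl⟩))) _ (hpl i)
  have hma : IsMultiple H a := ⟨b, u, v, hba, hHa, hHb⟩
  have hmb : IsMultiple H b := hma.congr hHa hHb
  have hmp : ∀ i, IsMultiple H (p i) := fun i => ⟨p (!i), x, y, (hpi i).symm, hHp i, hHp _⟩
  have hmulor : ∀ e, IsMultiple H e → H.IsLink e u v ∨ H.IsLink e x y := by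
    intro e he
    obtain ⟨z, z', hl⟩ := he.exists_isLink
    rcases hmul e z z' hl he with ⟨rfl, rfl⟩ | ⟨rfl, rfl⟩ | ⟨rfl, rfl⟩ | ⟨rfl, rfl⟩
    exacts [Or.inl hl, Or.inl hl.symm, Or.inr hl, Or.inr hl.symm]
  have hnot : ∀ e, H.IsLink e u v → ¬ H.IsLink e x y := by
    intro e h1 h2
    rcases h2.left_eq_or_eq h1 with h | h
    exacts [hxu h, hxv h]
  have hap : ∀ i, a ≠ p i := fun i h => hnot a hHa (h ▸ hHp i)
  have hbp : ∀ i, b ≠ p i := fun i h => hnot b hHb (h ▸ hHp i)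
  have hIS : ∀ r ∈ I, ∃ z ∈ S, r = Sum.inl z := by
    intro r hr
    obtain ⟨z, -, rfl⟩ := hIv r hr
    exact ⟨z, Or.inl hr, rfl⟩
  have hIe : ∀ e, Sum.inr e ∉ I := by
    intro e he
    obtain ⟨z, -, h⟩ := hIS _ he
    cases h
  -- the labels
  obtain ⟨A₁, hA₁I, hIA₁, hsum⟩ := exists_even_subset I hxI
  set A : Set (α ⊕ β) := A₁ ∪ {Sum.inl u, Sum.inl v, Sum.inr a, Sum.inr b, Sum.inr (p true),
    Sum.inr (p false)} with hA
  have wu : weight A (Sum.inl u) = 1 := weight_of_mem (by simp [hA])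
  have wv : weight A (Sum.inl v) = 1 := weight_of_mem (by simp [hA])
  have wa : weight A (Sum.inr a) = 1 := weight_of_mem (by simp [hA])
  have wb : weight A (Sum.inr b) = 1 := weight_of_mem (by simp [hA])
  have wp : ∀ i, weight A (Sum.inr (p i)) = 1 := by
    rintro (_ | _) <;> exact weight_of_mem (by simp [hA])
  -- The end `y` lies on the second bundle, so admissibility allows leaving it out of `A`; it may
  -- however coincide with `v`, which has weight 1.
  have wy : y = v ∨ weight A (Sum.inl y) = 0 := by
    by_cases hyv : y = v
    · exact Or.inl hyv
    · refine Or.inr (weight_of_notMem ?_)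
      have : Sum.inl y ∉ A₁ := fun h => hyI (Finset.mem_coe.1 (hA₁I h))
      simp [hA, this, hyu, hyv]
  have hIL : (I : Set (α ⊕ β)) ⊆ labels H := by
    intro r hr
    obtain ⟨z, hz, rfl⟩ := hIS r hr
    exact inl_mem_labels.2 (hHV ▸ hz)
  have hlu : Sum.inl u ∈ labels H := inl_mem_labels.2 (hHV ▸ huS)
  have hlv : Sum.inl v ∈ labels H := inl_mem_labels.2 (hHV ▸ hvS)
  have hly : Sum.inl y ∈ labels H := inl_mem_labels.2 (hHV ▸ hyS)
  have hla : Sum.inr a ∈ labels H := inr_mem_labels.2 hma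
  have hlb : Sum.inr b ∈ labels H := inr_mem_labels.2 hmb
  have hlp : ∀ i, Sum.inr (p i) ∈ labels H := fun i => inr_mem_labels.2 (hmp i)
  -- the links
  have hIlink : ∀ X, I ⊆ X → ∀ r ∈ I, Linked (tokAdj H) X (Sum.inl x) r := by
    intro X hX r hr
    refine ((hlink r hr).of_imp fun s hs t ht h => ?_).mono hX hxI
    obtain ⟨z, hz, rfl⟩ := hIS s hs
    obtain ⟨z', hz', rfl⟩ := hIS t ht
    exact hPI.adj (hHV ▸ hz) (hHV ▸ hz') h
  have hvlink : ∀ X, I ⊆ X → Sum.inl v ∈ X → Linked (tokAdj H) X (Sum.inl x) (Sum.inl v) := by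
    intro X hX hv
    obtain ⟨r, hr, hrv⟩ := hadj
    refine (hIlink X hX r hr).trans (Linked.of_adj ?_ hv)
    obtain ⟨z, hz, rfl⟩ := hIS r hr
    exact hPI.adj (hHV ▸ hz) (hHV ▸ hvS) hrv
  have hulink : ∀ X, I ⊆ X → Sum.inl v ∈ X → Sum.inl u ∈ X →
      Linked (tokAdj H) X (Sum.inl x) (Sum.inl u) :=
    fun X hX hv hu => (hvlink X hX hv).trans (Linked.of_adj hHa.symm.adj hu)
  have halink : ∀ X, I ⊆ X → Sum.inl v ∈ X → Sum.inr a ∈ X →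
      Linked (tokAdj H) X (Sum.inl x) (Sum.inr a) :=
    fun X hX hv ha => (hvlink X hX hv).trans (Linked.of_adj ⟨hma, hHa.inc_right⟩ ha)
  have hblink : ∀ X, I ⊆ X → Sum.inl v ∈ X → Sum.inr b ∈ X →
      Linked (tokAdj H) X (Sum.inl x) (Sum.inr b) :=
    fun X hX hv hb => (hvlink X hX hv).trans (Linked.of_adj ⟨hmb, hHb.inc_right⟩ hb)
  have hylink : ∀ X : Finset (α ⊕ β), Sum.inl y ∈ X →
      Linked (tokAdj H) X (Sum.inl x) (Sum.inl y) := fun X hy => Linked.of_adj (hHp true).adj hy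
  have hplink : ∀ i (X : Finset (α ⊕ β)), Sum.inr (p i) ∈ X →
      Linked (tokAdj H) X (Sum.inl x) (Sum.inr (p i)) :=
    fun i X hp => Linked.of_adj ⟨hmp i, (hHp i).inc_left⟩ hp
  have hIE : IsEvenSet (tokAdj H) (weight A) I := by
    refine isEvenSet_empty.of_linked tokAdj_symm (Finset.empty_subset _) hxI
      (fun r hr _ _ => hIlink I subset_rfl r hr) ?_
    rw [← hsum]
    refine Finset.sum_congr rfl fun r hr => ?_
    have h1 : r ∉ ({Sum.inl u, Sum.inl v, Sum.inr a, Sum.inr b, Sum.inr (p true),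
        Sum.inr (p false)} : Set (α ⊕ β)) := by
      rintro (rfl | rfl | rfl | rfl | rfl | rfl)
      exacts [huI hr, hvI hr, hIe _ hr, hIe _ hr, hIe _ hr, hIe _ hr]
    by_cases h : r ∈ A₁
    · rw [weight_of_mem h, weight_of_mem (A := A) (show r ∈ A from Or.inl h)]
    · rw [weight_of_notMem h,
        weight_of_notMem (A := A) (show r ∉ A from fun h' => h'.elim h h1)]
  -- the bottom and the top of the interval
  have hI : TokenOk H A I := TokenOk.of_bundles hmulor hIL (fun e he => absurd he (hIe e))
    (fun h => absurd h huI) (fun _ h => absurd h hyI) hIE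
  set D : Finset (α ⊕ β) := {Sum.inl u, Sum.inl v, Sum.inr a, Sum.inr b, Sum.inr (p true),
    Sum.inr (p false)} with hD
  have hpD : ∀ i, Sum.inr (p i) ∈ D := by rintro (_ | _) <;> simp [hD]
  have hDI : ∀ d ∈ insert (Sum.inl y) D, d ∉ I := by
    simp [hD, huI, hvI, hIe, hyI]
  -- Inserting `y` never changes the sum: either `y` is `v`, already in `D`, or it contributes zero.
  have hDsum : ∀ f : α ⊕ β → ZMod 2, (y = v ∨ f (Sum.inl y) = 0) →
      ∑ d ∈ insert (Sum.inl y) D, f d = f (Sum.inl u) + (f (Sum.inl v) +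
      (f (Sum.inr a) + (f (Sum.inr b) + (f (Sum.inr (p true)) + f (Sum.inr (p false)))))) := by
    intro f hf
    rw [Finset.sum_insert_of_eq_zero_if_notMem, hD, Finset.sum_insert (by simp [huv]),
      Finset.sum_insert (by simp), Finset.sum_insert (by simp [hba.symm, hap]),
      Finset.sum_insert (by simp [hbp]), Finset.sum_pair (by simpa using hpp)]
    intro hy
    exact hf.resolve_left fun h => hy (by simp [hD, h])
  have hJ : TokenOk H A (insert (Sum.inl y) D ∪ I) := by
    refine TokenOk.of_bundles hmulor ?_ ?_ ?_ ?_ ?_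
    · intro r hr
      simp only [hD, Finset.coe_union, Finset.coe_insert, Finset.coe_singleton, Set.mem_union,
        Set.mem_insert_iff, Set.mem_singleton_iff] at hr
      rcases hr with (rfl | rfl | rfl | rfl | rfl | rfl | rfl) | hr
      exacts [hly, hlu, hlv, hla, hlb, hlp _, hlp _, hIL hr]
    · intro e he
      have : e = a ∨ e = b ∨ e = p true ∨ e = p false := by simpa [hD, hIe] using he
      rcases this with rfl | rfl | rfl | rfl
      · left; simp [hD, hHa]
      · left; simp [hD, hHb]
      · right; simp [hHp, hxI]
      · right; simp [hHp, hxI]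
    · exact fun _ _ => ⟨a, hHa, by simp [hD]⟩
    · exact fun _ _ => ⟨p true, hHp true, by simp [hD]⟩
    · refine hIE.of_linked tokAdj_symm Finset.subset_union_right (r := Sum.inl x) (by simp [hxI])
        ?_ ?_
      · intro r hr hrI _
        have hrD := (Finset.mem_union.1 hr).resolve_right hrI
        have hvJ : Sum.inl v ∈ insert (Sum.inl y) D ∪ I := by simp [hD]
        simp only [hD, Finset.mem_insert, Finset.mem_singleton] at hrD
        rcases hrD with rfl | rfl | rfl | rfl | rfl | rfl | rfl
        · exact hylink _ hr
        · exact hulink _ Finset.subset_union_right hvJ hr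
        · exact hvlink _ Finset.subset_union_right hr
        · exact halink _ Finset.subset_union_right hvJ hr
        · exact hblink _ Finset.subset_union_right hvJ hr
        · exact hplink _ _ hr
        · exact hplink _ _ hr
      · rw [sum_union_of_even hIE hDI, hDsum _ wy, wu, wv, wa, wb, wp, wp]
        decide
  have hAJ : A ⊆ (insert (Sum.inl y) D ∪ I : Finset (α ⊕ β)) := by
    rintro r (hr | hr)
    · exact Finset.mem_coe.2 (Finset.mem_union_right _ (Finset.mem_coe.1 (hA₁I hr)))
    · refine Finset.mem_coe.2 (Finset.mem_union_left _ (Finset.mem_insert_of_mem ?_))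
      rcases hr with rfl | rfl | rfl | rfl | rfl | rfl <;> simp [hD]
  have hAe : ∀ e, Sum.inr e ∈ A → e = a ∨ e = b ∨ e = p true ∨ e = p false := by
    intro e he
    have := Finset.mem_coe.1 (hAJ he)
    simpa [hD, hIe] using this
  have hadm : Admissible H A := by
    refine hJ.admissible hH hAJ ?_ ?_
    · intro z hz hzs
      rw [hHV] at hz
      rcases hz with hz | rfl | rfl | rfl
      · refine Or.inl (hIA₁ _ hz ?_)
        -- The only vertex of `I` possibly missing from `A₁` is `x`, which is incident to a multiple
        -- edge.
        intro h
        rw [Sum.inl.inj h] at hzs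
        exact hzs _ (hHp true).inc_left (hmp true)
      · exact absurd hma (hzs _ hHa.inc_left)
      · exact absurd hma (hzs _ hHa.inc_right)
      · exact absurd (hmp true) (hzs _ (hHp true).inc_right)
    · intro z z' e hm hl
      have hset : ∀ {s t}, H.IsLink e s t → {f | H.IsLink f z z'} = {f | H.IsLink f s t} := by
        intro s t h
        ext f
        rcases h.eq_and_eq_or_eq_and_eq hl with ⟨rfl, rfl⟩ | ⟨rfl, rfl⟩
        · exact Iff.rfl
        · exact Graph.isLink_comm
      rcases hmulor e hm with h | h
      · rw [hset h]
        refine ⟨a, b, hba.symm, inter_image_eq_pair hHa hHb (by simp [hA]) (by simp [hA]) ?_⟩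
        intro f hf hfA
        rcases hAe f hfA with h | h | rfl | rfl
        exacts [Or.inl h, Or.inr h, absurd (hHp _) (hnot _ hf), absurd (hHp _) (hnot _ hf)]
      · rw [hset h]
        refine ⟨p true, p false, hpp, inter_image_eq_pair (hHp _) (hHp _) (by simp [hA])
          (by simp [hA]) ?_⟩
        intro f hf hfA
        rcases hAe f hfA with rfl | rfl | h | h
        exacts [absurd hf (hnot _ hHa), absurd hf (hnot _ hHb), Or.inl h, Or.inr h]
  have hAl : A ⊆ labels H := hadm.1
  have := finite_evenPoset hH hAl
  refine not_shellable_of_bundle (evenPosetIso hH hAl) hI hJ Finset.subset_union_right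
    (u := Sum.inl u) (v := Sum.inl v) (a := Sum.inr a) (b := Sum.inr b)
    (p := fun i => Sum.inr (p i)) (fun i => hIe _)
    (fun i => Finset.mem_union_left _ (Finset.mem_insert_of_mem (hpD i))) ?_ ?_ ?_ ?_ ?_ ?_
    (hG.shellable (H, A) ⟨hPI, hadm⟩)
  · intro K hK hIK hKJ
    have h1 := hK.even.sum
    rw [sum_between hIE hDI hIK hKJ, hDsum _ (wy.imp_right fun h => by rw [h, ite_self]), wu, wv,
      wa, wb, wp, wp] at h1
    simp only [weight_coe]
    refine Eq.trans ?_ h1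
    simp only [← add_assoc]
  · rintro K hK (h | h)
    · exact ⟨hK.mem_of_inc a u h hHa.inc_left, hK.mem_of_inc a v h hHa.inc_right⟩
    · exact ⟨hK.mem_of_inc b u h hHb.inc_left, hK.mem_of_inc b v h hHb.inc_right⟩
  · intro K hK hKJ hu hv
    obtain ⟨f, hf, hfK⟩ := hK.exists_edge a u v hma hHa hu hv
    have : f = a ∨ f = b ∨ f = p true ∨ f = p false := by simpa [hD, hIe] using hKJ hfK
    rcases this with rfl | rfl | rfl | rfl
    exacts [Or.inl hfK, Or.inr hfK, absurd (hHp _) (hnot _ hf), absurd (hHp _) (hnot _ hf)]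
  · intro K hK hIK hKJ hu hv ha hb hi
    refine hKJ.antisymm (Finset.union_subset ?_ hIK)
    have hy := hK.mem_of_inc (p true) y (hi true) (hHp true).inc_right
    simp [hD, Finset.insert_subset_iff, hu, hv, ha, hb, hi, hy]
  · intro K hK hIK hKJ hu hv ha hb hi
    refine Finset.Subset.antisymm (fun r hr => ?_) hIK
    refine (Finset.mem_union.1 (hKJ hr)).resolve_left fun hrD => ?_
    simp only [hD, Finset.mem_insert, Finset.mem_singleton] at hrD
    rcases hrD with rfl | rfl | rfl | rfl | rfl | rfl | rfl
    · obtain ⟨f, hf, hfK⟩ := hK.exists_edge (p true) x y (hmp true) (hHp true) (hIK hxI) hr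
      have : f = a ∨ f = b ∨ f = p true ∨ f = p false := by simpa [hD, hIe] using hKJ hfK
      rcases this with rfl | rfl | rfl | rfl
      exacts [ha hfK, hb hfK, hi _ hfK, hi _ hfK]
    · exact hu hr
    · exact hv hr
    · exact ha hr
    · exact hb hr
    · exact hi _ hr
    · exact hi _ hr
  · intro i
    have hum : Sum.inl u ∉ (insert (Sum.inl y) {Sum.inr (p i), Sum.inl v} ∪ I : Finset (α ⊕ β)) := by
      simp [huI, hyu.symm, huv]
    have hmI : ∀ d ∈ (insert (Sum.inl y) {Sum.inr (p i), Sum.inl v} : Finset (α ⊕ β)), d ∉ I := by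
      simp [hyI, hIe, hvI]
    have hMI : ∀ d ∈ (insert (Sum.inl y) {Sum.inl u, Sum.inl v, Sum.inr (p i), Sum.inr a} :
        Finset (α ⊕ β)), d ∉ I := by simp [huI, hvI, hyI, hIe]
    -- The edge `p i` requires its end `y`, and `v`, linked to `x` through `I`, restores parity. The
    -- larger set also has `u` and the edge `a`; both sets omit the other edge `p (!i)`.
    refine ⟨insert (Sum.inl y) {Sum.inr (p i), Sum.inl v} ∪ I,
      insert (Sum.inl y) {Sum.inl u, Sum.inl v, Sum.inr (p i), Sum.inr a} ∪ I, ?_, ?_,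
      Finset.subset_union_right, Finset.union_subset_union_left ?_,
      Finset.union_subset_union_left ?_, by simp, ?_, fun h => hum h.1, by simp, by simp, by simp,
      ?_, ?_⟩
    · refine TokenOk.of_bundles hmulor ?_ ?_ ?_ ?_ ?_
      · intro r hr
        simp only [Finset.coe_union, Finset.coe_insert, Finset.coe_singleton, Set.mem_union,
          Set.mem_insert_iff, Set.mem_singleton_iff] at hr
        rcases hr with (rfl | rfl | rfl) | hr
        exacts [hly, hlp i, hlv, hIL hr]
      · intro e he
        have : e = p i := by simpa [hIe] using he
        subst this
        right
        simp [hHp, hxI]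
      · exact fun h => absurd h hum
      · exact fun _ _ => ⟨p i, hHp i, by simp⟩
      · refine hIE.of_linked tokAdj_symm Finset.subset_union_right (r := Sum.inl x) (by simp [hxI])
          ?_ ?_
        · intro r hr hrI _
          have hrD := (Finset.mem_union.1 hr).resolve_right hrI
          simp only [Finset.mem_insert, Finset.mem_singleton] at hrD
          rcases hrD with rfl | rfl | rfl
          · exact hylink _ hr
          · exact hplink _ _ hr
          · exact hvlink _ Finset.subset_union_right hr
        · rw [sum_union_of_even hIE hmI, Finset.sum_insert_of_eq_zero_if_notMem,
            Finset.sum_pair (by simp), wv, wp]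
          · decide
          · intro hy
            exact wy.resolve_left fun h => hy (by simp [h])
    · refine TokenOk.of_bundles hmulor ?_ ?_ ?_ ?_ ?_
      · intro r hr
        simp only [Finset.coe_union, Finset.coe_insert, Finset.coe_singleton, Set.mem_union,
          Set.mem_insert_iff, Set.mem_singleton_iff] at hr
        rcases hr with (rfl | rfl | rfl | rfl | rfl) | hr
        exacts [hly, hlu, hlv, hlp i, hla, hIL hr]
      · intro e he
        have : e = p i ∨ e = a := by simpa [hIe] using he
        rcases this with rfl | rfl
        · right
          simp [hHp, hxI]
        · left
          simp [hHa]
      · exact fun _ _ => ⟨a, hHa, by simp⟩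
      · exact fun _ _ => ⟨p i, hHp i, by simp⟩
      · refine hIE.of_linked tokAdj_symm Finset.subset_union_right (r := Sum.inl x) (by simp [hxI])
          ?_ ?_
        · intro r hr hrI _
          have hrD := (Finset.mem_union.1 hr).resolve_right hrI
          simp only [Finset.mem_insert, Finset.mem_singleton] at hrD
          rcases hrD with rfl | rfl | rfl | rfl | rfl
          · exact hylink _ hr
          · exact hulink _ Finset.subset_union_right (by simp) hr
          · exact hvlink _ Finset.subset_union_right hr
          · exact hplink _ _ hr
          · exact halink _ Finset.subset_union_right (by simp) hr
        · rw [sum_union_of_even hIE hMI, Finset.sum_insert_of_eq_zero_if_notMem,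
            Finset.sum_insert (by simp [huv]), Finset.sum_insert (by simp),
            Finset.sum_pair (by simpa using (hap i).symm), wu, wv, wa, wp]
          · decide
          · intro hy
            exact wy.resolve_left fun h => hy (by simp [h])
    · simp [Finset.insert_subset_iff]
    · refine Finset.insert_subset_insert _ ?_
      have := hpD i
      simp only [Finset.insert_subset_iff, Finset.singleton_subset_iff, this]
      simp [hD]
    · simp [(hpi i).symm, (hap _).symm, hIe]
    · intro K hK hIK hi hu hv
      have hy := hK.mem_of_inc (p i) y hi (hHp i).inc_right
      simp [Finset.insert_subset_iff, hv, hi, hIK, hy]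
    · intro K hK hKJ ha hb hi r hr
      rcases Finset.mem_union.1 (hKJ hr) with hrD | hrI
      · have hpr : ∀ j, r = Sum.inr (p j) → r = Sum.inr (p i) := by
          rintro j rfl
          rcases hpall i j with h | h
          · rw [h]
          · rw [h] at hr
            exact absurd hr hi
        simp only [hD, Finset.mem_insert, Finset.mem_singleton] at hrD
        rcases hrD with h | h | h | rfl | rfl | h | h
        · simp [h]
        · simp [h]
        · simp [h]
        · exact absurd hr ha
        · exact absurd hr hb
        · simp [hpr _ h]
        · simp [hpr _ h]
      · exact Finset.mem_union_right _ hrI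

lemma IsMultiple.exists_pair {e : β} {x y : α} (he : IsMultiple G e) (hl : G.IsLink e x y) :
    ∃ p : Bool → β, p true ≠ p false ∧ ∀ i, G.IsLink (p i) x y := by
  obtain ⟨f, hf, hfe⟩ := (he.isBundle hl).1.exists_ne e
  refine ⟨fun i => if i then f else e, by simpa using hfe, ?_⟩
  rintro (_ | _)
  exacts [hl, hf]

/-- Links through tokens come from walks in the graph: the component of an end of `e` in the token
graph is described by `block_toTokens`. -/
lemma reachable_of_linked (hH : (labels H).Finite) {e f : β} (he : IsMultiple H e)
    (hf : IsMultiple H f) (h : Linked (tokAdj H) hH.toFinset (Sum.inr e) (Sum.inr f))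
    {u v x y : α} (hu : H.IsLink e u v) (hx : H.IsLink f x y) :
    Relation.ReflTransGen H.Adj u x := by
  have heq : toTokens hH H = hH.toFinset := by
    ext (z | g)
    · rw [inl_mem_toTokens hH le_rfl, hH.mem_toFinset, inl_mem_labels]
    · rw [inr_mem_toTokens, hH.mem_toFinset, inr_mem_labels, and_iff_left_iff_imp]
      intro hg
      obtain ⟨z, z', hl⟩ := hg.exists_isLink
      exact hl.edge_mem
  have hfb : Sum.inr f ∈ block (tokAdj H) (toTokens hH H) (Sum.inl u) := by
    rw [heq]
    refine mem_block.2 ⟨hH.mem_toFinset.2 (inr_mem_labels.2 hf), Linked.trans (t := Sum.inr e)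
      (Linked.of_adj ⟨he, hu.inc_left⟩ (hH.mem_toFinset.2 (inr_mem_labels.2 he))) h⟩
  rw [← Finset.mem_coe, block_toTokens hH ⟨le_rfl, fun _ _ _ _ h => h⟩ hu.left_mem] at hfb
  obtain ⟨-, ⟨z, -, hz⟩ | ⟨g, hg, hgf⟩⟩ := hfb
  · cases hz
  · obtain rfl := Sum.inr.inj hgf
    obtain ⟨z, z', hl, hz⟩ := mem_edgeSet_componentOf.1 hg
    rcases hx.left_eq_or_eq hl with rfl | rfl
    exacts [hz, hz.tail hl.adj]

/-- In a graph of the family, each component has at most one bundle. -/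
theorem IsGStar.bundlesSeparated (hG : IsGStar G) (hL : (labels G).Finite) :
    BundlesSeparated G hL.toFinset := by
  intro e f he hf hlinked u v huv
  have := hG.loopless
  by_contra hno
  obtain ⟨x, y, hxy⟩ := hf.exists_isLink
  have hreach : Relation.ReflTransGen G.Adj x u := reachable_of_linked hL hf he
    (hlinked.symm tokAdj_symm (hL.mem_toFinset.2 (inr_mem_labels.2 he))) hxy huv
  -- The forbidden configuration, applied to the component of `x` in a vertex set avoiding `u`, `v`,
  -- `y`: this component has no neighbor at `v`.
  have core : ∀ {u v x y : α} {e f : β}, IsMultiple G e → IsMultiple G f → G.IsLink e u v →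
      G.IsLink f x y → y ≠ u → ∀ X : Finset (α ⊕ β), (∀ r ∈ X, ∃ z ∈ V(G), r = Sum.inl z) →
      Sum.inl x ∈ X → Sum.inl u ∉ X → Sum.inl v ∉ X → Sum.inl y ∉ X →
      ∀ r ∈ block (tokAdj G) X (Sum.inl x), ¬ tokAdj G r (Sum.inl v) := by
    intro u v x y e f he hf huv hxy hyu X hX hxX huX hvX hyX r hr hrv
    obtain ⟨p, hpp, hpl⟩ := hf.exists_pair hxy
    obtain ⟨q, hqq, hql⟩ := he.exists_pair huv
    exact hG.false_of_two_bundles hqq (hql false) (hql true) hpp hpl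
      (I := block (tokAdj G) X (Sum.inl x)) (fun s hs => hX s (isClosedIn_block.1 hs))
      (mem_block.2 ⟨hxX, Linked.refl⟩) (fun h => huX (isClosedIn_block.1 h))
      (fun h => hvX (isClosedIn_block.1 h)) (fun h => hyX (isClosedIn_block.1 h)) hyu
      (fun s hs => linked_block (mem_block.1 hs).2) ⟨r, hr, hrv⟩
  -- bundles with a common end
  have hshare : ∀ {u v x : α} {e f : β}, IsMultiple G e → IsMultiple G f → G.IsLink e u v →
      G.IsLink f x v → x = u := by
    intro u v x e f he hf huv hxv
    by_contra hxu
    -- For two bundles sharing the end `v`, the connected set is just `{x}`, and `v` also plays the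
    -- role of `y`.
    refine core he hf huv hxv huv.ne.symm {Sum.inl x} ?_ (by simp) (by simpa using Ne.symm hxu)
      (by simpa using hxv.ne.symm) (by simpa using hxv.ne.symm) (Sum.inl x)
      (mem_block.2 ⟨by simp, Linked.refl⟩) hxv.adj
    intro r hr
    rw [Finset.mem_singleton] at hr
    exact ⟨x, hxv.left_mem, hr⟩
  have hyv : y ≠ v := by
    rintro rfl
    obtain rfl := hshare he hf huv hxy
    exact hno hxy
  have hyu : y ≠ u := by
    rintro rfl
    obtain rfl := hshare he hf huv.symm hxy
    exact hno hxy.symm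
  have hxv : x ≠ v := by
    rintro rfl
    exact hyu (hshare he hf huv hxy.symm)
  have hxu : x ≠ u := by
    rintro rfl
    exact hyv (hshare he hf huv.symm hxy.symm)
  -- disjoint bundles
  set T : α → Finset (α ⊕ β) := fun z =>
    (hG.finite_vertexSet.toFinset.image Sum.inl).filter
      (fun r => r ≠ Sum.inl u ∧ r ≠ Sum.inl v ∧ r ≠ Sum.inl z) with hT
  have hTmem : ∀ z t, Sum.inl t ∈ T z ↔ t ∈ V(G) ∧ t ≠ u ∧ t ≠ v ∧ t ≠ z := by
    intro z t
    simp [hT]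
  have hTv : ∀ z, ∀ r ∈ T z, ∃ t ∈ V(G), r = Sum.inl t := by
    intro z r hr
    obtain ⟨t, ht, rfl⟩ := Finset.mem_image.1 (Finset.mem_filter.1 hr).1
    exact ⟨t, hG.finite_vertexSet.mem_toFinset.1 ht, rfl⟩
  have hxT : Sum.inl x ∈ T y := (hTmem _ _).2 ⟨hxy.left_mem, hxu, hxv, hxy.ne⟩
  have hyT : Sum.inl y ∈ T x := (hTmem _ _).2 ⟨hxy.right_mem, hyu, hyv, hxy.ne.symm⟩
  -- Leaving the component of `x` in the graph without `u`, `v`, `y` leads only to `y`, since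
  -- `core`, applied with both orientations of `e`, forbids stepping to `u` or `v`.
  have hstep : ∀ {x y : α}, G.IsLink f x y → y ≠ u → y ≠ v → Sum.inl x ∈ T y → ∀ s t,
      Sum.inl s ∈ block (tokAdj G) (T y) (Sum.inl x) → G.Adj s t →
      Sum.inl t ∈ block (tokAdj G) (T y) (Sum.inl x) ∨ t = y := by
    intro x y hxy hyu hyv hxT s t hs hst
    by_cases hty : t = y
    · exact Or.inr hty
    left
    refine isClosedIn_block.2 _ hs _ ((hTmem _ _).2 ⟨hst.right_mem, ?_, ?_, hty⟩) hst
    · rintro rfl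
      exact core he hf huv.symm hxy hyv (T y) (hTv y) hxT (by simp [hTmem]) (by simp [hTmem])
        (by simp [hTmem]) _ hs hst
    · rintro rfl
      exact core he hf huv hxy hyu (T y) (hTv y) hxT (by simp [hTmem]) (by simp [hTmem])
        (by simp [hTmem]) _ hs hst
  -- A walk from `x` alternates between the component of `x` avoiding `y` and that of `y` avoiding
  -- `x`, so it never reaches `u`.
  have hall : ∀ z, Relation.ReflTransGen G.Adj x z →
      Sum.inl z ∈ block (tokAdj G) (T y) (Sum.inl x) ∨
        Sum.inl z ∈ block (tokAdj G) (T x) (Sum.inl y) := by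
    intro z hz
    induction hz with
    | refl => exact Or.inl (mem_block.2 ⟨hxT, Linked.refl⟩)
    | tail _ hst ih =>
      rcases ih with h | h
      · rcases hstep hxy hyu hyv hxT _ _ h hst with h | rfl
        exacts [Or.inl h, Or.inr (mem_block.2 ⟨hyT, Linked.refl⟩)]
      · rcases hstep hxy.symm hxu hxv hyT _ _ h hst with h | rfl
        exacts [Or.inr h, Or.inl (mem_block.2 ⟨hxT, Linked.refl⟩)]
  rcases hall u hreach with h | h
  · exact ((hTmem _ _).1 (isClosedIn_block.1 h)).2.1 rfl
  · exact ((hTmem _ _).1 (isClosedIn_block.1 h)).2.1 rfl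

end Obstruction

/-! ### Heredity of the two conditions, and the theorem. -/

section Subgraphs

variable {α β : Type*} [DecidableEq α] [DecidableEq β] {G H : Graph α β}

lemma tokAdj_mono (h : H ≤ G) : ∀ s t, tokAdj H s t → tokAdj G s t := by
  rintro (x | e) (y | f) hst
  · exact hst.mono h
  · exact ⟨hst.1.mono h, hst.2.mono h⟩
  · exact ⟨hst.1.mono h, hst.2.mono h⟩
  · exact hst

lemma BundlesSeparated.mono (h : H ≤ G) (hH : (labels H).Finite) (hL : (labels G).Finite)
    (hG : BundlesSeparated G hL.toFinset) : BundlesSeparated H hH.toFinset := by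
  intro e f he hf hl x y hxy
  obtain ⟨z, z', hz⟩ := hf.exists_isLink
  rw [h.isLink_iff hz.edge_mem]
  refine hG e f (he.mono h) (hf.mono h) ((hl.of_imp fun s _ t _ => tokAdj_mono h s t).mono ?_
    (hH.mem_toFinset.2 (inr_mem_labels.2 he))) x y (hxy.mono h)
  rintro (t | g) ht
  · exact hL.mem_toFinset.2 (inl_mem_labels.2 (h.vertexSet_mono
      (inl_mem_labels.1 (hH.mem_toFinset.1 ht))))
  · exact hL.mem_toFinset.2 (inr_mem_labels.2 ((inr_mem_labels.1 (hH.mem_toFinset.1 ht)).mono h))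

/-- Passing to a larger graph only merges components, which preserves both evenness and links, so a
violation in `H` is a violation in `G`. -/
lemma UniqueNeighbor.mono (h : H ≤ G) (hG : UniqueNeighbor G) : UniqueNeighbor H := by
  intro e u v he hl W hW hWev hu hv s hs t ht hsW htW hsu hsv htu htv hls hlt
  refine hG e u v (he.mono h) (hl.mono h) W ?_ (hWev.of_imp (fun s _ t _ => tokAdj_mono h s t)
    fun _ _ => rfl) hu hv s (h.vertexSet_mono hs) t (h.vertexSet_mono ht) hsW htW hsu hsv htu htv
    (hls.of_imp fun s _ t _ => tokAdj_mono h s t) (hlt.of_imp fun s _ t _ => tokAdj_mono h s t)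
  intro r hr
  obtain ⟨x, hx, rfl⟩ := hW r hr
  exact ⟨x, h.vertexSet_mono hx, rfl⟩

end Subgraphs
end EvenSubgraph

theorem theorem3p4 {α β : Type*} (G : Graph α β) (hG : EvenSubgraph.IsGStar G) :
    ∀ p ∈ EvenSubgraph.AStar G,
      EvenSubgraph.CLShellable (EvenSubgraph.EvenPoset p.1 p.2) := by
  classical
  rintro ⟨H, A⟩ ⟨hPI, hA⟩
  have hle := hPI.le
  have := hG.loopless
  have : H.Loopless := Graph.Loopless.anti hle
  have hL := EvenSubgraph.finite_labels hG.finite_vertexSet hG.finite_edgeSet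
  have hH := EvenSubgraph.finite_labels (hG.finite_vertexSet.subset hle.vertexSet_mono)
    (hG.finite_edgeSet.subset (Graph.IsSubgraph.edgeSet_mono hle))
  exact EvenSubgraph.clShellable_of_separated hH hA
    ((hG.bundlesSeparated hL).mono hle hH hL) (hG.uniqueNeighbor.mono hle)
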